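/- **Setting.** Let $n,m\ge 1$. An $(n,m)$-annulus is an annulus with $1,\dots,n$ placed in clockwise order on the exterior circle and $n+1,\dots,n+m$ placed in counterclockwise order on the interior circle. A permutation of $\{1,\dots,n+m\}$ is *annular noncrossing* if its cycles can be drawn inside the annulus by arrows $a\to\pi(a)$ such that no arrows cross and every cycle is a closed contour running clockwise around a disc contained in the annulus. A cycle (fixed points included) is *exterior* (resp. *interior*) if all its elements lie on the exterior (resp. interior) circle, and *connected* if it has elements on both circles; its exterior (interior) size is its number of elements on the exterior (interior) circle. Let $\mathrm{Par}(N,k)$ be the set of integer partitions of $N$ with exactly $k$ parts. Let $c\ge 1$, $r,s\ge 0$, $0\le R\le n$, $0\le S\le m$ be integers, and let $\alpha\in\mathrm{Par}(R,r)$, $\beta\in\mathrm{Par}(S,s)$, $\lambda\in\mathrm{Par}(n-R,c)$, $\mu\in\mathrm{Par}(m-S,c)$. Let $X=\mathrm{ANC}(n,m;c,r,s,R,S;\alpha,\beta,\lambda,\mu)$ be the set of annular noncrossing permutations that have at least one connected cycle, whose exterior cycles have sizes given by the parts of $\alpha$, whose interior cycles have sizes given by the parts of $\beta$, and whose connected cycles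 have exterior sizes given by the parts of $\lambda$ and interior sizes given by the parts of $\mu$ (all with multiplicity). Let $g=\gcd(n,m)$ and let $C$ be the cyclic group, of order $g$, of rotations of the annulus preserving the marked points. It is generated by the rotation sending $i$ to $i+n/g$ modulo $n$ on the exterior circle and $n+j$ to $n+(j-m/g)$, with $j - m/g$ taken modulo $m$, on the interior circle. It acts on permutations by relabelling the elements of the cycles (conjugation). Put $[k]_q=\frac{1-q^k}{1-q}$, $[k]_q!=[1]_q\cdots[k]_q$, $\binom{k}{j}_q=\frac{[k]_q!}{[j]_q!\,[k-j]_q!}$, and $\binom{k}{\nu}_q=\frac{[k]_q!}{[m_1]_q!\,[m_2]_q!\cdots}$ for a partition $\nu=(1^{m_1},2^{m_2},\dots)$ with $k$ parts. **Theorem.** The rational function $$X(q)=\frac{[(n-R)(m-S)]_q}{[c]_q}\binom{n}{r}_q\binom{m}{s}_q\binom{r}{\alpha}_q\binom{s}{\beta}_q\binom{c}{\lambda}_q\binom{c}{\mu}_q$$ is a polynomial in $q$, the finite set $X$ is stable under $C$, and $(X,X(q),C)$ exhibits the cyclic sieving phenomenon: for every embedding $w:C\to\mathbb{C}^\times$ and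 every $\rho\in C$, $$X(w(\rho))=\bigl|\{\pi\in X:\rho(\pi)=\pi\}\bigr|.$$ -/

import Mathlib

noncomputable section

namespace AnnularNC

/-- Noncrossing permutations of points placed on the boundary circle of a disc. The points are the
elements of a linearly ordered set `P`, listed clockwise (the circle being cut open somewhere). An
arrow is drawn from `x` to `f x` for each `x`. Every cycle is finite and is traversed clockwise: the
successor of `x` is the next element of its cycle after `x`, and the successor of the largest
element is the smallest. No two arrows cross, i.e. no two arrows have interleaved end points. -/
structure IsNoncrossing {P : Type*} [LinearOrder P] (f : Equiv.Perm P) : Prop where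
  finite_cycle : ∀ x, {y | f.SameCycle x y}.Finite
  clockwise_step : ∀ x y, f.SameCycle x y → x < f x → y ≤ x ∨ f x ≤ y
  clockwise_return : ∀ x y, f.SameCycle x y → f x ≤ x → f x ≤ y ∧ y ≤ x
  noncrossing : ∀ x y, ¬ (min x (f x) < min y (f y) ∧ min y (f y) < max x (f x) ∧
    max x (f x) < max y (f y))

/-- The marked points of the `(n,m)`-annulus. `Sum.inl i` is the point of the exterior circle whose
label in `{1, ..., n}` is congruent to `i` modulo `n` (clockwise order); `Sum.inr j` is the
point of the interior circle whose label in `{n+1, ..., n+m}` is congruent to `n + j` modulo `m`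
(counterclockwise order). -/
abbrev Point (n m : ℕ) : Type := ZMod n ⊕ ZMod m

/-- The marked points on the boundary of the universal cover of the annulus, which is a strip:
integers `inl x` on the exterior boundary line, followed by integers `inr y` on the interior
boundary line. As the interior points run counterclockwise in the annulus, the lexicographic order
lists these points clockwise around the boundary of the strip (a disc). -/
abbrev CoverPoint : Type := ℤ ⊕ₗ ℤ

/-- The covering map on marked points. -/
def proj (n m : ℕ) (x : CoverPoint) : Point n m :=
  Sum.map (fun i : ℤ => (i : ZMod n)) (fun j : ℤ => (j : ZMod m)) (ofLex x)

/-- The generating deck transformation of the strip: one clockwise turn around the annulus. It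
increases exterior positions by `n`, and decreases interior positions (which are numbered
counterclockwise) by `m`. -/
def deck (n m : ℕ) (x : CoverPoint) : CoverPoint :=
  toLex (Sum.map (fun i : ℤ => i + n) (fun j : ℤ => j - m) (ofLex x))

/-- A permutation of the marked points can be drawn in the `(n,m)`-annulus with every cycle drawn
as a closed contour running clockwise around a disc contained in the annulus, and without crossing
arrows. A drawing is recorded by its preimage in the universal cover: arrows in the annulus are
determined up to homotopy by the end points of their lifts, so the drawing is a permutation `f` of
the marked points of the strip that lifts `π`, is invariant under deck transformations, and is
noncrossing in the strip (its cycles, being finite, are the lifts of the closed contours). -/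
def IsAnnularNoncrossing {n m : ℕ} (π : Equiv.Perm (Point n m)) : Prop :=
  ∃ f : Equiv.Perm CoverPoint,
    (∀ x, f (deck n m x) = deck n m (f x)) ∧
    (∀ x, proj n m (f x) = π (proj n m x)) ∧
    IsNoncrossing f

section Types

variable {n m : ℕ} [NeZero n] [NeZero m]

open scoped Classical in
/-- The cycles of `π` (fixed points included), as sets of marked points. -/
def cycles (π : Equiv.Perm (Point n m)) : Finset (Finset (Point n m)) :=
  Finset.univ.image fun x => Finset.univ.filter fun y => π.SameCycle x y

/-- The number of exterior points in a set of marked points. -/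
def extSize (γ : Finset (Point n m)) : ℕ := (γ.filter fun x => x.isLeft).card

/-- The number of interior points in a set of marked points. -/
def intSize (γ : Finset (Point n m)) : ℕ := (γ.filter fun x => x.isRight).card

/-- The sizes of the exterior cycles, i.e. those without interior points. -/
def extCycleType (π : Equiv.Perm (Point n m)) : Multiset ℕ :=
  ((cycles π).filter fun γ => intSize γ = 0).val.map extSize

/-- The sizes of the interior cycles, i.e. those without exterior points. -/
def intCycleType (π : Equiv.Perm (Point n m)) : Multiset ℕ :=
  ((cycles π).filter fun γ => extSize γ = 0).val.map intSize

/-- The connected cycles: those with an exterior and an interior point. -/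
def connectedCycles (π : Equiv.Perm (Point n m)) : Finset (Finset (Point n m)) :=
  (cycles π).filter fun γ => 0 < extSize γ ∧ 0 < intSize γ

/-- The exterior sizes of the connected cycles. -/
def connExtCycleType (π : Equiv.Perm (Point n m)) : Multiset ℕ :=
  (connectedCycles π).val.map extSize

/-- The interior sizes of the connected cycles. -/
def connIntCycleType (π : Equiv.Perm (Point n m)) : Multiset ℕ :=
  (connectedCycles π).val.map intSize

end Types

/-- Connected `(n,m)`-annular noncrossing permutations. -/
def ANC (n m : ℕ) [NeZero n] [NeZero m] : Set (Equiv.Perm (Point n m)) :=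
  {π | IsAnnularNoncrossing π ∧ (connectedCycles π).Nonempty}

/-- Connected `(n,m)`-annular noncrossing permutations with exterior cycle type `α`, interior
cycle type `β`, connected exterior cycle type `lam` and connected interior cycle type `mu`. -/
def ANCOfType (n m : ℕ) [NeZero n] [NeZero m] {R S N M : ℕ} (α : Nat.Partition R)
    (β : Nat.Partition S) (lam : Nat.Partition N) (mu : Nat.Partition M) :
    Set (Equiv.Perm (Point n m)) :=
  {π | π ∈ ANC n m ∧ extCycleType π = α.parts ∧ intCycleType π = β.parts ∧
    connExtCycleType π = lam.parts ∧ connIntCycleType π = mu.parts}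

/-- The smallest clockwise rotation of the annulus that preserves the set of exterior points and
the set of interior points: with `g = gcd n m`, the rotation by the `g`-th part of a full turn. It
moves the exterior labels forward by `n / g` and the interior labels (which are in counterclockwise
order) backward by `m / g`. -/
def rotation (n m : ℕ) : Equiv.Perm (Point n m) :=
  Equiv.sumCongr (Equiv.addRight ((n / Nat.gcd n m : ℕ) : ZMod n))
    (Equiv.subRight ((m / Nat.gcd n m : ℕ) : ZMod m))

/-- The cyclic group of annular rotations, acting on permutations of the marked points by
relabelling the entries of all cycles, that is, by conjugation. -/
abbrev rotationGroup (n m : ℕ) : Subgroup (ConjAct (Equiv.Perm (Point n m))) :=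
  Subgroup.zpowers (ConjAct.toConjAct (rotation n m))

/-- The cyclic sieving phenomenon for a group `C` acting on a subset `X` of a `C`-set `Y`. `C` is
finite and cyclic, `X` is finite and stable under `C`, and for embeddings `w : C → ℂˣ`, the
value of the polynomial `P` at `w c` is the number of elements of `X` fixed by `c`. (An embedding
sends each generator of `C` to a primitive root of unity of order the order of `C`.) -/
structure ExhibitsCSP {Y : Type*} (X : Set Y) (P : Polynomial ℂ) (C : Type*) [Group C]
    [MulAction C Y] : Prop where
  finite_group : Finite C
  cyclic : IsCyclic C
  finite_set : X.Finite
  smul_mem : ∀ c : C, ∀ x ∈ X, c • x ∈ X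
  eval_eq : ∀ w : C →* ℂˣ, Function.Injective w → ∀ c : C,
    P.eval (w c : ℂ) = (Set.ncard {x | x ∈ X ∧ c • x = x} : ℂ)

/-- `[k]_q = (1 - q^k) / (1 - q)`, as a rational function of `q`. -/
def qInt (k : ℕ) : RatFunc ℂ := (1 - RatFunc.X ^ k) / (1 - RatFunc.X)

/-- `[k]_q! = [1]_q [2]_q ... [k]_q`. -/
def qFactorial (k : ℕ) : RatFunc ℂ := ∏ i ∈ Finset.Icc 1 k, qInt i

/-- The `q`-binomial coefficient `[k]_q! / ([j]_q! [k-j]_q!)` for `j ≤ k`, and `0` for `j > k`. -/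
def qBinom (k j : ℕ) : RatFunc ℂ :=
  if j ≤ k then qFactorial k / (qFactorial j * qFactorial (k - j)) else 0

/-- The `q`-multinomial coefficient `[k]_q! / ([m_1]_q! [m_2]_q! ...)` for a partition
`(1^{m_1}, 2^{m_2}, ...)` with `k` parts. -/
def qMultinom {N : ℕ} (k : ℕ) (lam : Nat.Partition N) : RatFunc ℂ :=
  qFactorial k / ∏ i ∈ lam.parts.toFinset, qFactorial (lam.parts.count i)

end AnnularNC

end

/-!
A drawing of an annular noncrossing permutation is lifted to the universal cover of the annulus, a
strip with marked points on two boundary lines, where it is a periodic noncrossing permutation. The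
drawing is determined by its partition into cycles (`IsNoncrossing.eq_of_sameCycle_iff`), and it is
encoded by periodic functions, in the spirit of the cycle lemma.

On each boundary line `s`, let `φ s` be the function whose value at the first point of a cycle
contained in the line is the size of this cycle, and whose other values are `0`. The height function
with increments `1 - φ s` climbs by at most `1` per step, and by the number `N s` of points of
connected cycles per turn. The points of connected cycles are exactly the records of the height
function, and any other point lies on the cycle that starts at the last earlier point of at least
the height reached (`IsNoncrossing.isRecord_iff`, `IsNoncrossing.opens_iff`). There is one record at
each height, so the connected cycles cut the heights of both lines into intervals. They are recorded
by the sizes `a s` of these intervals and, once one connected cycle is distinguished, by the heights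
`x s` at which its parts on the two lines start. Conversely, all such functions come from drawings
(`IsShape.exists_model`). In this way, the pairs of a permutation with prescribed cycle sizes and one
of its `c` connected cycles correspond to triples `(φ, a, x)` in which `φ s` runs through the
arrangements of a given multiset around the circle `s`, `a s` runs through the arrangements of the
parts of `λ` or `μ` around a cycle of length `c`, and `x s` is one of `N s` numbers, all chosen
independently.

The encoding is compatible with rotations. The permutation is invariant under the rotation of order
`d` if and only if the functions `φ s` and `a s` are invariant under rotations of order `d`; the
heights `x s` are not restricted. Hence `c` times the number of invariant permutations is the
number of invariant triples (`mul_ncard_fixed`), which is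
`N true * N false` times a product of numbers of invariant arrangements (`ncard_data`), or `0` if `d`
does not divide `c`.

On the other side, a `q`-multinomial coefficient, evaluated at a primitive `d`-th root of unity, is
the number of arrangements invariant under the rotation of order `d` (`eval_qMult`). The product of a
`q`-binomial and a `q`-multinomial coefficient in the sieving polynomial is one `q`-multinomial
coefficient, for the multiset of values of `φ s`, zeros included
(`algebraMap_qMult_add_replicate`). If the coefficient for `φ true` does not vanish at the root of
unity, then `d` divides `N true`, so `[N true * N false]_q / [c]_q` takes the value
`N true * N false / c` if `d` divides `c`, and `0` otherwise. The two counts agree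
(`IsAdmissible.mul_eval_eq`). The same dichotomy, applied to the coefficient for `λ`, shows that the
rational function is a polynomial (`IsAdmissible.exists_quotient`).
-/

namespace AnnularNC

/-! ### Noncrossing permutations and noncrossing partitions -/

section Noncrossing

variable {P : Type*} [LinearOrder P]

/-- The partition into cycles of a noncrossing permutation is noncrossing. -/
theorem IsNoncrossing.sameCycle_of_lt {f : Equiv.Perm P} (hf : IsNoncrossing f) {a b c d : P}
    (hab : a < b) (hbc : b < c) (hcd : c < d) (hac : f.SameCycle a c) (hbd : f.SameCycle b d) :
    f.SameCycle a b := by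
  by_contra hne
  -- `x` is the last point of the cycle of `a` before `b`
  have hA : {y | f.SameCycle a y ∧ y < b}.Finite := (hf.finite_cycle a).subset fun y hy => hy.1
  obtain ⟨x, ⟨hx, hxb⟩, hxm⟩ := Set.exists_max_image _ id hA ⟨a, .refl _ _, hab⟩
  have hxfx : x < f x := by
    by_contra h
    have := (hf.clockwise_return x c (hx.symm.trans hac) (not_lt.1 h)).2
    exact absurd (hxb.trans hbc) (not_lt.2 this)
  have hfx : f.SameCycle a (f x) := hx.trans (Equiv.Perm.sameCycle_apply_right.2 (.refl _ _))
  have hbfx : b < f x := by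
    rcases lt_trichotomy b (f x) with h | h | h
    · exact h
    · exact absurd (h ▸ hfx) hne
    · exact absurd (hxm (f x) ⟨hfx, h⟩) (not_le.2 hxfx)
  have hfxc : f x ≤ c :=
    (hf.clockwise_step x c (hx.symm.trans hac) hxfx).resolve_left (not_le.2 (hxb.trans hbc))
  -- `y` is the last point of the cycle of `b` before `f x`
  have hB : {y | f.SameCycle b y ∧ y < f x}.Finite := (hf.finite_cycle b).subset fun y hy => hy.1
  obtain ⟨y, ⟨hy, hyx⟩, hym⟩ := Set.exists_max_image _ id hB ⟨b, .refl _ _, hbfx⟩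
  have hby : b ≤ y := hym b ⟨.refl _ _, hbfx⟩
  have hyfy : y < f y := by
    by_contra h
    have := (hf.clockwise_return y d (hy.symm.trans hbd) (not_lt.1 h)).2
    exact absurd (hyx.trans_le (hfxc.trans hcd.le)) (not_lt.2 this)
  have hfy : f.SameCycle b (f y) := hy.trans (Equiv.Perm.sameCycle_apply_right.2 (.refl _ _))
  have hfxy : f x < f y := by
    rcases lt_trichotomy (f x) (f y) with h | h | h
    · exact h
    · exact absurd (hfx.trans (h ▸ hfy.symm)) hne
    · exact absurd (hym (f y) ⟨hfy, h⟩) (not_le.2 hyfy)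
  refine hf.noncrossing x y ⟨?_, ?_, ?_⟩
  · rw [min_eq_left hxfx.le, min_eq_left hyfy.le]; exact hxb.trans_le hby
  · rw [max_eq_right hxfx.le, min_eq_left hyfy.le]; exact hyx
  · rw [max_eq_right hxfx.le, max_eq_right hyfy.le]; exact hfxy

/-- A noncrossing permutation is determined by its partition into cycles. -/
theorem IsNoncrossing.eq_of_sameCycle_iff {f g : Equiv.Perm P} (hf : IsNoncrossing f)
    (hg : IsNoncrossing g) (h : ∀ x y, f.SameCycle x y ↔ g.SameCycle x y) : f = g := by
  ext x
  have hfx : g.SameCycle x (f x) := (h _ _).1 (Equiv.Perm.sameCycle_apply_right.2 (.refl _ _))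
  have hgx : f.SameCycle x (g x) := (h _ _).2 (Equiv.Perm.sameCycle_apply_right.2 (.refl _ _))
  rcases lt_or_ge x (f x) with h1 | h1 <;> rcases lt_or_ge x (g x) with h2 | h2
  · exact le_antisymm ((hf.clockwise_step x _ hgx h1).resolve_left (not_le.2 h2))
      ((hg.clockwise_step x _ hfx h2).resolve_left (not_le.2 h1))
  · exact absurd (hg.clockwise_return x _ hfx h2).2 (not_le.2 h1)
  · exact absurd (hf.clockwise_return x _ hgx h1).2 (not_le.2 h2)
  · exact le_antisymm (hf.clockwise_return x _ hgx h1).1 (hg.clockwise_return x _ hfx h2).1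

theorem sameCycle_conj_iff {P Q : Type*} (e : P ≃ Q) (f : Equiv.Perm P) (x y : Q) :
    Equiv.Perm.SameCycle (e.permCongr f) x y ↔ f.SameCycle (e.symm x) (e.symm y) := by
  have key : ∀ i : ℤ, (e.permCongr f) ^ i = e.permCongr (f ^ i) := fun i => by
    have := map_zpow (e.permCongrHom) f i
    simpa using this.symm
  simp only [Equiv.Perm.SameCycle, key, Equiv.permCongr_apply, ← Equiv.eq_symm_apply]

/-- Noncrossing permutations are preserved under conjugation by order isomorphisms. -/
theorem IsNoncrossing.conj {Q : Type*} [LinearOrder Q] {f : Equiv.Perm P} (hf : IsNoncrossing f)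
    (e : P ≃o Q) : IsNoncrossing (e.toEquiv.permCongr f) where
  finite_cycle x := by
    refine ((hf.finite_cycle (e.symm x)).image e).subset fun y hy => ?_
    exact ⟨e.symm y, (sameCycle_conj_iff e.toEquiv f x y).1 hy, by simp⟩
  clockwise_step x y hxy hx := by
    have h1 := (sameCycle_conj_iff e.toEquiv f x y).1 hxy
    have h2 : e.symm x < f (e.symm x) := by
      rw [← e.lt_iff_lt]; simpa using hx
    rcases hf.clockwise_step _ _ h1 h2 with h | h
    · left; exact e.symm.le_iff_le.1 h
    · right; have := e.le_iff_le.2 h; simpa using this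
  clockwise_return x y hxy hx := by
    have h1 := (sameCycle_conj_iff e.toEquiv f x y).1 hxy
    have h2 : f (e.symm x) ≤ e.symm x := by
      rw [← e.le_iff_le]; simpa using hx
    obtain ⟨h3, h4⟩ := hf.clockwise_return _ _ h1 h2
    refine ⟨?_, e.symm.le_iff_le.1 h4⟩
    have := e.le_iff_le.2 h3; simpa using this
  noncrossing x y h := by
    obtain ⟨x, rfl⟩ := e.surjective x
    obtain ⟨y, rfl⟩ := e.surjective y
    have hm : StrictMono e := e.strictMono
    have key : ∀ z, (e.toEquiv.permCongr f) (e z) = e (f z) := fun z => by simp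
    simp only [key, ← hm.monotone.map_min, ← hm.monotone.map_max, hm.lt_iff_lt] at h
    exact hf.noncrossing x y h

/-- A noncrossing permutation whose cycle partition is invariant under an order automorphism
commutes with it. -/
theorem IsNoncrossing.commute_of_invariant {f : Equiv.Perm P} (hf : IsNoncrossing f) (e : P ≃o P)
    (h : ∀ x y, f.SameCycle (e x) (e y) ↔ f.SameCycle x y) (x : P) : f (e x) = e (f x) := by
  have : e.toEquiv.permCongr f = f := by
    refine (hf.conj e).eq_of_sameCycle_iff hf fun x y => ?_
    rw [sameCycle_conj_iff, ← h]
    simp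
  conv_lhs => rw [← this]
  simp

/-- A noncrossing partition into finite blocks, given as the partition into the fibres of a
function, is the cycle partition of a noncrossing permutation. -/
theorem exists_isNoncrossing_of_key {K : Type*} (κ : P → K) (hfin : ∀ x, {y | κ y = κ x}.Finite)
    (hnc : ∀ a b c d, a < b → b < c → c < d → κ a = κ c → κ b = κ d → κ a = κ b) :
    ∃ f : Equiv.Perm P, IsNoncrossing f ∧ ∀ x y, f.SameCycle x y ↔ κ x = κ y := by
  classical
  -- the clockwise successor of a point within its block
  have hsucc : ∀ x, ∃ y, κ y = κ x ∧ (x < y → ∀ z, κ z = κ x → z ≤ x ∨ y ≤ z) ∧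
      (y ≤ x → ∀ z, κ z = κ x → y ≤ z ∧ z ≤ x) := by
    intro x
    by_cases hx : ∃ y, κ y = κ x ∧ x < y
    · have hA : {y | κ y = κ x ∧ x < y}.Finite := (hfin x).subset fun y hy => hy.1
      obtain ⟨y, ⟨hy, hxy⟩, hym⟩ := Set.exists_min_image _ id hA hx
      refine ⟨y, hy, fun _ z hz => ?_, fun h => absurd hxy (not_lt.2 h)⟩
      rcases le_or_gt z x with h | h
      · exact .inl h
      · exact .inr (hym z ⟨hz, h⟩)
    · push Not at hx
      obtain ⟨y, hy, hym⟩ := Set.exists_min_image _ id (hfin x) ⟨x, rfl⟩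
      exact ⟨y, hy, fun h => absurd (hx y hy) (not_le.2 h), fun _ z hz => ⟨hym z hz, hx z hz⟩⟩
  choose g hgκ hstep hret using hsucc
  have hinj : Function.Injective g := by
    intro x y hxy
    have hκ : κ x = κ y := by rw [← hgκ x, hxy, hgκ]
    rcases lt_or_ge x (g x) with h1 | h1 <;> rcases lt_or_ge y (g y) with h2 | h2
    · exact le_antisymm ((hstep y h2 x hκ).resolve_right (not_le.2 (hxy ▸ h1)))
        ((hstep x h1 y hκ.symm).resolve_right (not_le.2 (hxy ▸ h2)))
    · exact absurd ((hret y h2 x hκ).1.trans_lt h1) (by rw [hxy]; exact lt_irrefl _)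
    · exact absurd ((hret x h1 y hκ.symm).1.trans_lt h2) (by rw [hxy]; exact lt_irrefl _)
    · exact le_antisymm (hret y h2 x hκ).2 (hret x h1 y hκ.symm).2
  -- `g` maps each block to itself, injectively, and the blocks are finite
  have hsurj : Function.Surjective g := by
    intro y
    have hm : Set.MapsTo g {z | κ z = κ y} {z | κ z = κ y} := fun z hz => (hgκ z).trans hz
    obtain ⟨x, -, hx⟩ := (((hfin y).injOn_iff_bijOn_of_mapsTo hm).1 hinj.injOn).surjOn
      (show y ∈ {z | κ z = κ y} from rfl)
    exact ⟨x, hx⟩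
  let f : Equiv.Perm P := Equiv.ofBijective g ⟨hinj, hsurj⟩
  have hfg : ∀ x, f x = g x := fun _ => rfl
  have hpow : ∀ (i : ℕ) x, κ ((f ^ i) x) = κ x := by
    intro i
    induction i with
    | zero => simp
    | succ i ih => intro x; rw [pow_succ, Equiv.Perm.mul_apply, ih, hfg, hgκ]
  have hsame : ∀ x y, f.SameCycle x y → κ x = κ y := by
    rintro x y ⟨i, rfl⟩
    obtain ⟨i, rfl | rfl⟩ := i.eq_nat_or_neg
    · rw [zpow_natCast, hpow]
    · rw [zpow_neg, zpow_natCast]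
      conv_lhs => rw [← (f ^ i).apply_symm_apply x, hpow]
      rfl
  -- every point is connected to the largest point of its block
  have hmax : ∀ (k : ℕ) x M, κ M = κ x → (∀ z, κ z = κ x → z ≤ M) →
      {z | κ z = κ x ∧ x < z}.ncard = k → f.SameCycle x M := by
    intro k
    induction k using Nat.strong_induction_on with
    | _ k ih =>
      intro x M hM hMm hk
      rcases (hMm x rfl).eq_or_lt with rfl | hlt
      · exact .refl _ _
      have h1 : x < g x := by
        by_contra h
        exact absurd hlt (not_lt.2 (hret x (not_lt.1 h) M hM).2)
      have h2 : f.SameCycle (g x) M := by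
        refine ih _ ?_ (g x) M (hM.trans (hgκ x).symm) (fun z hz => hMm z (hz.trans (hgκ x))) rfl
        rw [← hk]
        refine Set.ncard_lt_ncard ?_ ((hfin x).subset fun y hy => hy.1)
        refine ⟨fun z hz => ⟨hz.1.trans (hgκ x), h1.trans hz.2⟩, fun h => ?_⟩
        exact absurd (h ⟨hgκ x, h1⟩).2 (lt_irrefl _)
      exact (Equiv.Perm.sameCycle_apply_left (f := f)).1 h2
  have hiff : ∀ x y, f.SameCycle x y ↔ κ x = κ y := by
    refine fun x y => ⟨hsame x y, fun h => ?_⟩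
    obtain ⟨M, hM, hMm⟩ := Set.exists_max_image _ id (hfin x) ⟨x, rfl⟩
    have hx := hmax _ x M hM hMm rfl
    have hy := hmax _ y M (hM.trans h) (fun z hz => hMm z (hz.trans h.symm)) rfl
    exact hx.trans hy.symm
  refine ⟨f, ⟨fun x => ?_, fun x y hxy hx => ?_, fun x y hxy hx => ?_, fun x y => ?_⟩, hiff⟩
  · simpa only [hiff, eq_comm] using hfin x
  · exact hstep x hx y ((hiff _ _).1 hxy).symm
  · exact hret x hx y ((hiff _ _).1 hxy).symm
  · rintro ⟨h1, h2, h3⟩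
    have hmin : ∀ z, κ (min z (f z)) = κ z := fun z => by
      rcases min_choice z (f z) with h | h <;> rw [h]
      exact hgκ z
    have hmax' : ∀ z, κ (max z (f z)) = κ z := fun z => by
      rcases max_choice z (f z) with h | h <;> rw [h]
      exact hgκ z
    -- crossing arrows have interleaved end points, so they belong to the same block
    have hκ : κ x = κ y := by
      have := hnc _ _ _ _ h1 h2 h3 (by rw [hmin, hmax']) (by rw [hmin, hmax'])
      rwa [hmin, hmin] at this
    rcases lt_or_ge x (f x) with h | h
    · rw [min_eq_left h.le] at h1
      rw [max_eq_right h.le] at h2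
      rcases hstep x h _ ((hmin y).trans hκ.symm) with h' | h'
      · exact absurd h1 (not_lt.2 h')
      · exact absurd h2 (not_lt.2 h')
    · rw [max_eq_left h] at h3
      exact absurd h3 (not_lt.2 (hret x h _ ((hmax' y).trans hκ.symm)).2)

end Noncrossing


/-! ### The universal cover of the annulus -/

section Strip

/-- The point at position `t` on the exterior (`s = true`) or interior (`s = false`) boundary line
of the strip. The two boundary lines are indexed by `Bool` in order to treat them uniformly. -/
def pt (s : Bool) (t : ℤ) : CoverPoint := bif s then toLex (.inl t) else toLex (.inr t)

/-- The direction of the deck transformation on the two boundary lines. -/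
def sg (s : Bool) : ℤ := bif s then 1 else -1

/-- The number of marked points on the two boundary circles. -/
def per (n m : ℕ) (s : Bool) : ℕ := bif s then n else m

theorem exists_pt (x : CoverPoint) : ∃ s t, x = pt s t := by
  obtain ⟨x | x, rfl⟩ := toLex.surjective x
  exacts [⟨true, x, rfl⟩, ⟨false, x, rfl⟩]

@[simp] theorem pt_lt_pt {s : Bool} {i j : ℤ} : pt s i < pt s j ↔ i < j := by
  cases s
  exacts [Sum.Lex.inr_lt_inr_iff, Sum.Lex.inl_lt_inl_iff]

@[simp] theorem pt_le_pt {s : Bool} {i j : ℤ} : pt s i ≤ pt s j ↔ i ≤ j := by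
  cases s
  exacts [Sum.Lex.inr_le_inr_iff, Sum.Lex.inl_le_inl_iff]

theorem pt_true_lt_pt_false (i j : ℤ) : pt true i < pt false j := Sum.Lex.inl_lt_inr _ _

@[simp] theorem pt_inj {s s' : Bool} {i j : ℤ} : pt s i = pt s' j ↔ s = s' ∧ i = j := by
  cases s <;> cases s' <;> simp [pt]

theorem pt_injective (s : Bool) : Function.Injective (pt s) := fun _ _ h => (pt_inj.1 h).2

/-- Translation of the two boundary lines by the amounts `v true` and `v false`. -/
def shift (v : Bool → ℤ) : CoverPoint ≃o CoverPoint :=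
  OrderIso.sumLexCongr (OrderIso.addRight (v true)) (OrderIso.addRight (v false))

@[simp] theorem shift_pt (v : Bool → ℤ) (s : Bool) (t : ℤ) : shift v (pt s t) = pt s (t + v s) := by
  cases s <;> rfl

theorem shift_shift (v w : Bool → ℤ) (x : CoverPoint) : shift v (shift w x) = shift (w + v) x := by
  obtain ⟨s, t, rfl⟩ := exists_pt x
  simp [add_assoc]

@[simp] theorem shift_zero (x : CoverPoint) : shift 0 x = x := by
  obtain ⟨s, t, rfl⟩ := exists_pt x
  simp

/-- The translation vector of the `k`-th power of the deck transformation. -/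
def deckVec (n m : ℕ) (k : ℤ) (s : Bool) : ℤ := k * (sg s * per n m s)

theorem deckVec_add (n m : ℕ) (k l : ℤ) : deckVec n m (k + l) = deckVec n m k + deckVec n m l := by
  ext s; simp [deckVec]; ring

theorem deckVec_zero (n m : ℕ) : deckVec n m 0 = 0 := by
  ext s; simp [deckVec]

theorem deck_eq_shift (n m : ℕ) (x : CoverPoint) : deck n m x = shift (deckVec n m 1) x := by
  obtain ⟨s, t, rfl⟩ := exists_pt x
  cases s <;> simp [deckVec, sg, per] <;> rfl

theorem dvd_deckVec (n m : ℕ) (k : ℤ) (s : Bool) : (per n m s : ℤ) ∣ deckVec n m k s :=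
  Dvd.intro_left (k * sg s) (by simp [deckVec, mul_assoc])

theorem exists_deckVec_eq {n m : ℕ} {s : Bool} {a : ℤ} (h : (per n m s : ℤ) ∣ a) :
    ∃ k, deckVec n m k s = a := by
  obtain ⟨k, rfl⟩ := h
  refine ⟨k * sg s, ?_⟩
  cases s <;> simp [deckVec, sg, mul_comm]

theorem proj_pt_eq_iff {n m : ℕ} {s s' : Bool} {i j : ℤ} :
    proj n m (pt s i) = proj n m (pt s' j) ↔ s = s' ∧ (per n m s : ℤ) ∣ j - i := by
  cases s <;> cases s' <;> simp [proj, pt, per, ZMod.intCast_eq_intCast_iff_dvd_sub]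

/-- The fibres of the covering map are the orbits of the deck transformations. -/
theorem proj_eq_iff {n m : ℕ} {x y : CoverPoint} :
    proj n m x = proj n m y ↔ ∃ k, y = shift (deckVec n m k) x := by
  obtain ⟨s, i, rfl⟩ := exists_pt x
  obtain ⟨s', j, rfl⟩ := exists_pt y
  rw [proj_pt_eq_iff]
  constructor
  · rintro ⟨rfl, h⟩
    obtain ⟨k, hk⟩ := exists_deckVec_eq h
    exact ⟨k, by simp [hk]⟩
  · rintro ⟨k, hk⟩
    simp only [shift_pt, pt_inj] at hk
    obtain ⟨rfl, rfl⟩ := hk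
    exact ⟨rfl, by simpa using dvd_deckVec n m k s'⟩

theorem proj_shift_deckVec (n m : ℕ) (k : ℤ) (x : CoverPoint) :
    proj n m (shift (deckVec n m k) x) = proj n m x := (proj_eq_iff.2 ⟨k, rfl⟩).symm

theorem proj_surjective (n m : ℕ) : Function.Surjective (proj n m) := by
  rintro (x | x)
  · obtain ⟨t, rfl⟩ := ZMod.intCast_surjective x
    exact ⟨pt true t, rfl⟩
  · obtain ⟨t, rfl⟩ := ZMod.intCast_surjective x
    exact ⟨pt false t, rfl⟩

end Strip

/-! ### Drawings in the universal cover -/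

section Lift

/-- A symmetry of a permutation permutes its cycles. -/
theorem sameCycle_comm_iff {P : Type*} {f : Equiv.Perm P} {e : P ≃ P} (h : ∀ x, f (e x) = e (f x))
    (x y : P) : f.SameCycle (e x) (e y) ↔ f.SameCycle x y := by
  have : e.permCongr f = f := by
    ext x
    rw [Equiv.permCongr_apply, ← h, Equiv.apply_symm_apply]
  conv_lhs => rw [← this]
  rw [sameCycle_conj_iff]
  simp

/-- `f` is a drawing of `π` in the universal cover. -/
structure IsDrawing {n m : ℕ} (f : Equiv.Perm CoverPoint) (π : Equiv.Perm (Point n m)) : Prop where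
  deck_comm : ∀ x, f (deck n m x) = deck n m (f x)
  proj_apply : ∀ x, proj n m (f x) = π (proj n m x)
  noncrossing : IsNoncrossing f

variable {n m : ℕ} {f : Equiv.Perm CoverPoint} {π : Equiv.Perm (Point n m)}

theorem apply_shift_deckVec (h : ∀ x, f (deck n m x) = deck n m (f x)) (k : ℤ) (x : CoverPoint) :
    f (shift (deckVec n m k) x) = shift (deckVec n m k) (f x) := by
  simp only [deck_eq_shift] at h
  induction k using Int.induction_on generalizing x with
  | zero => simp [deckVec_zero]
  | succ k ih => rw [deckVec_add, ← shift_shift, h, ih, shift_shift]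
  | pred k ih =>
    apply (shift (deckVec n m 1)).injective
    rw [← h, shift_shift, shift_shift, ← deckVec_add, sub_add_cancel, ih]

theorem IsDrawing.apply_shift (h : IsDrawing f π) (k : ℤ) (x : CoverPoint) :
    f (shift (deckVec n m k) x) = shift (deckVec n m k) (f x) :=
  apply_shift_deckVec h.deck_comm k x

theorem IsDrawing.proj_pow_apply (h : IsDrawing f π) (i : ℤ) (x : CoverPoint) :
    proj n m ((f ^ i) x) = (π ^ i) (proj n m x) := by
  induction i using Int.induction_on generalizing x with
  | zero => simp
  | succ k ih => simp only [zpow_add, zpow_one, Equiv.Perm.mul_apply, ih, h.proj_apply]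
  | pred k ih =>
    simp only [zpow_sub, zpow_one, Equiv.Perm.mul_apply, ih]
    congr 1
    rw [Equiv.Perm.eq_inv_iff_eq, ← h.proj_apply]
    simp

theorem IsDrawing.proj_inv_apply (h : IsDrawing f π) (x : CoverPoint) :
    proj n m (f⁻¹ x) = π⁻¹ (proj n m x) := by
  simpa using h.proj_pow_apply (-1) x

/-- An equivariant permutation of the marked points of the strip descends to the annulus. -/
theorem exists_isDrawing (h : ∀ x, f (deck n m x) = deck n m (f x)) (hf : IsNoncrossing f) :
    ∃ π : Equiv.Perm (Point n m), IsDrawing f π := by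
  have key := apply_shift_deckVec h
  have key' : ∀ (k : ℤ) x, f⁻¹ (shift (deckVec n m k) x) = shift (deckVec n m k) (f⁻¹ x) := by
    intro k x
    rw [Equiv.Perm.inv_eq_iff_eq, key]
    simp
  obtain ⟨s, hs⟩ := (proj_surjective n m).hasRightInverse
  have hsp : ∀ x, ∃ k, s (proj n m x) = shift (deckVec n m k) x := fun x =>
    proj_eq_iff.1 (hs _).symm
  refine ⟨⟨fun p => proj n m (f (s p)), fun p => proj n m (f⁻¹ (s p)), fun p => ?_, fun p => ?_⟩,
    h, fun x => ?_, hf⟩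
  · obtain ⟨k, hk⟩ := hsp (f (s p))
    simp [hk, key', proj_shift_deckVec, hs p]
  · obtain ⟨k, hk⟩ := hsp (f⁻¹ (s p))
    change proj n m (f (s (proj n m (f⁻¹ (s p))))) = p
    rw [hk, key]
    simp [proj_shift_deckVec, hs p]
  · obtain ⟨k, hk⟩ := hsp x
    change _ = proj n m (f (s (proj n m x)))
    rw [hk, key, proj_shift_deckVec]

theorem IsDrawing.sameCycle_shift (h : IsDrawing f π) (k : ℤ) (x y : CoverPoint) :
    f.SameCycle (shift (deckVec n m k) x) (shift (deckVec n m k) y) ↔ f.SameCycle x y :=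
  sameCycle_comm_iff (e := (shift (deckVec n m k)).toEquiv) (h.apply_shift k) x y

theorem IsDrawing.sameCycle_proj (h : IsDrawing f π) (x y : CoverPoint) :
    π.SameCycle (proj n m x) (proj n m y) ↔ ∃ k, f.SameCycle x (shift (deckVec n m k) y) := by
  constructor
  · rintro ⟨i, hi⟩
    rw [← h.proj_pow_apply] at hi
    obtain ⟨k, hk⟩ := proj_eq_iff.1 hi.symm
    exact ⟨k, i, hk⟩
  · rintro ⟨k, i, hi⟩
    refine ⟨i, ?_⟩
    rw [← h.proj_pow_apply, hi, proj_shift_deckVec]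

/-- A cycle of a drawing is finite, hence disjoint from its translates. -/
theorem IsDrawing.eq_zero_of_sameCycle_shift [NeZero n] [NeZero m] (h : IsDrawing f π) {k : ℤ}
    {x : CoverPoint} (hk : f.SameCycle x (shift (deckVec n m k) x)) : k = 0 := by
  by_contra hk0
  -- otherwise the cycle contains infinitely many translates of `x`
  have hj : ∀ j : ℕ, f.SameCycle x (shift (deckVec n m (j * k)) x) := by
    intro j
    induction j with
    | zero => simpa [deckVec_zero] using Equiv.Perm.SameCycle.refl f x
    | succ j ih =>
      refine ih.trans ?_
      rw [← h.sameCycle_shift (j * k), shift_shift, ← deckVec_add] at hk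
      rwa [show ((j + 1 : ℕ) : ℤ) * k = k + j * k by push_cast; ring]
  refine Set.infinite_of_injective_forall_mem (f := fun j : ℕ => shift (deckVec n m (j * k)) x) ?_ hj
    (h.noncrossing.finite_cycle x)
  intro i j hij
  obtain ⟨s, t, rfl⟩ := exists_pt x
  have hn : n ≠ 0 := NeZero.ne n
  have hm : m ≠ 0 := NeZero.ne m
  cases s <;> simpa [deckVec, sg, per, hk0, hn, hm] using hij

theorem IsDrawing.eq_of_sameCycle [NeZero n] [NeZero m] (h : IsDrawing f π) {x y : CoverPoint}
    (hxy : f.SameCycle x y) (hp : proj n m x = proj n m y) : x = y := by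
  obtain ⟨k, rfl⟩ := proj_eq_iff.1 hp
  simp [h.eq_zero_of_sameCycle_shift hxy, deckVec_zero]

/-- The rotation of the annulus by the amounts `v true` and `v false` on the two circles. -/
def rotBy (n m : ℕ) (v : Bool → ℤ) : Equiv.Perm (Point n m) :=
  Equiv.sumCongr (Equiv.addRight (v true : ZMod n)) (Equiv.addRight (v false : ZMod m))

theorem proj_shift (n m : ℕ) (v : Bool → ℤ) (x : CoverPoint) :
    proj n m (shift v x) = rotBy n m v (proj n m x) := by
  obtain ⟨s, t, rfl⟩ := exists_pt x
  rw [shift_pt]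
  cases s <;> simp [proj, pt, rotBy]

theorem shift_comm (v w : Bool → ℤ) (x : CoverPoint) : shift v (shift w x) = shift w (shift v x) := by
  rw [shift_shift, shift_shift, add_comm]

theorem conj_shift_apply (v : Bool → ℤ) (f : Equiv.Perm CoverPoint) (x : CoverPoint) :
    (shift v).toEquiv.permCongr f (shift v x) = shift v (f x) := by
  simp

/-- Translating a drawing of `π` gives a drawing of the rotated permutation. -/
theorem IsDrawing.conj (h : IsDrawing f π) (v : Bool → ℤ) :
    IsDrawing ((shift v).toEquiv.permCongr f) ((rotBy n m v).permCongr π) where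
  deck_comm x := by
    obtain ⟨x, rfl⟩ := (shift v).surjective x
    have h1 := h.deck_comm x
    simp only [deck_eq_shift] at h1 ⊢
    rw [shift_comm, conj_shift_apply, conj_shift_apply, h1, shift_comm]
  proj_apply x := by
    obtain ⟨x, rfl⟩ := (shift v).surjective x
    rw [conj_shift_apply, proj_shift, proj_shift, h.proj_apply, Equiv.permCongr_apply,
      Equiv.symm_apply_apply]
  noncrossing := h.noncrossing.conj _

end Lift


/-! ### Height functions on a line -/

noncomputable section Heights

/-- The discrete integral of `g` from `0` to `k` (of either sign). -/
def psum (g : ℤ → ℤ) (k : ℤ) : ℤ := ∑ j ∈ Finset.Ico 0 k, g j - ∑ j ∈ Finset.Ico k 0, g j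

@[simp] theorem psum_zero (g : ℤ → ℤ) : psum g 0 = 0 := by simp [psum]

theorem psum_add_one (g : ℤ → ℤ) (k : ℤ) : psum g (k + 1) = psum g k + g k := by
  unfold psum
  rcases le_or_gt 0 k with h | h
  · rw [Finset.Ico_eq_empty_of_le (a := k) h, Finset.Ico_eq_empty_of_le (a := k + 1) (by omega),
      ← Finset.sum_Ico_add_eq_sum_Ico_add_one h]
    simp
  · rw [Finset.Ico_eq_empty_of_le (a := 0) h.le, Finset.Ico_eq_empty_of_le (a := 0) (by omega),
      ← Finset.add_sum_Ioo_eq_sum_Ico h]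
    have : Finset.Ioo k 0 = Finset.Ico (k + 1) 0 := by ext; simp
    rw [this]
    simp

theorem sub_eq_sum_Ico {H g : ℤ → ℤ} (h : ∀ t, H (t + 1) = H t + g t) {a b : ℤ} (hab : a ≤ b) :
    H b - H a = ∑ j ∈ Finset.Ico a b, g j := by
  induction b, hab using Int.leInduction with
  | base => simp
  | succ k hk ih => rw [h, ← Finset.sum_Ico_add_eq_sum_Ico_add_one hk, ← ih]; ring

theorem eq_of_add_one_sub {F G : ℤ → ℤ} (h : ∀ t, F (t + 1) - F t = G (t + 1) - G t)
    {a : ℤ} (ha : F a = G a) (t : ℤ) : F t = G t := by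
  have : ∀ k : ℤ, F (a + k) = G (a + k) := by
    intro k
    induction k using Int.induction_on with
    | zero => simpa using ha
    | succ k ih => have := h (a + k); rw [add_assoc] at this; linarith
    | pred k ih =>
      have := h (a + (-k - 1))
      rw [show a + (-(k : ℤ) - 1) + 1 = a + -k by ring] at this
      linarith
  simpa using this (t - a)

/-- The increment over one period of a function with periodic differences is constant. -/
theorem add_period {F g : ℤ → ℤ} (h : ∀ t, F (t + 1) = F t + g t) {p : ℤ}
    (hg : ∀ t, g (t + p) = g t) (a t : ℤ) : F (t + p) = F t + (F (a + p) - F a) := by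
  refine eq_of_add_one_sub (F := fun t => F (t + p)) (G := fun t => F t + (F (a + p) - F a))
    (fun t => ?_) (a := a) ?_ t
  · have := h (t + p)
    rw [hg, show t + p + 1 = t + 1 + p by ring] at this
    simp only [this, h t]
    ring
  · ring

theorem add_mul_period {F : ℤ → ℤ} {p N : ℤ} (h : ∀ t, F (t + p) = F t + N) (k t : ℤ) :
    F (t + k * p) = F t + k * N := by
  induction k using Int.induction_on with
  | zero => simp
  | succ k ih => rw [add_mul, one_mul, ← add_assoc, h, ih]; ring
  | pred k ih =>
    have := h (t + (-k - 1) * p)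
    rw [show t + (-(k : ℤ) - 1) * p + p = t + -k * p by ring, ih] at this
    linarith

/-- A height function on a line with drift: it climbs by at most `1` per step, and by `N > 0` in
each period of length `p`. -/
structure IsHeight (p N : ℕ) (H : ℤ → ℤ) : Prop where
  period_pos : 0 < p
  drift_pos : 0 < N
  step : ∀ t, H (t + 1) ≤ H t + 1
  add_period : ∀ t, H (t + p) = H t + N

/-- The step at `t` reaches a height that has not been reached before. -/
def IsRecord (H : ℤ → ℤ) (t : ℤ) : Prop := ∀ j ≤ t, H j < H (t + 1)

/-- The position `i` is the last one, up to `t`, with height at least the height reached by the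
step at `t`. It is called the opener of `t`; for the heights of a drawing it turns out to be the
first point of the cycle of `t`. -/
def Opens (H : ℤ → ℤ) (i t : ℤ) : Prop :=
  i ≤ t ∧ H (t + 1) ≤ H i ∧ ∀ l, i < l → l ≤ t → H l < H (t + 1)

theorem Opens.unique {H : ℤ → ℤ} {i j t : ℤ} (hi : Opens H i t) (hj : Opens H j t) : i = j := by
  rcases lt_trichotomy i j with h | h | h
  · exact absurd (hi.2.2 j h hj.1) (not_lt.2 hj.2.1)
  · exact h
  · exact absurd (hj.2.2 i h hi.1) (not_lt.2 hi.2.1)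

/-- The steps that are not records are those with an opener: the last earlier position of at least the height
reached by the step. -/
theorem exists_opens_iff {H : ℤ → ℤ} {t : ℤ} : (∃ i, Opens H i t) ↔ ¬ IsRecord H t := by
  constructor
  · rintro ⟨i, hi⟩ h
    exact absurd (h i hi.1) (not_lt.2 hi.2.1)
  · intro h
    simp only [IsRecord, not_forall, not_lt] at h
    obtain ⟨j, hj, hjt⟩ := h
    obtain ⟨i, ⟨hi, hit⟩, him⟩ := Int.exists_greatest_of_bdd (P := fun j => j ≤ t ∧ H (t + 1) ≤ H j)
      ⟨t, fun z hz => hz.1⟩ ⟨j, hj, hjt⟩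
    refine ⟨i, hi, hit, fun l hl hlt => ?_⟩
    by_contra hc
    exact absurd (him l ⟨hlt, not_lt.1 hc⟩) (not_le.2 hl)

/-- The blocks of the positions with a common opener do not cross each other. -/
theorem Opens.noncrossing {H : ℤ → ℤ} {t₁ t₂ t₃ t₄ i j : ℤ} (h₁₂ : t₁ < t₂) (h₂₃ : t₂ < t₃)
    (h₃₄ : t₃ < t₄) (h₁ : Opens H i t₁) (h₃ : Opens H i t₃) (h₂ : Opens H j t₂)
    (h₄ : Opens H j t₄) : i = j := by
  rcases lt_trichotomy i j with h | h | h
  · have e1 := h₃.2.2 j h (h₂.1.trans h₂₃.le)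
    have e2 := h₄.2.2 (t₃ + 1) (by have := h₂.1; omega) (by omega)
    have := h₄.2.1
    omega
  · exact h
  · have e1 := h₂.2.2 i h (h₁.1.trans h₁₂.le)
    have e2 := h₃.2.2 (t₂ + 1) (by have := h₁.1; omega) (by omega)
    have := h₃.2.1
    omega

/-- No record lies between two positions with a common opener. -/
theorem Opens.not_isRecord {H : ℤ → ℤ} {t₁ t₂ t₃ i : ℤ} (h₁₂ : t₁ < t₂) (h₂₃ : t₂ < t₃)
    (h₁ : Opens H i t₁) (h₃ : Opens H i t₃) : ¬ IsRecord H t₂ := by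
  intro h
  have e1 := h i (h₁.1.trans h₁₂.le)
  have e2 := h₃.2.2 (t₂ + 1) (by have := h₁.1; omega) (by omega)
  have := h₃.2.1
  omega

theorem Opens.height_lt {H : ℤ → ℤ} {i t t' : ℤ} (h : Opens H i t) (h' : Opens H i t')
    (htt' : t < t') : H (t' + 1) > H (t + 1) :=
  h'.2.2 (t + 1) (by have := h.1; omega) (by omega)

theorem IsRecord.height_mono {H : ℤ → ℤ} {t t' : ℤ} (h' : IsRecord H t') (htt' : t < t') :
    H (t + 1) < H (t' + 1) := h' (t + 1) (by omega)

variable {p N : ℕ} {H : ℤ → ℤ}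

theorem IsHeight.le_add (h : IsHeight p N H) {s t : ℤ} (hst : s ≤ t) : H t ≤ H s + (t - s) := by
  induction t, hst using Int.leInduction with
  | base => simp
  | succ k hk ih => have := h.step k; linarith

theorem IsHeight.add_mul (h : IsHeight p N H) (k t : ℤ) : H (t + k * p) = H t + k * N :=
  add_mul_period h.add_period k t

theorem IsHeight.exists_ge (h : IsHeight p N H) (a v : ℤ) : ∃ t, a ≤ t ∧ v ≤ H t := by
  refine ⟨a + (max 0 (v - H a)) * p, ?_, ?_⟩
  · have : 0 ≤ (max 0 (v - H a)) * (p : ℤ) := by positivity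
    linarith
  · rw [h.add_mul]
    have h1 : (1 : ℤ) ≤ N := by exact_mod_cast h.drift_pos
    have h2 : v - H a ≤ max 0 (v - H a) := le_max_right _ _
    nlinarith [le_max_left 0 (v - H a)]

theorem IsHeight.exists_forall_lt (h : IsHeight p N H) (v : ℤ) : ∃ T, ∀ t ≤ T, H t < v := by
  have hp : (0 : ℤ) < p := by exact_mod_cast h.period_pos
  have hN : (1 : ℤ) ≤ N := by exact_mod_cast h.drift_pos
  set K : ℤ := max 0 (H 0 + p - v + 1) with hK
  refine ⟨-(K * p), fun t ht => ?_⟩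
  have h1 := h.add_mul (t / p) (t % p)
  rw [mul_comm, Int.emod_add_mul_ediv] at h1
  have h2 := h.le_add (Int.emod_nonneg t hp.ne')
  have h3 := Int.emod_lt_of_pos t hp
  have h4 : t / p ≤ -K := by
    have := Int.ediv_le_ediv hp ht
    rwa [← neg_mul, Int.mul_ediv_cancel _ hp.ne'] at this
  have h5 : K ≥ H 0 + p - v + 1 := le_max_right _ _
  have h6 : K ≥ 0 := le_max_left _ _
  nlinarith

/-- Each block has one point for each height from the height after its opener up to the height of
its opener. -/
theorem IsHeight.bijOn_opens (h : IsHeight p N H) (i : ℤ) :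
    Set.BijOn (fun t => H (t + 1)) {t | Opens H i t} (Set.Icc (H (i + 1)) (H i)) := by
  refine ⟨fun t ht => ⟨?_, ht.2.1⟩, fun t ht t' ht' htt' => ?_, fun v hv => ?_⟩
  · rcases ht.1.eq_or_lt with rfl | h1
    · exact le_rfl
    · exact (ht.2.2 (i + 1) (by omega) (by omega)).le
  · rcases lt_trichotomy t t' with h1 | h1 | h1
    · exact absurd htt' (ht.height_lt ht' h1).ne
    · exact h1
    · exact absurd htt' (ht'.height_lt ht h1).ne'
  · obtain ⟨t, ⟨hit, hvt⟩, htm⟩ := Int.exists_least_of_bdd (P := fun t => i ≤ t ∧ v ≤ H (t + 1))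
      ⟨i, fun z hz => hz.1⟩ (by
        obtain ⟨t, ht, hvt⟩ := h.exists_ge (i + 1) v
        exact ⟨t - 1, by omega, by simpa using hvt⟩)
    have hlt : ∀ l, i < l → l ≤ t → H l < v := by
      intro l hl hlt
      by_contra hc
      have := htm (l - 1) ⟨by omega, by simpa using hc⟩
      omega
    have heq : H (t + 1) = v := by
      refine le_antisymm ?_ hvt
      rcases hit.eq_or_lt with rfl | h1
      · exact hv.1
      · have := hlt t h1 le_rfl
        have := h.step t
        omega
    exact ⟨t, ⟨hit, heq ▸ hv.2, fun l hl hl' => heq ▸ hlt l hl hl'⟩, heq⟩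

theorem IsHeight.ncard_opens (h : IsHeight p N H) (i : ℤ) :
    ({t | Opens H i t}.ncard : ℤ) = H i - H (i + 1) + 1 := by
  have hb := h.bijOn_opens i
  rw [← hb.injOn.ncard_image, hb.image_eq, ← Finset.coe_Icc, Set.ncard_coe_finset,
    Int.card_Icc]
  have := h.step i
  omega

theorem IsHeight.finite_opens (h : IsHeight p N H) (i : ℤ) : {t | Opens H i t}.Finite :=
  (h.bijOn_opens i).finite_iff_finite.2 (Set.finite_Icc _ _)

theorem IsHeight.height_add_one (h : IsHeight p N H) {t : ℤ} (ht : IsRecord H t) :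
    H (t + 1) = H t + 1 :=
  le_antisymm (h.step t) (ht t le_rfl)

/-- There is exactly one record at each height. -/
theorem IsHeight.bijOn_isRecord (h : IsHeight p N H) :
    Set.BijOn H {t | IsRecord H t} Set.univ := by
  refine ⟨fun _ _ => trivial, fun t ht t' ht' htt' => ?_, fun v _ => ?_⟩
  · have e := h.height_add_one ht
    have e' := h.height_add_one ht'
    rcases lt_trichotomy t t' with h1 | h1 | h1
    · have := ht'.height_mono h1; omega
    · exact h1
    · have := ht.height_mono h1; omega
  · obtain ⟨T, hT⟩ := h.exists_forall_lt (v + 1)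
    obtain ⟨t, hvt, htm⟩ := Int.exists_least_of_bdd (P := fun t => v + 1 ≤ H (t + 1))
      ⟨T, fun z hz => by
        by_contra hc
        exact absurd (hT (z + 1) (by omega)) (not_lt.2 hz)⟩ (by
        obtain ⟨t, ht, hvt⟩ := h.exists_ge 0 (v + 1)
        exact ⟨t - 1, by simpa using hvt⟩)
    have hlt : ∀ l ≤ t, H l < v + 1 := by
      intro l hl
      by_contra hc
      have := htm (l - 1) (by simpa using hc)
      omega
    have ho : IsRecord H t := fun j hj => (hlt j hj).trans_le hvt
    refine ⟨t, ho, ?_⟩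
    have := h.height_add_one ho
    have := hlt t le_rfl
    omega

theorem IsHeight.opens_add (h : IsHeight p N H) (i t : ℤ) :
    Opens H (i + p) (t + p) ↔ Opens H i t := by
  have e : H (t + p + 1) = H (t + 1) + N := by rw [← h.add_period]; ring_nf
  unfold Opens
  rw [e, h.add_period]
  refine and_congr (by omega) (and_congr (by omega) ⟨fun hl l h1 h2 => ?_, fun hl l h1 h2 => ?_⟩)
  · have := hl (l + p) (by omega) (by omega)
    rw [h.add_period] at this
    omega
  · have := hl (l - p) (by omega) (by omega)
    have e' := h.add_period (l - p)
    rw [sub_add_cancel] at e'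
    omega

theorem IsHeight.isRecord_add (h : IsHeight p N H) (t : ℤ) : IsRecord H (t + p) ↔ IsRecord H t := by
  rw [← not_iff_not, ← exists_opens_iff, ← exists_opens_iff]
  constructor
  · rintro ⟨i, hi⟩
    exact ⟨i - p, by rw [← h.opens_add]; simpa using hi⟩
  · rintro ⟨i, hi⟩
    exact ⟨i + p, (h.opens_add _ _).2 hi⟩

theorem le_sub_of_strictMono {u : ℤ → ℤ} (hu : StrictMono u) {a b : ℤ} (hab : a ≤ b) :
    u a + (b - a) ≤ u b := by
  induction b, hab using Int.leInduction with
  | base => simp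
  | succ k hk ih => have := hu (lt_add_one k); linarith

/-- A strictly increasing function on the integers is unbounded in both directions, so its values
cut the line into intervals. -/
theorem exists_index {u : ℤ → ℤ} (hu : StrictMono u) (l : ℤ) : ∃ k, u k ≤ l ∧ l < u (k + 1) := by
  obtain ⟨k, hk, hkm⟩ := Int.exists_greatest_of_bdd (P := fun k => u k ≤ l)
    ⟨max 0 (l - u 0), fun z hz => by
      rcases le_or_gt 0 z with h | h
      · have := le_sub_of_strictMono hu h
        exact le_max_of_le_right (by linarith)
      · exact le_max_of_le_left h.le⟩
    ⟨min 0 (l - u 0), by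
      have := le_sub_of_strictMono hu (min_le_left 0 (l - u 0))
      have := min_le_right 0 (l - u 0)
      linarith⟩
  refine ⟨k, hk, ?_⟩
  by_contra hc
  have := hkm (k + 1) (not_lt.1 hc)
  omega

/-- The intervals between consecutive values of an increasing function are disjoint. -/
theorem index_unique {u : ℤ → ℤ} (hu : StrictMono u) {l k k' : ℤ} (h : u k ≤ l ∧ l < u (k + 1))
    (h' : u k' ≤ l ∧ l < u (k' + 1)) : k = k' := by
  have h1 : k < k' + 1 := hu.lt_iff_lt.1 (h.1.trans_lt h'.2)
  have h2 : k' < k + 1 := hu.lt_iff_lt.1 (h'.1.trans_lt h.2)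
  omega

/-- A set of integers has at most one increasing enumeration by the integers with a given start. -/
theorem eq_of_range_eq {u v : ℤ → ℤ} (hu : StrictMono u) (hv : StrictMono v)
    (h : Set.range u = Set.range v) (h0 : u 0 = v 0) : u = v := by
  have key : ∀ {u v : ℤ → ℤ}, StrictMono u → StrictMono v → Set.range u = Set.range v →
      ∀ k, u k = v k → v (k + 1) ≤ u (k + 1) := by
    intro u v hu hv h k hk
    obtain ⟨j, hj⟩ : u (k + 1) ∈ Set.range v := h ▸ Set.mem_range_self _
    rw [← hj]
    refine hv.monotone ?_
    have : v k < v j := by rw [hj, ← hk]; exact hu (lt_add_one k)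
    have := hv.lt_iff_lt.1 this
    omega
  have key' : ∀ {u v : ℤ → ℤ}, StrictMono u → StrictMono v → Set.range u = Set.range v →
      ∀ k, u k = v k → u (k - 1) ≤ v (k - 1) := by
    intro u v hu hv h k hk
    obtain ⟨j, hj⟩ : u (k - 1) ∈ Set.range v := h ▸ Set.mem_range_self _
    rw [← hj]
    refine hv.monotone ?_
    have : v j < v k := by rw [hj, ← hk]; exact hu (by omega)
    have := hv.lt_iff_lt.1 this
    omega
  ext k
  induction k using Int.induction_on with
  | zero => exact h0
  | succ k ih => exact le_antisymm (key hv hu h.symm _ ih.symm) (key hu hv h _ ih)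
  | pred k ih => exact le_antisymm (key' hu hv h _ ih) (key' hv hu h.symm _ ih.symm)

open scoped Classical in
/-- The name of the block of a position of a line with height function `H`. A position that is not a
record belongs to the block `Sum.inl i` with `i` its opener. The records are grouped by their
heights: those with height in the interval from `u k` to `u (k + 1)` form the block `Sum.inr k`. The
value `Sum.inr 0` outside these cases is never taken if `u` is strictly increasing. -/
def lineKey (H u : ℤ → ℤ) (t : ℤ) : ℤ ⊕ ℤ :=
  if h : ∃ i, Opens H i t then .inl h.choose
  else if h : ∃ k, u k ≤ H t ∧ H t < u (k + 1) then .inr h.choose else .inr 0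

theorem lineKey_eq_inl {u : ℤ → ℤ} {i t : ℤ} : lineKey H u t = .inl i ↔ Opens H i t := by
  unfold lineKey
  split_ifs with h h'
  · rw [Sum.inl.injEq]
    exact ⟨fun e => e ▸ h.choose_spec, fun e => h.choose_spec.unique e⟩
  · exact ⟨nofun, fun e => h ⟨i, e⟩⟩
  · exact ⟨nofun, fun e => h ⟨i, e⟩⟩

theorem lineKey_eq_inr {u : ℤ → ℤ} (hu : StrictMono u) {k t : ℤ} :
    lineKey H u t = .inr k ↔ IsRecord H t ∧ u k ≤ H t ∧ H t < u (k + 1) := by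
  unfold lineKey
  split_ifs with h h'
  · exact ⟨nofun, fun e => absurd e.1 (exists_opens_iff.1 h)⟩
  · rw [Sum.inr.injEq]
    have ho : IsRecord H t := by rwa [exists_opens_iff, not_not] at h
    exact ⟨fun e => ⟨ho, e ▸ h'.choose_spec⟩, fun e => index_unique hu h'.choose_spec e.2⟩
  · exact absurd (exists_index hu _) h'

theorem IsHeight.ncard_lineKey_inr (h : IsHeight p N H) {u : ℤ → ℤ} (hu : StrictMono u) (k : ℤ) :
    ({t | lineKey H u t = .inr k}.ncard : ℤ) = u (k + 1) - u k ∧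
      {t | lineKey H u t = .inr k}.Finite := by
  have hb := h.bijOn_isRecord
  have hb' : Set.BijOn H {t | lineKey H u t = .inr k} (Set.Ico (u k) (u (k + 1))) := by
    refine ⟨fun t ht => ((lineKey_eq_inr hu).1 ht).2, hb.injOn.mono fun t ht =>
      ((lineKey_eq_inr hu).1 ht).1, fun v hv => ?_⟩
    obtain ⟨t, ht, rfl⟩ := hb.surjOn (Set.mem_univ v)
    exact ⟨t, (lineKey_eq_inr hu).2 ⟨ht, hv⟩, rfl⟩
  constructor
  · rw [← hb'.injOn.ncard_image, hb'.image_eq, ← Finset.coe_Ico, Set.ncard_coe_finset,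
      Int.card_Ico]
    have := hu (lt_add_one k)
    omega
  · exact hb'.finite_iff_finite.2 (Set.finite_Ico _ _)

theorem IsHeight.ncard_lineKey_inl (h : IsHeight p N H) (u : ℤ → ℤ) (i : ℤ) :
    ({t | lineKey H u t = .inl i}.ncard : ℤ) = H i - H (i + 1) + 1 ∧
      {t | lineKey H u t = .inl i}.Finite := by
  simp only [lineKey_eq_inl]
  exact ⟨h.ncard_opens i, h.finite_opens i⟩

/-- The blocks of records follow each other in increasing order. -/
theorem IsHeight.lineKey_mono (h : IsHeight p N H) {u : ℤ → ℤ} (hu : StrictMono u) {t t' k k' : ℤ}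
    (htt' : t ≤ t') (hk : lineKey H u t = .inr k) (hk' : lineKey H u t' = .inr k') : k ≤ k' := by
  rw [lineKey_eq_inr hu] at hk hk'
  have : H t ≤ H t' := by
    rcases htt'.eq_or_lt with rfl | hlt
    · exact le_rfl
    · have := hk'.1.height_mono hlt
      rw [h.height_add_one hk.1, h.height_add_one hk'.1] at this
      omega
  have := hu.lt_iff_lt.1 ((hk.2.1.trans this).trans_lt hk'.2.2)
  omega

theorem lineKey_not_inr (hu : StrictMono u) {t₁ t₂ t₃ i k : ℤ} (h₁₂ : t₁ < t₂)
    (h₂₃ : t₂ < t₃) (h₁ : lineKey H u t₁ = .inl i) (h₃ : lineKey H u t₃ = .inl i)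
    (h₂ : lineKey H u t₂ = .inr k) : False :=
  Opens.not_isRecord h₁₂ h₂₃ (lineKey_eq_inl.1 h₁) (lineKey_eq_inl.1 h₃) ((lineKey_eq_inr hu).1 h₂).1

/-- The partition of a line given by a height function and a grouping of the records is
noncrossing. -/
theorem IsHeight.lineKey_noncrossing (h : IsHeight p N H) {u : ℤ → ℤ} (hu : StrictMono u)
    {t₁ t₂ t₃ t₄ : ℤ} (h₁₂ : t₁ < t₂) (h₂₃ : t₂ < t₃) (h₃₄ : t₃ < t₄)
    (h₁₃ : lineKey H u t₁ = lineKey H u t₃) (h₂₄ : lineKey H u t₂ = lineKey H u t₄) :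
    lineKey H u t₁ = lineKey H u t₂ := by
  rcases hi : lineKey H u t₁ with i | i <;> rcases hj : lineKey H u t₂ with j | j
  · rw [Opens.noncrossing h₁₂ h₂₃ h₃₄ (lineKey_eq_inl.1 hi) (lineKey_eq_inl.1 (h₁₃ ▸ hi))
      (lineKey_eq_inl.1 hj) (lineKey_eq_inl.1 (h₂₄ ▸ hj))]
  · exact (lineKey_not_inr hu h₁₂ h₂₃ hi (h₁₃ ▸ hi) hj).elim
  · exact (lineKey_not_inr hu h₂₃ h₃₄ hj (h₂₄ ▸ hj) (h₁₃ ▸ hi)).elim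
  · have h1 := h.lineKey_mono hu h₁₂.le hi hj
    have h2 := h.lineKey_mono hu h₂₃.le hj (h₁₃ ▸ hi)
    rw [le_antisymm h1 h2]

theorem IsHeight.lineKey_add (h : IsHeight p N H) {u : ℤ → ℤ} (hu : StrictMono u) {c : ℤ}
    (hc : ∀ k, u (k + c) = u k + N) (t : ℤ) :
    lineKey H u (t + p) = (lineKey H u t).map (· + (p : ℤ)) (· + c) := by
  rcases hi : lineKey H u t with i | i
  · rw [Sum.map_inl, lineKey_eq_inl, h.opens_add]
    exact lineKey_eq_inl.1 hi
  · rw [lineKey_eq_inr hu] at hi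
    rw [Sum.map_inr, lineKey_eq_inr hu, h.isRecord_add, h.add_period, hc,
      show i + c + 1 = i + 1 + c by ring, hc]
    exact ⟨hi.1, by omega, by omega⟩

end Heights


/-! ### Cycles on a boundary line of the strip -/

noncomputable section Shape

/-- The positions on the boundary line `s` in the cycle of the point at position `t` of that
line. -/
def block (f : Equiv.Perm CoverPoint) (s : Bool) (t : ℤ) : Set ℤ :=
  {t' | f.SameCycle (pt s t) (pt s t')}

/-- The cycle of the point at position `t` of the line `s` has a point on the other line. -/
def Conn (f : Equiv.Perm CoverPoint) (s : Bool) (t : ℤ) : Prop :=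
  ∃ t', f.SameCycle (pt s t) (pt (!s) t')

/-- The position `t` is the first one of its cycle on the line `s`. -/
def IsFirst (f : Equiv.Perm CoverPoint) (s : Bool) (t : ℤ) : Prop := ∀ t' ∈ block f s t, t ≤ t'

open scoped Classical in
/-- The opener function of the line `s`: the size of a cycle contained in that line, at the first
point of the cycle, and `0` at all other points. -/
def phiOf (f : Equiv.Perm CoverPoint) (s : Bool) (i : ℤ) : ℕ :=
  if ¬ Conn f s i ∧ IsFirst f s i then (block f s i).ncard else 0

variable {f : Equiv.Perm CoverPoint} {s : Bool}

theorem mem_block_self (t : ℤ) : t ∈ block f s t := .refl _ _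

theorem block_eq {i t : ℤ} (h : t ∈ block f s i) : block f s t = block f s i :=
  Set.ext fun _ => ⟨fun h' => Equiv.Perm.SameCycle.trans h h',
    fun h' => Equiv.Perm.SameCycle.trans (Equiv.Perm.SameCycle.symm h) h'⟩

theorem mem_block_comm {i t : ℤ} : t ∈ block f s i ↔ i ∈ block f s t :=
  Equiv.Perm.sameCycle_comm

theorem conn_congr {i t : ℤ} (h : t ∈ block f s i) : Conn f s t ↔ Conn f s i :=
  ⟨fun ⟨x, hx⟩ => ⟨x, Equiv.Perm.SameCycle.trans h hx⟩,
    fun ⟨x, hx⟩ => ⟨x, Equiv.Perm.SameCycle.trans (Equiv.Perm.SameCycle.symm h) hx⟩⟩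

variable (hf : IsNoncrossing f)
include hf

theorem IsNoncrossing.finite_block (s : Bool) (t : ℤ) : (block f s t).Finite :=
  Set.Finite.preimage (f := pt s) (pt_injective s).injOn (hf.finite_cycle (pt s t))

theorem IsNoncrossing.exists_isFirst (s : Bool) (t : ℤ) : ∃ i ∈ block f s t, IsFirst f s i := by
  obtain ⟨i, hi, him⟩ := Set.exists_min_image _ id (hf.finite_block s t) ⟨t, mem_block_self t⟩
  exact ⟨i, hi, fun j hj => him j (by rwa [block_eq hi] at hj)⟩

theorem IsNoncrossing.mem_block_of_lt {i j k l : ℤ} (hij : i < j) (hjk : j < k) (hkl : k < l)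
    (hik : k ∈ block f s i) (hjl : l ∈ block f s j) : j ∈ block f s i :=
  hf.sameCycle_of_lt (pt_lt_pt.2 hij) (pt_lt_pt.2 hjk) (pt_lt_pt.2 hkl) hik hjl

/-- A point of a connected cycle is not covered by other cycles. -/
theorem IsNoncrossing.mem_block_of_conn {i j k : ℤ} (hij : i < j) (hjk : j < k)
    (hik : k ∈ block f s i) (hj : Conn f s j) : j ∈ block f s i := by
  obtain ⟨x, hx⟩ := hj
  cases s
  · have h := hf.sameCycle_of_lt (pt_true_lt_pt_false x i) (pt_lt_pt.2 hij) (pt_lt_pt.2 hjk)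
      hx.symm hik
    exact h.symm.trans hx.symm
  · exact hf.sameCycle_of_lt (pt_lt_pt.2 hij) (pt_lt_pt.2 hjk) (pt_true_lt_pt_false k x) hik hx

theorem phiOf_eq_card (s : Bool) : ∃ B : ℤ → Finset ℤ, (∀ i, phiOf f s i = (B i).card) ∧
    ∀ i t, t ∈ B i ↔ ¬ Conn f s i ∧ IsFirst f s i ∧ t ∈ block f s i := by
  classical
  refine ⟨fun i => if ¬ Conn f s i ∧ IsFirst f s i then (hf.finite_block s i).toFinset else ∅,
    fun i => ?_, fun i t => ?_⟩ <;> beta_reduce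
  · unfold phiOf
    split_ifs
    · exact Set.ncard_eq_toFinset_card _ _
    · rfl
  · split_ifs with h
    · simp [h]
    · simpa using fun h1 h2 => absurd ⟨h1, h2⟩ h

theorem IsNoncrossing.phiOf_ne_zero_iff {i : ℤ} : phiOf f s i ≠ 0 ↔ ¬ Conn f s i ∧ IsFirst f s i := by
  obtain ⟨B, hB, hBm⟩ := phiOf_eq_card hf s
  rw [hB, Finset.card_ne_zero, Finset.Nonempty]
  simp only [hBm]
  exact ⟨fun ⟨_, h1, h2, _⟩ => ⟨h1, h2⟩, fun h => ⟨i, h.1, h.2, mem_block_self i⟩⟩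

omit hf in
theorem pairwiseDisjoint_openers {B : ℤ → Finset ℤ}
    (hB : ∀ i t, t ∈ B i ↔ ¬ Conn f s i ∧ IsFirst f s i ∧ t ∈ block f s i) (S : Set ℤ) :
    S.PairwiseDisjoint B := by
  intro i _ j _ hij
  rw [Function.onFun, Finset.disjoint_left]
  intro t hi hj
  rw [hB] at hi hj
  have h1 : j ∈ block f s i := by rw [← block_eq hi.2.2]; exact mem_block_comm.1 hj.2.2
  exact hij (le_antisymm (hi.2.1 j h1) (hj.2.1 i (mem_block_comm.1 h1)))

/-- An upper bound for the number of points of the cycles opened in `S`. -/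
theorem IsNoncrossing.sum_phiOf_le (S X : Finset ℤ)
    (h : ∀ i ∈ S, ¬ Conn f s i → IsFirst f s i → ∀ t ∈ block f s i, t ∈ X) :
    ∑ i ∈ S, phiOf f s i ≤ X.card := by
  classical
  obtain ⟨B, hB, hBm⟩ := phiOf_eq_card hf s
  simp only [hB]
  rw [← Finset.card_biUnion (pairwiseDisjoint_openers hBm _)]
  refine Finset.card_le_card (Finset.biUnion_subset.2 fun i hi t ht => ?_)
  obtain ⟨h1, h2, h3⟩ := (hBm _ _).1 ht
  exact h i hi h1 h2 t h3

/-- A lower bound for the number of points of the cycles opened in `S`. -/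
theorem IsNoncrossing.le_sum_phiOf (S X : Finset ℤ)
    (h : ∀ t ∈ X, ∃ i ∈ S, ¬ Conn f s i ∧ IsFirst f s i ∧ t ∈ block f s i) :
    X.card ≤ ∑ i ∈ S, phiOf f s i := by
  classical
  obtain ⟨B, hB, hBm⟩ := phiOf_eq_card hf s
  simp only [hB]
  rw [← Finset.card_biUnion (pairwiseDisjoint_openers hBm _)]
  refine Finset.card_le_card fun t ht => ?_
  obtain ⟨i, hi, h⟩ := h t ht
  exact Finset.mem_biUnion.2 ⟨i, hi, (hBm _ _).2 h⟩

variable {H : ℤ → ℤ} (hH : ∀ t, H (t + 1) = H t + (1 - phiOf f s t))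
include hH

omit hf in
/-- A height difference is the number of points of an interval minus the total size of the cycles
contained in the line that start in this interval. -/
theorem height_sub {a b : ℤ} (hab : a ≤ b) :
    H b - H a = (b - a) - ((∑ i ∈ Finset.Ico a b, phiOf f s i : ℕ) : ℤ) := by
  rw [sub_eq_sum_Ico hH hab, Finset.sum_sub_distrib]
  simp [hab]

/-- The first point of a cycle contained in a boundary line is the opener of the other points. A
height difference compares the number of points of an interval with the total size of the cycles
that start in it. From `i` to `t`, all points are on cycles that start there, as no other cycle can
cross that of `i`. After `i`, the cycles that start in an interval ending at `t` have all their
points in this interval, and miss `t`. -/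
theorem IsNoncrossing.opens_of_first {i t : ℤ} (ht : ¬ Conn f s t) (hit : t ∈ block f s i)
    (hi : IsFirst f s i) : Opens H i t := by
  have hle : i ≤ t := hi t hit
  have hic : ¬ Conn f s i := by rwa [← conn_congr hit]
  refine ⟨hle, ?_, fun l hl hlt => ?_⟩
  · have h1 := height_sub hH (show i ≤ t + 1 by omega)
    have h2 := hf.le_sum_phiOf (s := s) (Finset.Ico i (t + 1)) (Finset.Ico i (t + 1)) ?_
    · rw [Int.card_Ico] at h2
      omega
    intro p hp
    rw [Finset.mem_Ico] at hp
    have hend : p = i ∨ p = t ∨ (i < p ∧ p < t) := by omega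
    have hpc : ¬ Conn f s p := by
      rcases hend with rfl | rfl | ⟨h3, h4⟩
      · exact hic
      · exact ht
      · intro hp'
        exact hic ((conn_congr (hf.mem_block_of_conn h3 h4 hit hp')).1 hp')
    obtain ⟨o, hop, ho⟩ := hf.exists_isFirst s p
    have hop' : p ∈ block f s o := mem_block_comm.1 hop
    have hoc : ¬ Conn f s o := by rwa [← conn_congr hop']
    have hle' := ho p hop'
    refine ⟨o, Finset.mem_Ico.2 ⟨?_, by omega⟩, hoc, ho, hop'⟩
    by_contra hlt
    have h5 : o ∈ block f s i := by
      rcases hend with rfl | rfl | ⟨h3, h4⟩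
      · exact hop
      · rwa [← block_eq hit]
      · exact mem_block_comm.1 (hf.mem_block_of_lt (not_le.1 hlt) h3 h4 hop' hit)
    exact hlt (hi o h5)
  · have h1 := height_sub hH (show l ≤ t + 1 by omega)
    have h2 := hf.sum_phiOf_le (s := s) (Finset.Ico l (t + 1)) (Finset.Ico l t) ?_
    · rw [Int.card_Ico] at h2
      omega
    intro o ho hoc hof q hq
    rw [Finset.mem_Ico] at ho ⊢
    have h3 := hof q hq
    refine ⟨by omega, ?_⟩
    have hoi : o ∉ block f s i := fun h => by
      have := hof i (mem_block_comm.1 h)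
      omega
    rcases lt_trichotomy q t with h | rfl | h
    · exact h
    · exact absurd (by rw [← block_eq hit]; exact mem_block_comm.1 hq) hoi
    · rcases (show o ≤ t by omega).eq_or_lt with rfl | h4
      · exact absurd hit hoi
      · exact absurd (hf.mem_block_of_lt (by omega) h4 h hit hq) hoi

/-- The cycles contained in the line that start in an interval ending at a point `t` of a connected
cycle also end before `t`, so they have fewer points than the interval. -/
theorem IsNoncrossing.isRecord_of_conn {t : ℤ} (ht : Conn f s t) : IsRecord H t := by
  intro j hj
  have h1 := height_sub hH (show j ≤ t + 1 by omega)
  have h2 := hf.sum_phiOf_le (s := s) (Finset.Ico j (t + 1)) (Finset.Ico j t) ?_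
  · rw [Int.card_Ico] at h2
    omega
  intro o ho hoc hof q hq
  rw [Finset.mem_Ico] at ho ⊢
  have h3 := hof q hq
  refine ⟨by omega, ?_⟩
  have hot : t ∉ block f s o := fun h => hoc ((conn_congr h).1 ht)
  rcases lt_trichotomy q t with h | rfl | h
  · exact h
  · exact absurd hq hot
  · rcases (show o ≤ t by omega).eq_or_lt with rfl | h4
    · exact absurd ht hoc
    · exact absurd (hf.mem_block_of_conn h4 h hq ht) hot

/-- The points of connected cycles are the records of the height function. -/
theorem IsNoncrossing.isRecord_iff {t : ℤ} : IsRecord H t ↔ Conn f s t := by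
  refine ⟨fun h => ?_, hf.isRecord_of_conn hH⟩
  by_contra hc
  obtain ⟨i, hi, hif⟩ := hf.exists_isFirst s t
  exact exists_opens_iff.1 ⟨i, hf.opens_of_first hH hc (mem_block_comm.1 hi) hif⟩ h

/-- The height function recovers the cycles contained in a boundary line. -/
theorem IsNoncrossing.opens_iff {i t : ℤ} :
    Opens H i t ↔ ¬ Conn f s t ∧ t ∈ block f s i ∧ IsFirst f s i := by
  refine ⟨fun h => ?_, fun h => hf.opens_of_first hH h.1 h.2.1 h.2.2⟩
  have hc : ¬ Conn f s t := by
    rw [← hf.isRecord_iff hH, ← exists_opens_iff]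
    exact ⟨i, h⟩
  obtain ⟨j, hj, hjf⟩ := hf.exists_isFirst s t
  have := (hf.opens_of_first hH hc (mem_block_comm.1 hj) hjf).unique h
  subst this
  exact ⟨hc, mem_block_comm.1 hj, hjf⟩

end Shape


/-! ### Reading off the cycle type of a permutation from a drawing -/

noncomputable section Types

variable {n m : ℕ} {f : Equiv.Perm CoverPoint} {π : Equiv.Perm (Point n m)} {s : Bool}

/-- The first points of the connected cycles on one of the boundary lines. -/
def IsStart (f : Equiv.Perm CoverPoint) (s : Bool) (t : ℤ) : Prop := Conn f s t ∧ IsFirst f s t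

section Translate

variable {g : Equiv.Perm CoverPoint} {v : Bool → ℤ}
  (h : ∀ x y, g.SameCycle (shift v x) (shift v y) ↔ f.SameCycle x y)
include h

theorem mem_block_translate (t t' : ℤ) : t' + v s ∈ block g s (t + v s) ↔ t' ∈ block f s t := by
  have := h (pt s t) (pt s t')
  rwa [shift_pt, shift_pt] at this

theorem conn_translate (t : ℤ) : Conn g s (t + v s) ↔ Conn f s t := by
  constructor
  · rintro ⟨x, hx⟩
    refine ⟨x - v (!s), ?_⟩
    rwa [← shift_pt, show pt (!s) x = shift v (pt (!s) (x - v (!s))) by simp, h] at hx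
  · rintro ⟨x, hx⟩
    exact ⟨x + v (!s), by rwa [← shift_pt, ← shift_pt, h]⟩

theorem isFirst_translate (t : ℤ) : IsFirst g s (t + v s) ↔ IsFirst f s t := by
  constructor
  · intro hF t' ht'
    have := hF (t' + v s) ((mem_block_translate h t t').2 ht')
    omega
  · intro hF t' ht'
    have := hF (t' - v s) (by rw [← mem_block_translate h]; simpa using ht')
    omega

theorem ncard_block_translate (t : ℤ) : (block g s (t + v s)).ncard = (block f s t).ncard := by
  rw [← Set.ncard_image_of_injective (block f s t) (add_left_injective (v s))]
  congr 1
  ext t'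
  simp only [Set.mem_image]
  constructor
  · intro ht'
    exact ⟨t' - v s, by rw [← mem_block_translate h]; simpa using ht', by simp⟩
  · rintro ⟨x, hx, rfl⟩
    exact (mem_block_translate h _ _).2 hx

theorem phiOf_translate (t : ℤ) : phiOf g s (t + v s) = phiOf f s t := by
  unfold phiOf
  rw [conn_translate h, isFirst_translate h, ncard_block_translate h]

theorem isStart_translate (t : ℤ) : IsStart g s (t + v s) ↔ IsStart f s t :=
  and_congr (conn_translate h t) (isFirst_translate h t)

end Translate

theorem IsDrawing.isFirst_add (h : IsDrawing f π) {a : ℤ} (ha : (per n m s : ℤ) ∣ a) (t : ℤ) :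
    IsFirst f s (t + a) ↔ IsFirst f s t := by
  obtain ⟨k, rfl⟩ := exists_deckVec_eq ha
  exact isFirst_translate (h.sameCycle_shift k) t

theorem IsDrawing.phiOf_add (h : IsDrawing f π) {a : ℤ} (ha : (per n m s : ℤ) ∣ a) (t : ℤ) :
    phiOf f s (t + a) = phiOf f s t := by
  obtain ⟨k, rfl⟩ := exists_deckVec_eq ha
  exact phiOf_translate (h.sameCycle_shift k) t

theorem IsDrawing.isStart_add (h : IsDrawing f π) {a : ℤ} (ha : (per n m s : ℤ) ∣ a) (t : ℤ) :
    IsStart f s (t + a) ↔ IsStart f s t := by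
  obtain ⟨k, rfl⟩ := exists_deckVec_eq ha
  exact isStart_translate (h.sameCycle_shift k) t

variable [NeZero n] [NeZero m]

theorem per_pos (n m : ℕ) [NeZero n] [NeZero m] (s : Bool) : 0 < per n m s := by
  cases s
  exacts [Nat.pos_of_ne_zero (NeZero.ne m), Nat.pos_of_ne_zero (NeZero.ne n)]

/-- The number of points on the exterior or interior circle in a set of marked points. -/
def sizeOn (s : Bool) (γ : Finset (Point n m)) : ℕ := bif s then extSize γ else intSize γ

open scoped Classical in
/-- The cycle of a marked point. -/
def cyc (π : Equiv.Perm (Point n m)) (p : Point n m) : Finset (Point n m) :=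
  Finset.univ.filter fun y => π.SameCycle p y

theorem mem_cyc {p q : Point n m} : q ∈ cyc π p ↔ π.SameCycle p q := by simp [cyc]

theorem cyc_eq_iff {p q : Point n m} : cyc π p = cyc π q ↔ π.SameCycle p q := by
  constructor
  · intro h
    rw [← mem_cyc, h, mem_cyc]
  · intro h
    ext x
    rw [mem_cyc, mem_cyc]
    exact ⟨fun hx => h.symm.trans hx, fun hx => h.trans hx⟩

theorem mem_cycles {γ : Finset (Point n m)} : γ ∈ cycles π ↔ ∃ p, γ = cyc π p := by
  simp only [cycles, Finset.mem_image, Finset.mem_univ, true_and, eq_comm]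
  rfl

/-- The number of points of a cycle on either circle can be counted on the strip. -/
theorem IsDrawing.sizeOn_cyc (h : IsDrawing f π) (s : Bool) (x : CoverPoint) :
    sizeOn s (cyc π (proj n m x)) = {t | f.SameCycle x (pt s t)}.ncard := by
  have hside : ∀ y : CoverPoint, (bif s then (proj n m y).isLeft else (proj n m y).isRight) = true ↔
      ∃ t, y = pt s t := by
    intro y
    obtain ⟨s', t, rfl⟩ := exists_pt y
    cases s <;> cases s' <;> simp [proj, pt]
  have hb : Set.BijOn (fun t => proj n m (pt s t)) {t | f.SameCycle x (pt s t)}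
      ((cyc π (proj n m x)).filter fun y => (bif s then y.isLeft else y.isRight) = true) := by
    refine ⟨fun t ht => ?_, fun t ht t' ht' htt' => ?_, fun y hy => ?_⟩
    · rw [Finset.mem_coe, Finset.mem_filter, mem_cyc, h.sameCycle_proj, hside]
      exact ⟨⟨0, by simpa [deckVec_zero] using ht⟩, t, rfl⟩
    · exact pt_injective s (h.eq_of_sameCycle (ht.symm.trans ht') htt')
    · obtain ⟨y, rfl⟩ := proj_surjective n m y
      rw [Finset.mem_coe, Finset.mem_filter, mem_cyc, h.sameCycle_proj, hside] at hy
      obtain ⟨⟨k, hk⟩, t, rfl⟩ := hy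
      refine ⟨t + deckVec n m k s, by rwa [shift_pt] at hk, ?_⟩
      simp only [← shift_pt, proj_shift_deckVec]
  rw [← hb.injOn.ncard_image, hb.image_eq, Set.ncard_coe_finset]
  cases s <;> rfl

theorem IsDrawing.sizeOn_cyc_pt (h : IsDrawing f π) (s : Bool) (t : ℤ) :
    sizeOn s (cyc π (proj n m (pt s t))) = (block f s t).ncard := h.sizeOn_cyc s _

theorem IsDrawing.sizeOn_cyc_pos_iff (h : IsDrawing f π) (s : Bool) (x : CoverPoint) :
    0 < sizeOn s (cyc π (proj n m x)) ↔ ∃ t, f.SameCycle x (pt s t) := by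
  have hfin : {t | f.SameCycle x (pt s t)}.Finite :=
    Set.Finite.preimage (f := pt s) (pt_injective s).injOn (h.noncrossing.finite_cycle x)
  rw [h.sizeOn_cyc, Set.ncard_pos hfin]
  rfl

theorem IsDrawing.sizeOn_pos (h : IsDrawing f π) (s : Bool) (t : ℤ) :
    0 < sizeOn s (cyc π (proj n m (pt s t))) := (h.sizeOn_cyc_pos_iff s _).2 ⟨t, .refl _ _⟩

theorem IsDrawing.sizeOn_not_pos_iff (h : IsDrawing f π) (s : Bool) (t : ℤ) :
    0 < sizeOn (!s) (cyc π (proj n m (pt s t))) ↔ Conn f s t := h.sizeOn_cyc_pos_iff _ _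

theorem proj_pt_add {n m : ℕ} {a : ℤ} {s : Bool} (ha : (per n m s : ℤ) ∣ a) (t : ℤ) :
    proj n m (pt s (t + a)) = proj n m (pt s t) := by
  rw [proj_pt_eq_iff]
  exact ⟨rfl, by simpa using ha⟩

/-- The sizes, on one circle, of a class of cycles that all meet this circle can be read off from
representatives of the first points of these cycles. -/
theorem IsDrawing.map_sizeOn (h : IsDrawing f π) (s : Bool) (Q : Finset (Point n m) → Prop)
    [DecidablePred Q] {ι : Type*} (I : Finset ι) (e : ι → ℤ)
    (hside : ∀ γ ∈ cycles π, Q γ → 0 < sizeOn s γ)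
    (hfirst : ∀ i ∈ I, IsFirst f s (e i)) (hQ : ∀ i ∈ I, Q (cyc π (proj n m (pt s (e i)))))
    (hcover : ∀ t, IsFirst f s t → Q (cyc π (proj n m (pt s t))) →
      ∃ i ∈ I, (per n m s : ℤ) ∣ t - e i)
    (hinj : ∀ i ∈ I, ∀ j ∈ I, (per n m s : ℤ) ∣ e i - e j → i = j) :
    ((cycles π).filter Q).val.map (sizeOn s) = I.val.map fun i => (block f s (e i)).ncard := by
  classical
  have himage : (cycles π).filter Q = I.image fun i => cyc π (proj n m (pt s (e i))) := by
    ext γ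
    rw [Finset.mem_filter, Finset.mem_image]
    constructor
    · rintro ⟨hγ, hQγ⟩
      have hpos := hside γ hγ hQγ
      obtain ⟨p, rfl⟩ := mem_cycles.1 hγ
      obtain ⟨x, rfl⟩ := proj_surjective n m p
      obtain ⟨t, ht⟩ := (h.sizeOn_cyc_pos_iff s x).1 hpos
      obtain ⟨o, ho, hof⟩ := h.noncrossing.exists_isFirst s t
      have hxo : cyc π (proj n m x) = cyc π (proj n m (pt s o)) := by
        rw [cyc_eq_iff, h.sameCycle_proj]
        exact ⟨0, by simpa [deckVec_zero] using ht.trans ho⟩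
      rw [hxo] at hQγ ⊢
      obtain ⟨i, hi, hdvd⟩ := hcover o hof hQγ
      refine ⟨i, hi, ?_⟩
      rw [show o = e i + (o - e i) by ring, proj_pt_add hdvd]
    · rintro ⟨i, hi, rfl⟩
      exact ⟨mem_cycles.2 ⟨_, rfl⟩, hQ i hi⟩
  rw [himage, Finset.image_val_of_injOn, Multiset.map_map]
  · exact Multiset.map_congr rfl fun i _ => h.sizeOn_cyc_pt s (e i)
  · intro i hi j hj hij
    apply hinj i hi j hj
    rw [cyc_eq_iff, h.sameCycle_proj] at hij
    obtain ⟨k, hk⟩ := hij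
    rw [shift_pt] at hk
    have h1 := hfirst i hi _ hk
    have h2 := (h.isFirst_add (dvd_deckVec n m k s) (e j)).2 (hfirst j hj) (e i) hk.symm
    rw [show e i - e j = deckVec n m k s by omega]
    exact dvd_deckVec n m k s

/-- The sizes of the cycles contained in one of the two circles. -/
def cycleTypeOn (s : Bool) (π : Equiv.Perm (Point n m)) : Multiset ℕ :=
  ((cycles π).filter fun γ => sizeOn (!s) γ = 0).val.map (sizeOn s)

/-- The sizes of the connected cycles on one of the two circles. -/
def connTypeOn (s : Bool) (π : Equiv.Perm (Point n m)) : Multiset ℕ :=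
  (connectedCycles π).val.map (sizeOn s)

theorem mem_connectedCycles {γ : Finset (Point n m)} :
    γ ∈ connectedCycles π ↔ γ ∈ cycles π ∧ 0 < sizeOn s γ ∧ 0 < sizeOn (!s) γ := by
  unfold connectedCycles
  rw [Finset.mem_filter]
  cases s
  · exact and_congr_right fun _ => and_comm
  · exact Iff.rfl

/-- The nonzero values of the opener function in one turn are the sizes of the cycles contained in
the circle. -/
theorem IsDrawing.cycleTypeOn_eq (h : IsDrawing f π) (s : Bool) :
    cycleTypeOn s π =
      ((Finset.range (per n m s)).val.map fun i : ℕ => phiOf f s (i : ℤ)).filter (· ≠ 0) := by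
  have hp : (0 : ℤ) < per n m s := by exact_mod_cast per_pos n m s
  unfold cycleTypeOn
  rw [h.map_sizeOn s (fun γ => sizeOn (!s) γ = 0)
    ((Finset.range (per n m s)).filter fun i : ℕ => phiOf f s (i : ℤ) ≠ 0) (fun i : ℕ => (i : ℤ))]
  · rw [Multiset.filter_map, Finset.filter_val]
    refine Multiset.map_congr rfl fun i hi => ?_
    have := (h.noncrossing.phiOf_ne_zero_iff (s := s)).1 (Multiset.mem_filter.1 hi).2
    rw [phiOf, if_pos this]
  · intro γ hγ h0
    obtain ⟨p, rfl⟩ := mem_cycles.1 hγ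
    obtain ⟨x, rfl⟩ := proj_surjective n m p
    obtain ⟨s', t, rfl⟩ := exists_pt x
    rcases Bool.eq_or_eq_not s' s with rfl | rfl
    · exact h.sizeOn_pos _ _
    · exact absurd h0 (h.sizeOn_pos _ _).ne'
  · intro i hi
    exact ((h.noncrossing.phiOf_ne_zero_iff).1 (Finset.mem_filter.1 hi).2).2
  · intro i hi
    have := ((h.noncrossing.phiOf_ne_zero_iff).1 (Finset.mem_filter.1 hi).2).1
    rwa [← h.sizeOn_not_pos_iff, not_lt, Nat.le_zero] at this
  · intro t ht h0
    have hc : ¬ Conn f s t := by rw [← h.sizeOn_not_pos_iff, h0]; exact lt_irrefl _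
    have h1 : t % per n m s = ((t % per n m s).toNat : ℤ) :=
      (Int.toNat_of_nonneg (Int.emod_nonneg _ hp.ne')).symm
    have h2 : (per n m s : ℤ) ∣ t - (t % per n m s).toNat := by
      rw [← h1]
      exact Int.dvd_self_sub_emod
    refine ⟨(t % per n m s).toNat, Finset.mem_filter.2 ⟨Finset.mem_range.2 ?_, ?_⟩, h2⟩
    · have := Int.emod_lt_of_pos t hp
      omega
    · rw [← h.phiOf_add h2, add_sub_cancel]
      exact h.noncrossing.phiOf_ne_zero_iff.2 ⟨hc, ht⟩
  · intro i hi j hj hdvd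
    have hi' := Finset.mem_range.1 (Finset.mem_filter.1 hi).1
    have hj' := Finset.mem_range.1 (Finset.mem_filter.1 hj).1
    have := Int.eq_zero_of_abs_lt_dvd hdvd (by rw [abs_lt]; constructor <;> omega)
    omega

/-- If the first points of the connected cycles on a line are enumerated as `e`, with `c` of them in
each turn, the sizes of the connected cycles are read off from `c` consecutive ones. -/
theorem IsDrawing.connTypeOn_eq (h : IsDrawing f π) (s : Bool) {c : ℕ} (hc : 0 < c) (e : ℤ → ℤ)
    (he : StrictMono e) (hper : ∀ k, e (k + c) = e k + per n m s)
    (hstart : ∀ t, IsStart f s t ↔ ∃ k, t = e k) :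
    connTypeOn s π = (Finset.range c).val.map fun k : ℕ => (block f s (e k)).ncard := by
  have hc' : (0 : ℤ) < c := by exact_mod_cast hc
  have key : ∀ k q : ℤ, e (k + q * c) = e k + q * per n m s := fun k q => add_mul_period hper q k
  have : connectedCycles π = (cycles π).filter fun γ => 0 < sizeOn s γ ∧ 0 < sizeOn (!s) γ := by
    ext γ
    rw [mem_connectedCycles (s := s), Finset.mem_filter]
  rw [connTypeOn, this, h.map_sizeOn s (fun γ => 0 < sizeOn s γ ∧ 0 < sizeOn (!s) γ)
    (Finset.range c) (fun i : ℕ => e i)]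
  · exact fun γ _ h => h.1
  · exact fun i _ => ((hstart _).2 ⟨_, rfl⟩).2
  · exact fun i _ => ⟨h.sizeOn_pos _ _, (h.sizeOn_not_pos_iff _ _).2 ((hstart _).2 ⟨_, rfl⟩).1⟩
  · rintro t ht ⟨-, hQ⟩
    obtain ⟨k, rfl⟩ := (hstart t).1 ⟨(h.sizeOn_not_pos_iff _ _).1 hQ, ht⟩
    have h1 : k % c = ((k % c).toNat : ℤ) :=
      (Int.toNat_of_nonneg (Int.emod_nonneg _ hc'.ne')).symm
    refine ⟨(k % c).toNat, Finset.mem_range.2 ?_, ?_⟩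
    · have := Int.emod_lt_of_pos k hc'
      omega
    · have := key (k % c) (k / c)
      rw [mul_comm, Int.emod_add_mul_ediv] at this
      rw [this, ← h1]
      simp
  · intro i hi j hj hdvd
    rw [Finset.mem_range] at hi hj
    obtain ⟨q, hq⟩ := hdvd
    have h1 := key j q
    rw [mul_comm q (per n m s : ℤ), ← hq, add_sub_cancel] at h1
    have h2 := he.injective h1
    have h3 : (c : ℤ) ∣ (i : ℤ) - j := ⟨q, by rw [mul_comm]; omega⟩
    have := Int.eq_zero_of_abs_lt_dvd h3 (by rw [abs_lt]; constructor <;> omega)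
    omega

/-- A connected point is the first one of its cycle on its line if and only if the arrow to this
point comes from the other line. -/
theorem IsNoncrossing.isFirst_iff (hf : IsNoncrossing f) {t : ℤ} (hc : Conn f s t) :
    IsFirst f s t ↔ ∃ t', f⁻¹ (pt s t) = pt (!s) t' := by
  obtain ⟨x, hx⟩ := hc
  obtain ⟨s', t', ht'⟩ := exists_pt (f⁻¹ (pt s t))
  have hft : f (pt s' t') = pt s t := by rw [← ht']; simp
  have hsc : f.SameCycle (pt s' t') (pt s t) :=
    hft ▸ Equiv.Perm.sameCycle_apply_right.2 (.refl _ _)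
  rw [ht']
  rcases Bool.eq_or_eq_not s' s with rfl | rfl
  · simp only [pt_inj, Bool.eq_not_self, false_and, exists_false, iff_false]
    intro hF
    have hle := hF t' hsc.symm
    have hret := hf.clockwise_return (pt s' t') (pt (!s') x) (hsc.trans hx)
      (by rw [hft]; exact pt_le_pt.2 hle)
    rw [hft] at hret
    cases s'
    · exact absurd hret.1 (not_le.2 (pt_true_lt_pt_false _ _))
    · exact absurd hret.2 (not_le.2 (pt_true_lt_pt_false _ _))
  · refine iff_of_true (fun y hy => ?_) ⟨t', rfl⟩
    have hxy := hsc.trans hy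
    cases s
    · have := hf.clockwise_step _ _ hxy (by rw [hft]; exact pt_true_lt_pt_false _ _)
      rw [hft] at this
      exact pt_le_pt.1 (this.resolve_left (not_le.2 (pt_true_lt_pt_false _ _)))
    · have := hf.clockwise_return _ _ hxy (by rw [hft]; exact (pt_true_lt_pt_false _ _).le)
      rw [hft] at this
      exact pt_le_pt.1 this.1

theorem IsDrawing.conn_iff (h : IsDrawing f π) (s : Bool) (t : ℤ) :
    Conn f s t ↔ cyc π (proj n m (pt s t)) ∈ connectedCycles π := by
  rw [mem_connectedCycles (s := s), h.sizeOn_not_pos_iff]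
  exact ⟨fun hc => ⟨mem_cycles.2 ⟨_, rfl⟩, h.sizeOn_pos s t, hc⟩, fun hc => hc.2.2⟩

omit [NeZero n] [NeZero m] in
theorem proj_eq_pt_iff (x : CoverPoint) (s : Bool) :
    (∃ t, x = pt s t) ↔ ∃ t, proj n m x = proj n m (pt s t) := by
  refine ⟨fun ⟨t, ht⟩ => ⟨t, by rw [ht]⟩, fun ⟨t, ht⟩ => ?_⟩
  obtain ⟨s', t', rfl⟩ := exists_pt x
  obtain ⟨rfl, -⟩ := proj_pt_eq_iff.1 ht
  exact ⟨t', rfl⟩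

/-- The starts of the connected cycles of a drawing are determined by the permutation. -/
theorem IsDrawing.isStart_iff (h : IsDrawing f π) (s : Bool) (t : ℤ) :
    IsStart f s t ↔ cyc π (proj n m (pt s t)) ∈ connectedCycles π ∧
      ∃ t', π⁻¹ (proj n m (pt s t)) = proj n m (pt (!s) t') := by
  rw [IsStart, ← h.conn_iff, and_congr_right_iff]
  intro hc
  rw [h.noncrossing.isFirst_iff hc, proj_eq_pt_iff (n := n) (m := m), h.proj_inv_apply]

end Types


/-! ### Positions of the records of a height function -/

noncomputable section Records

variable {p N : ℕ} {H : ℤ → ℤ}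

/-- The record at height `v`. -/
def recordPos (h : IsHeight p N H) (v : ℤ) : ℤ := (h.bijOn_isRecord.surjOn (Set.mem_univ v)).choose

theorem isRecord_recordPos (h : IsHeight p N H) (v : ℤ) : IsRecord H (recordPos h v) :=
  (h.bijOn_isRecord.surjOn (Set.mem_univ v)).choose_spec.1

theorem height_recordPos (h : IsHeight p N H) (v : ℤ) : H (recordPos h v) = v :=
  (h.bijOn_isRecord.surjOn (Set.mem_univ v)).choose_spec.2

theorem eq_recordPos (h : IsHeight p N H) {t : ℤ} (ht : IsRecord H t) : t = recordPos h (H t) :=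
  h.bijOn_isRecord.injOn ht (isRecord_recordPos h _) (height_recordPos h _).symm

theorem IsHeight.record_lt_iff (h : IsHeight p N H) {t t' : ℤ} (ht : IsRecord H t)
    (ht' : IsRecord H t') : H t < H t' ↔ t < t' := by
  have e := h.height_add_one ht
  have e' := h.height_add_one ht'
  constructor
  · intro hlt
    by_contra hc
    rcases (not_lt.1 hc).eq_or_lt with rfl | h1
    · exact lt_irrefl _ hlt
    · have := ht.height_mono h1
      omega
  · intro hlt
    have := ht'.height_mono hlt
    omega

theorem recordPos_strictMono (h : IsHeight p N H) : StrictMono (recordPos h) := fun v w hvw => by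
  rw [← h.record_lt_iff (isRecord_recordPos h v) (isRecord_recordPos h w),
    height_recordPos h, height_recordPos h]
  exact hvw

theorem recordPos_add (h : IsHeight p N H) (v : ℤ) : recordPos h (v + N) = recordPos h v + p := by
  have h1 : IsRecord H (recordPos h v + p) := (h.isRecord_add _).2 (isRecord_recordPos h v)
  rw [eq_recordPos h h1, h.add_period, height_recordPos h]

end Records

/-! ### Drawings with given heights and given connected cycles -/

noncomputable section Model

/-- The combinatorial shape of a drawing: a height function `H s` on each boundary line `s`, and an
enumeration `u s` of the heights at which the connected cycles start. -/
structure IsShape (p N : Bool → ℕ) (c : ℕ) (H u : Bool → ℤ → ℤ) : Prop where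
  height : ∀ s, IsHeight (p s) (N s) (H s)
  mono : ∀ s, StrictMono (u s)
  add_period : ∀ s k, u s (k + c) = u s k + N s

/-- The name of the block of a point of the strip. The exterior part of the connected cycle number
`k` is the block of records number `k` on the exterior line; its interior part is the block of
records number `-k` on the interior line, as the cycles occur in opposite orders on the two
lines. -/
def stripKey (H u : Bool → ℤ → ℤ) (x : CoverPoint) : (Bool × ℤ) ⊕ ℤ :=
  Sum.elim (fun t => (lineKey (H true) (u true) t).map (Prod.mk true) (sg true * ·))
    (fun t => (lineKey (H false) (u false) t).map (Prod.mk false) (sg false * ·)) (ofLex x)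

variable {p N : Bool → ℕ} {c : ℕ} {H u : Bool → ℤ → ℤ}

theorem stripKey_pt (s : Bool) (t : ℤ) :
    stripKey H u (pt s t) = (lineKey (H s) (u s) t).map (Prod.mk s) (sg s * ·) := by
  cases s <;> rfl

theorem sg_mul_sg (s : Bool) : sg s * sg s = 1 := by cases s <;> rfl

theorem sg_not (s : Bool) : sg (!s) = -sg s := by cases s <;> rfl

theorem stripKey_eq_inl {s s' : Bool} {t i : ℤ} :
    stripKey H u (pt s t) = .inl (s', i) ↔ s = s' ∧ lineKey (H s) (u s) t = .inl i := by
  rw [stripKey_pt]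
  rcases lineKey (H s) (u s) t with j | j <;> simp

theorem stripKey_eq_inr {s : Bool} {t k : ℤ} :
    stripKey H u (pt s t) = .inr k ↔ lineKey (H s) (u s) t = .inr (sg s * k) := by
  rw [stripKey_pt]
  rcases lineKey (H s) (u s) t with j | j
  · simp
  · rw [Sum.map_inr, Sum.inr.injEq, Sum.inr.injEq]
    constructor
    · rintro rfl
      rw [← mul_assoc, sg_mul_sg, one_mul]
    · rintro rfl
      rw [← mul_assoc, sg_mul_sg, one_mul]

theorem stripKey_pt_eq_iff {s : Bool} {t t' : ℤ} :
    stripKey H u (pt s t) = stripKey H u (pt s t') ↔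
      lineKey (H s) (u s) t = lineKey (H s) (u s) t' := by
  rcases h : lineKey (H s) (u s) t with j | j
  · rw [stripKey_eq_inl.2 ⟨rfl, h⟩, eq_comm, stripKey_eq_inl, eq_comm (a := Sum.inl j)]
    simp
  · rw [(stripKey_eq_inr (k := sg s * j)).2, eq_comm, stripKey_eq_inr, ← mul_assoc, sg_mul_sg, one_mul,
      eq_comm (a := Sum.inr j)]
    rw [← mul_assoc, sg_mul_sg, one_mul, h]

variable (hD : IsShape p N c H u)
include hD

theorem IsShape.finite_fiber (x : CoverPoint) : {y | stripKey H u y = stripKey H u x}.Finite := by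
  have hfin : ∀ s κ, {t | lineKey (H s) (u s) t = κ}.Finite := by
    rintro s (i | k)
    · exact ((hD.height s).ncard_lineKey_inl (u s) i).2
    · exact ((hD.height s).ncard_lineKey_inr (hD.mono s) k).2
  have hfin' : ∀ s κ, (pt s '' {t | stripKey H u (pt s t) = κ}).Finite := by
    rintro s (⟨s', i⟩ | k)
    · refine Set.Finite.image _ ((hfin s (.inl i)).subset fun t ht => ?_)
      exact (stripKey_eq_inl.1 ht).2
    · refine Set.Finite.image _ ((hfin s (.inr (sg s * k))).subset fun t ht => ?_)
      exact stripKey_eq_inr.1 ht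
  refine ((hfin' true (stripKey H u x)).union (hfin' false (stripKey H u x))).subset fun y hy => ?_
  obtain ⟨s, t, rfl⟩ := exists_pt y
  cases s
  · exact .inr ⟨t, hy, rfl⟩
  · exact .inl ⟨t, hy, rfl⟩

omit hD in
/-- A block with points on both lines is a connected one. -/
theorem stripKey_of_ne {t t' : ℤ} (h : stripKey H u (pt true t) = stripKey H u (pt false t')) :
    ∃ k, lineKey (H true) (u true) t = .inr k ∧ lineKey (H false) (u false) t' = .inr (-k) := by
  rcases hk : stripKey H u (pt true t) with ⟨s, i⟩ | k
  · have h1 := stripKey_eq_inl.1 hk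
    have h2 := stripKey_eq_inl.1 (h.symm.trans hk)
    exact absurd (h1.1.trans h2.1.symm) (by simp)
  · refine ⟨k, ?_, ?_⟩
    · simpa [sg] using stripKey_eq_inr.1 hk
    · simpa [sg] using stripKey_eq_inr.1 (h.symm.trans hk)

/-- The blocks of a shape do not cross. On one line this is a property of the height function; cycles
connecting the two lines do not cross as they occur in opposite orders on them, and no block of
another kind encloses a record. -/
theorem IsShape.stripKey_noncrossing (a b c d : CoverPoint) (hab : a < b) (hbc : b < c) (hcd : c < d)
    (hac : stripKey H u a = stripKey H u c) (hbd : stripKey H u b = stripKey H u d) :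
    stripKey H u a = stripKey H u b := by
  obtain ⟨sa, a, rfl⟩ := exists_pt a
  obtain ⟨sb, b, rfl⟩ := exists_pt b
  obtain ⟨sc, c, rfl⟩ := exists_pt c
  obtain ⟨sd, d, rfl⟩ := exists_pt d
  have hno : ∀ i j, ¬ pt false i < pt true j := fun i j => not_lt.2 (pt_true_lt_pt_false j i).le
  have hmono := fun s {t t' k k' : ℤ} => (hD.height s).lineKey_mono (hD.mono s) (t := t) (t' := t') (k := k)
      (k' := k')
  cases sa <;> cases sb <;> cases sc <;> cases sd <;>
    first
    | exact absurd hab (hno _ _)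
    | exact absurd hbc (hno _ _)
    | exact absurd hcd (hno _ _)
    | skip
  · rw [pt_lt_pt] at hab hbc hcd
    rw [stripKey_pt_eq_iff] at hac hbd ⊢
    exact (hD.height _).lineKey_noncrossing (hD.mono _) hab hbc hcd hac hbd
  · rw [pt_lt_pt] at hbc hcd
    obtain ⟨k, hak, hck⟩ := stripKey_of_ne hac
    rw [stripKey_pt_eq_iff] at hbd
    rcases hb : lineKey (H false) (u false) b with i | j
    · exact (lineKey_not_inr (hD.mono _) hbc hcd hb (hbd ▸ hb) hck).elim
    · have h1 := hmono _ hbc.le hb hck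
      have h2 := hmono _ hcd.le hck (hbd ▸ hb)
      rw [hac, stripKey_pt_eq_iff, hck, hb, le_antisymm h1 h2]
  · rw [pt_lt_pt] at hab hcd
    obtain ⟨k, hak, hck⟩ := stripKey_of_ne hac
    obtain ⟨k', hbk, hdk⟩ := stripKey_of_ne hbd
    have h1 := hmono _ hab.le hak hbk
    have h2 := hmono _ hcd.le hck hdk
    rw [stripKey_pt_eq_iff, hak, hbk, show k = k' by omega]
  · rw [pt_lt_pt] at hab hbc
    obtain ⟨k, hbk, hdk⟩ := stripKey_of_ne hbd
    rw [stripKey_pt_eq_iff] at hac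
    rcases ha : lineKey (H true) (u true) a with i | j
    · exact (lineKey_not_inr (hD.mono _) hab hbc ha (hac ▸ ha) hbk).elim
    · have h1 := hmono _ hab.le ha hbk
      have h2 := hmono _ hbc.le hbk (hac ▸ ha)
      rw [stripKey_pt_eq_iff, ha, hbk, le_antisymm h1 h2]
  · rw [pt_lt_pt] at hab hbc hcd
    rw [stripKey_pt_eq_iff] at hac hbd ⊢
    exact (hD.height _).lineKey_noncrossing (hD.mono _) hab hbc hcd hac hbd

/-- Every shape is the shape of a noncrossing permutation. -/
theorem IsShape.exists_model : ∃ f : Equiv.Perm CoverPoint, IsNoncrossing f ∧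
    ∀ x y, f.SameCycle x y ↔ stripKey H u x = stripKey H u y :=
  exists_isNoncrossing_of_key _ hD.finite_fiber hD.stripKey_noncrossing

/-- A translation by one period translates the blocks of nonrecords and advances the number of the
connected cycles by `c`. -/
theorem IsShape.stripKey_shift (x : CoverPoint) : stripKey H u (shift (fun s => sg s * p s) x) =
    (stripKey H u x).map (fun y => (y.1, y.2 + sg y.1 * p y.1)) (· + (c : ℤ)) := by
  have key : ∀ s t, lineKey (H s) (u s) (t + sg s * p s) =
      (lineKey (H s) (u s) t).map (· + sg s * (p s : ℤ)) (· + sg s * (c : ℤ)) := by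
    intro s t
    have h := (hD.height s).lineKey_add (hD.mono s) (hD.add_period s)
    cases s
    · have h1 := h (t - p false)
      rw [sub_add_cancel] at h1
      rw [h1, Sum.map_map, show t + sg false * p false = t - p false by simp [sg]; ring]
      rcases lineKey (H false) (u false) (t - p false) with i | i <;> simp [sg]
    · simpa [sg] using h t
  obtain ⟨s, t, rfl⟩ := exists_pt x
  rw [shift_pt, stripKey_pt, stripKey_pt, key, Sum.map_map, Sum.map_map]
  congr 1
  ext k
  simp [mul_add, ← mul_assoc, sg_mul_sg]

variable {f : Equiv.Perm CoverPoint} (hf : IsNoncrossing f)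
  (hk : ∀ x y, f.SameCycle x y ↔ stripKey H u x = stripKey H u y)
include hf hk

/-- The drawing with a given shape has the translation symmetries of the shape. -/
theorem IsShape.model_comm (x : CoverPoint) :
    f (shift (fun s => sg s * p s) x) = shift (fun s => sg s * p s) (f x) := by
  refine hf.commute_of_invariant _ (fun x y => ?_) x
  rw [hk, hk, hD.stripKey_shift, hD.stripKey_shift]
  refine ⟨fun h => Sum.map_injective.2 ⟨?_, add_left_injective _⟩ h, fun h => by rw [h]⟩
  rintro ⟨s, i⟩ ⟨s', j⟩ h
  simp only [Prod.mk.injEq] at h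
  obtain ⟨rfl, h⟩ := h
  simpa using h

omit hf hD in
theorem mem_block_iff {s : Bool} {t t' : ℤ} :
    t' ∈ block f s t ↔ lineKey (H s) (u s) t = lineKey (H s) (u s) t' := by
  rw [← stripKey_pt_eq_iff, ← hk]
  rfl

omit hf hk in
theorem IsShape.lineKey_recordPos {s : Bool} {k v : ℤ} (h1 : u s k ≤ v) (h2 : v < u s (k + 1)) :
    lineKey (H s) (u s) (recordPos (hD.height s) v) = .inr k := by
  rw [lineKey_eq_inr (hD.mono s)]
  rw [height_recordPos (hD.height s)]
  exact ⟨isRecord_recordPos _ _, h1, h2⟩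

omit hf in
/-- Each block of records continues on the other line, so the records are the connected points. -/
theorem IsShape.conn_model_iff {s : Bool} {t : ℤ} : Conn f s t ↔ IsRecord (H s) t := by
  constructor
  · rintro ⟨x, hx⟩
    rw [hk] at hx
    cases s
    · obtain ⟨k, -, h⟩ := stripKey_of_ne hx.symm
      exact ((lineKey_eq_inr (hD.mono _)).1 h).1
    · obtain ⟨k, h, -⟩ := stripKey_of_ne hx
      exact ((lineKey_eq_inr (hD.mono _)).1 h).1
  · intro ht
    obtain ⟨k, hk1, hk2⟩ := exists_index (hD.mono s) (H s t)
    have h1 := (lineKey_eq_inr (hD.mono s)).2 ⟨ht, hk1, hk2⟩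
    have h2 := hD.lineKey_recordPos (s := !s) (k := -k) le_rfl (hD.mono _ (lt_add_one _))
    refine ⟨recordPos (hD.height (!s)) (u (!s) (-k)), (hk _ _).2 ?_⟩
    rw [(stripKey_eq_inr (k := sg s * k)).2, eq_comm]
    · exact stripKey_eq_inr.2 (by rw [h2, sg_not, neg_mul, ← mul_assoc, sg_mul_sg, one_mul])
    · rw [← mul_assoc, sg_mul_sg, one_mul, h1]

/-- The opener function of a drawing is determined by its shape. -/
theorem IsShape.phiOf_model (s : Bool) (i : ℤ) : (phiOf f s i : ℤ) = H s i - H s (i + 1) + 1 := by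
  have hstep := (hD.height s).step i
  by_cases hi : Opens (H s) i i
  · have h1 : lineKey (H s) (u s) i = .inl i := lineKey_eq_inl.2 hi
    have h2 : ¬ Conn f s i := by
      rw [hD.conn_model_iff hk, ← exists_opens_iff]
      exact ⟨i, hi⟩
    have h3 : block f s i = {t | lineKey (H s) (u s) t = .inl i} := by
      ext t
      rw [mem_block_iff hk, h1, eq_comm]
      rfl
    have h4 : IsFirst f s i := by
      intro t ht
      rw [h3] at ht
      exact (lineKey_eq_inl.1 ht).1
    rw [phiOf, if_pos ⟨h2, h4⟩, h3, ((hD.height s).ncard_lineKey_inl (u s) i).1]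
  · have h1 : phiOf f s i = 0 := by
      by_contra h0
      obtain ⟨hc, hF⟩ := hf.phiOf_ne_zero_iff.1 h0
      rw [hD.conn_model_iff hk, ← exists_opens_iff] at hc
      obtain ⟨o, ho⟩ := hc
      have h2 : o ∈ block f s i := by
        rw [mem_block_iff hk, lineKey_eq_inl.2 ho, eq_comm, lineKey_eq_inl]
        by_contra hoo
        have h5 : o < i := lt_of_le_of_ne ho.1 (by rintro rfl; exact hi ho)
        refine hoo ⟨le_rfl, ?_, fun l hl hl' => by omega⟩
        have h6 := ho.2.2 (o + 1) (by omega) (by omega)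
        exact h6.le.trans ho.2.1
      have h3 := hF o h2
      have h4 : o = i := le_antisymm ho.1 h3
      exact hi (h4 ▸ ho)
    rw [h1]
    have : ¬ H s (i + 1) ≤ H s i := fun h => hi ⟨le_rfl, h, fun l hl hl' => by omega⟩
    push_cast
    omega

omit hf in
theorem IsShape.isStart_model_iff {s : Bool} {t : ℤ} :
    IsStart f s t ↔ ∃ k, t = recordPos (hD.height s) (u s k) := by
  have hrec := fun v => isRecord_recordPos (hD.height s) v
  constructor
  · rintro ⟨hc, hF⟩
    rw [hD.conn_model_iff hk] at hc
    obtain ⟨k, hk1, hk2⟩ := exists_index (hD.mono s) (H s t)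
    refine ⟨k, le_antisymm (hF _ ?_) ?_⟩
    · rw [mem_block_iff hk, (lineKey_eq_inr (hD.mono s)).2 ⟨hc, hk1, hk2⟩,
        hD.lineKey_recordPos le_rfl (hD.mono s (lt_add_one k))]
    · rw [eq_recordPos (hD.height s) hc]
      exact (recordPos_strictMono _).monotone hk1
  · rintro ⟨k, rfl⟩
    refine ⟨(hD.conn_model_iff hk).2 (hrec _), fun t' ht' => ?_⟩
    rw [mem_block_iff hk, hD.lineKey_recordPos le_rfl (hD.mono s (lt_add_one k)), eq_comm,
      lineKey_eq_inr (hD.mono s)] at ht'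
    rw [eq_recordPos (hD.height s) ht'.1]
    exact (recordPos_strictMono _).monotone ht'.2.1

omit hf in
theorem IsShape.ncard_block_start (s : Bool) (k : ℤ) :
    ((block f s (recordPos (hD.height s) (u s k))).ncard : ℤ) = u s (k + 1) - u s k := by
  rw [← ((hD.height s).ncard_lineKey_inr (hD.mono s) k).1]
  congr 2
  ext t
  rw [mem_block_iff hk, hD.lineKey_recordPos le_rfl (hD.mono s (lt_add_one k)), eq_comm]
  rfl

/-- The arrow from the exterior part to the interior part of the connected cycle number `k`. -/
theorem IsShape.model_apply (k : ℤ) : f (pt true (recordPos (hD.height true) (u true (k + 1) - 1))) =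
    pt false (recordPos (hD.height false) (u false (-k))) := by
  have hlt := hD.mono true (lt_add_one k)
  have hlt' := hD.mono false (lt_add_one (-k))
  have h1 := hD.lineKey_recordPos (s := true) (k := k) (v := u true (k + 1) - 1) (by omega)
    (by omega)
  set a := recordPos (hD.height true) (u true (k + 1) - 1) with ha
  set b := recordPos (hD.height false) (u false (-k)) with hb
  have h2 : lineKey (H false) (u false) b = .inr (-k) := hD.lineKey_recordPos le_rfl hlt'
  have hk1 : stripKey H u (pt true a) = .inr k := stripKey_eq_inr.2 (by simpa [sg] using h1)
  have hk2 : stripKey H u (pt false b) = .inr k := stripKey_eq_inr.2 (by simpa [sg] using h2)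
  -- the preimage of the first interior point is exterior, and it is the last exterior point
  have hstart : IsStart f false b := (hD.isStart_model_iff hk).2 ⟨-k, rfl⟩
  obtain ⟨t, ht⟩ := (hf.isFirst_iff hstart.1).1 hstart.2
  rw [Bool.not_false] at ht
  have hft : f (pt true t) = pt false b := by rw [← ht]; simp
  have hsc : f.SameCycle (pt true t) (pt false b) :=
    hft ▸ Equiv.Perm.sameCycle_apply_right.2 (.refl _ _)
  have hkt : stripKey H u (pt true t) = .inr k := ((hk _ _).1 hsc).trans hk2
  have hsc' : f.SameCycle (pt true t) (pt true a) := (hk _ _).2 (hkt.trans hk1.symm)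
  have hat : a ≤ t := by
    have := hf.clockwise_step _ _ hsc' (by rw [hft]; exact pt_true_lt_pt_false _ _)
    rw [hft] at this
    exact pt_le_pt.1 (this.resolve_right (not_le.2 (pt_true_lt_pt_false _ _)))
  have hta : t ≤ a := by
    rw [stripKey_eq_inr] at hkt
    have hr := (lineKey_eq_inr (hD.mono true)).1 hkt
    rw [eq_recordPos (hD.height true) hr.1]
    refine (recordPos_strictMono _).monotone ?_
    have : sg true * k = k := by simp [sg]
    rw [this] at hr
    omega
  rw [le_antisymm hat hta, hft]

end Model


/-! ### The heights and the connected cycles of a drawing -/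

noncomputable section Extraction

/-- A nonempty periodic set of integers can be enumerated increasingly by the integers, starting
at any of its elements. -/
theorem exists_enumeration {L : Set ℤ} {N : ℤ} (hN : 0 < N) (hL : ∀ v, v + N ∈ L ↔ v ∈ L)
    {v₀ : ℤ} (hv₀ : v₀ ∈ L) : ∃ u : ℤ → ℤ, StrictMono u ∧ (∀ v, v ∈ L ↔ ∃ k, v = u k) ∧ u 0 = v₀ := by
  classical
  let _ : LocallyFiniteOrder L := inferInstance
  let _ : SuccOrder L := LinearLocallyFiniteOrder.succOrder L
  let _ : PredOrder L := LinearLocallyFiniteOrder.predOrder L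
  have : NoMaxOrder L := ⟨fun v => ⟨⟨v + N, (hL _).2 v.2⟩, Subtype.coe_lt_coe.1 (by simpa)⟩⟩
  have : NoMinOrder L := ⟨fun v => ⟨⟨v - N, by rw [← hL]; simp⟩, Subtype.coe_lt_coe.1 (by simpa)⟩⟩
  have : Nonempty L := ⟨⟨v₀, hv₀⟩⟩
  let e : L ≃o ℤ := orderIsoIntOfLinearSuccPredArch
  refine ⟨fun k => e.symm (k + e ⟨v₀, hv₀⟩), fun a b hab => ?_, fun v => ⟨fun hv => ?_, ?_⟩, by simp⟩
  · exact Subtype.coe_lt_coe.2 (e.symm.strictMono (by simpa using hab))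
  · exact ⟨e ⟨v, hv⟩ - e ⟨v₀, hv₀⟩, by simp⟩
  · rintro ⟨k, rfl⟩
    exact Subtype.coe_prop _

theorem apply_natCast_eq_sum {F g : ℤ → ℤ} (h : ∀ t, F (t + 1) = F t + g t) (p : ℕ) :
    F p = F 0 + ∑ i ∈ Finset.range p, g i := by
  induction p with
  | zero => simp
  | succ p ih => rw [Finset.sum_range_succ, Nat.cast_succ, h, ih, add_assoc]

theorem IsFirst.eq {f : Equiv.Perm CoverPoint} {s : Bool} {a b : ℤ} (ha : IsFirst f s a)
    (hb : IsFirst f s b) (h : b ∈ block f s a) : a = b :=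
  le_antisymm (ha b h) (hb a (mem_block_comm.1 h))

variable {n m : ℕ} [NeZero n] [NeZero m] {f : Equiv.Perm CoverPoint} {π : Equiv.Perm (Point n m)}

/-- A drawing whose connected cycles are numbered in their order along both boundary lines has the
shape given by its openers and by the heights of the first points of the connected cycles. -/
theorem IsNoncrossing.sameCycle_iff_stripKey (hf : IsNoncrossing f) {H e : Bool → ℤ → ℤ}
    {p N : Bool → ℕ} (hH : ∀ s t, H s (t + 1) = H s t + (1 - phiOf f s t))
    (hheight : ∀ s, IsHeight (p s) (N s) (H s)) (he : ∀ s, StrictMono (e s))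
    (hstart : ∀ s k, IsStart f s (e s k))
    (hcover : ∀ t, IsStart f true t → ∃ k, t = e true k)
    (hpair : ∀ k, f.SameCycle (pt true (e true k)) (pt false (e false (-k)))) (x y : CoverPoint) :
    f.SameCycle x y ↔ stripKey H (fun s k => H s (e s k)) x =
      stripKey H (fun s k => H s (e s k)) y := by
  have hrec : ∀ s t, IsRecord (H s) t ↔ Conn f s t := fun s t => hf.isRecord_iff (hH s)
  have hu : ∀ s, StrictMono fun k => H s (e s k) := fun s k k' hkk' =>
    ((hheight s).record_lt_iff ((hrec s _).2 (hstart s k).1) ((hrec s _).2 (hstart s k').1)).2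
      (he s hkk')
  -- the block of each point, for points of the two kinds
  have hspec : ∀ x, (∃ s i, stripKey H (fun s k => H s (e s k)) x = .inl (s, i) ∧
      (∃ t, x = pt s t ∧ ¬ Conn f s t) ∧ f.SameCycle x (pt s i) ∧ IsFirst f s i) ∨
      ∃ j, stripKey H (fun s k => H s (e s k)) x = .inr j ∧ f.SameCycle x (pt true (e true j)) := by
    intro x
    obtain ⟨s, t, rfl⟩ := exists_pt x
    by_cases hc : Conn f s t
    · right
      -- the number of the cycle is found at its first exterior point
      obtain ⟨j, hj⟩ : ∃ j, f.SameCycle (pt s t) (pt true (e true j)) := by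
        obtain ⟨a, ha⟩ : ∃ a, f.SameCycle (pt s t) (pt true a) := by
          cases s
          · exact hc
          · exact ⟨t, .refl _ _⟩
        obtain ⟨b, hb⟩ : ∃ b, f.SameCycle (pt s t) (pt false b) := by
          cases s
          · exact ⟨t, .refl _ _⟩
          · exact hc
        obtain ⟨o, ho, hof⟩ := hf.exists_isFirst true a
        obtain ⟨k, rfl⟩ := hcover o ⟨⟨b, Equiv.Perm.SameCycle.trans
          (Equiv.Perm.SameCycle.symm ho) (ha.symm.trans hb)⟩, hof⟩
        exact ⟨k, ha.trans ho⟩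
      refine ⟨j, ?_, hj⟩
      have hblock : e s (sg s * j) ∈ block f s t := by
        cases s
        · have : sg false * j = -j := by simp [sg]
          rw [this]
          exact hj.trans (hpair j)
        · have : sg true * j = j := by simp [sg]
          rw [this]
          exact hj
      have hblock' := mem_block_comm.1 hblock
      rw [stripKey_eq_inr, lineKey_eq_inr (hu s)]
      set k := sg s * j
      have hrt := (hrec s t).2 hc
      refine ⟨hrt, ?_, ?_⟩
      · rcases ((hstart s k).2 t hblock').eq_or_lt with h | h
        · simp [h]
        · exact (((hheight s).record_lt_iff ((hrec s _).2 (hstart s k).1) hrt).2 h).le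
      · rw [(hheight s).record_lt_iff hrt ((hrec s _).2 (hstart s (k + 1)).1)]
        have hne : e s (k + 1) ∉ block f s (e s k) := fun h => by
          have := (he s).injective ((hstart s k).2.eq (hstart s (k + 1)).2 h)
          omega
        rcases lt_trichotomy t (e s (k + 1)) with h | h | h
        · exact h
        · rw [h] at hblock'
          exact absurd hblock' hne
        · exact absurd (hf.mem_block_of_conn (he s (lt_add_one k)) h hblock' (hstart s _).1) hne
    · left
      obtain ⟨i, hi, hif⟩ := hf.exists_isFirst s t
      refine ⟨s, i, ?_, ⟨t, rfl, hc⟩, hi, hif⟩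
      rw [stripKey_eq_inl, lineKey_eq_inl, hf.opens_iff (hH s)]
      exact ⟨rfl, hc, mem_block_comm.1 hi, hif⟩
  constructor
  · intro hxy
    rcases hspec x with ⟨s, i, hx, ⟨t, rfl, hc⟩, hxi, hif⟩ | ⟨j, hx, hxj⟩
    · rcases hspec y with ⟨s', i', hy, ⟨t', rfl, hc'⟩, hyi', hif'⟩ | ⟨j', hy, hyj'⟩
      · rcases Bool.eq_or_eq_not s' s with rfl | rfl
        · rw [hx, hy, hif.eq hif' (hxi.symm.trans (hxy.trans hyi'))]
        · exact absurd ⟨t', hxy⟩ hc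
      · refine absurd ?_ hc
        cases s
        · exact ⟨_, hxy.trans hyj'⟩
        · exact ⟨_, (hxy.trans hyj').trans (hpair j')⟩
    · rcases hspec y with ⟨s', i', hy, ⟨t', rfl, hc'⟩, hyi', hif'⟩ | ⟨j', hy, hyj'⟩
      · refine absurd ?_ hc'
        cases s'
        · exact ⟨_, hxy.symm.trans hxj⟩
        · exact ⟨_, (hxy.symm.trans hxj).trans (hpair j)⟩
      · rw [hx, hy]
        congr 1
        exact (he true).injective ((hstart true j).2.eq (hstart true j').2
          (hxj.symm.trans (hxy.trans hyj')))
  · intro hxy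
    rcases hspec x with ⟨s, i, hx, -, hxi, -⟩ | ⟨j, hx, hxj⟩
    · rcases hspec y with ⟨s', i', hy, -, hyi', -⟩ | ⟨j', hy, hyj'⟩
      · have := (hx.symm.trans hxy).trans hy
        simp only [Sum.inl.injEq, Prod.mk.injEq] at this
        obtain ⟨rfl, rfl⟩ := this
        exact hxi.trans hyi'.symm
      · exact absurd ((hx.symm.trans hxy).trans hy) (by simp)
    · rcases hspec y with ⟨s', i', hy, -, hyi', -⟩ | ⟨j', hy, hyj'⟩
      · exact absurd ((hx.symm.trans hxy).trans hy) (by simp)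
      · have := (hx.symm.trans hxy).trans hy
        simp only [Sum.inr.injEq] at this
        subst this
        exact hxj.trans hyj'.symm

/-- The heights of a drawing. -/
def heightOf (f : Equiv.Perm CoverPoint) (s : Bool) : ℤ → ℤ := psum fun t => 1 - phiOf f s t

theorem heightOf_add_one (f : Equiv.Perm CoverPoint) (s : Bool) (t : ℤ) :
    heightOf f s (t + 1) = heightOf f s t + (1 - phiOf f s t) := psum_add_one _ _

theorem IsDrawing.isHeight (h : IsDrawing f π) {s : Bool} {N : ℕ} (hN : 0 < N)
    (hsum : ∑ i ∈ Finset.range (per n m s), phiOf f s (i : ℤ) + N = per n m s) :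
    IsHeight (per n m s) N (heightOf f s) where
  period_pos := per_pos n m s
  drift_pos := hN
  step t := by
    rw [heightOf_add_one]
    omega
  add_period t := by
    rw [AnnularNC.add_period (heightOf_add_one f s) (fun t => by rw [h.phiOf_add (dvd_refl _)]) 0,
      zero_add, apply_natCast_eq_sum (heightOf_add_one f s)]
    have : (per n m s : ℤ) = ∑ i ∈ Finset.range (per n m s), (phiOf f s (i : ℤ) : ℤ) + N := by
      exact_mod_cast hsum.symm
    rw [Finset.sum_sub_distrib]
    simp
    linarith

/-- Every drawing with a connected cycle has a shape. -/
theorem IsDrawing.exists_shape (h : IsDrawing f π) {N : Bool → ℕ} (hN : ∀ s, 0 < N s)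
    (hsum : ∀ s, ∑ i ∈ Finset.range (per n m s), phiOf f s (i : ℤ) + N s = per n m s) {z₀ : ℤ}
    (hz₀ : IsStart f true z₀) : ∃ (c : ℕ) (u : Bool → ℤ → ℤ), 0 < c ∧
      IsShape (per n m) N c (heightOf f) u ∧ u true 0 = heightOf f true z₀ ∧
      ∀ x y, f.SameCycle x y ↔ stripKey (heightOf f) u x = stripKey (heightOf f) u y := by
  have hf := h.noncrossing
  have hheight : ∀ s, IsHeight (per n m s) (N s) (heightOf f s) := fun s => h.isHeight (hN s) (hsum s)
  have hrec : ∀ s t, IsRecord (heightOf f s) t ↔ Conn f s t := fun s t =>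
    hf.isRecord_iff (heightOf_add_one f s)
  -- the exterior starts
  obtain ⟨z, hz, hzL, hz0⟩ := exists_enumeration (L := {t | IsStart f true t})
    (N := per n m true) (by exact_mod_cast per_pos n m true) (fun t => h.isStart_add (dvd_refl _) t) hz₀
  have hzs : ∀ k, IsStart f true (z k) := fun k => (hzL _).2 ⟨k, rfl⟩
  -- the number of cycles in a period
  obtain ⟨c, hc⟩ : ∃ c, z 0 + per n m true = z c :=
    (hzL _).1 ((h.isStart_add (dvd_refl _) _).2 (hzs 0))
  have hc0 : 0 < c := by
    rw [← hz.lt_iff_lt, ← hc]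
    have : (0 : ℤ) < per n m true := by exact_mod_cast per_pos n m true
    omega
  obtain ⟨c, rfl⟩ := Int.eq_ofNat_of_zero_le hc0.le
  have hzc : ∀ k, z (k + c) = z k + per n m true := by
    refine fun k => congrFun (eq_of_range_eq (u := fun k => z (k + c))
      (v := fun k => z k + per n m true) (fun a b hab => hz (by simpa using hab))
      (fun a b hab => by simpa using hz hab) ?_ (by simpa using hc.symm)) k
    ext t
    constructor
    · rintro ⟨k, rfl⟩
      obtain ⟨j, hj⟩ := (hzL (z (k + c) - per n m true)).1
        (by rw [Set.mem_ofPred_eq, ← h.isStart_add (dvd_refl _)]; simpa using hzs _)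
      exact ⟨j, by simp [← hj]⟩
    · rintro ⟨k, rfl⟩
      obtain ⟨j, hj⟩ := (hzL _).1 ((h.isStart_add (dvd_refl _) _).2 (hzs k))
      exact ⟨j - c, by simp [hj]⟩
  -- the corresponding interior starts
  have hw : ∀ k, ∃ w, f.SameCycle (pt true (z k)) (pt false w) ∧ IsStart f false w := by
    intro k
    obtain ⟨t, ht⟩ := (hzs k).1
    obtain ⟨w, hw, hwf⟩ := hf.exists_isFirst false t
    exact ⟨w, ht.trans hw, ⟨z k, (ht.trans hw).symm⟩, hwf⟩
  choose w hzw hws using hw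
  have hzinj : ∀ {j k}, f.SameCycle (pt true (z j)) (pt true (z k)) → j = k := fun hjk =>
    hz.injective ((hzs _).2.eq (hzs _).2 hjk)
  have hwanti : StrictAnti w := by
    intro j k hjk
    rcases lt_trichotomy (w k) (w j) with hlt | heq | hlt
    · exact hlt
    · have := hzinj ((hzw j).trans (heq ▸ (hzw k).symm))
      omega
    · have := hzinj (hf.sameCycle_of_lt (pt_lt_pt.2 (hz hjk)) (pt_true_lt_pt_false _ _)
        (pt_lt_pt.2 hlt) (hzw j) (hzw k))
      omega
  have hwc : ∀ k, w (k + c) = w k - per n m false := by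
    intro k
    have h1 := (h.sameCycle_shift 1 _ _).2 (hzw k)
    rw [shift_pt, shift_pt] at h1
    have h2 : deckVec n m 1 true = per n m true := by simp [deckVec, sg]
    have h3 : deckVec n m 1 false = -per n m false := by simp [deckVec, sg]
    rw [h2, h3, ← hzc] at h1
    refine (hws (k + c)).2.eq ?_ ((hzw (k + c)).symm.trans ?_)
    · have := (h.isFirst_add (s := false) (a := -per n m false) (by simp) (w k)).2 (hws k).2
      rwa [← sub_eq_add_neg] at this
    · rwa [← sub_eq_add_neg] at h1
  let e : Bool → ℤ → ℤ := fun s => if s then z else fun k => w (-k)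
  have he : ∀ s, StrictMono (e s) := by
    rintro (_ | _)
    · intro a b hab
      exact hwanti (by simpa using hab)
    · exact hz
  have hes : ∀ s k, IsStart f s (e s k) := by
    rintro (_ | _) k
    · exact hws _
    · exact hzs _
  have hec : ∀ s k, e s (k + c) = e s k + per n m s := by
    rintro (_ | _) k
    · have := hwc (-(k + c))
      rw [show -(k + (c : ℤ)) + c = -k by ring] at this
      change w (-(k + c)) = w (-k) + _
      omega
    · exact hzc k
  refine ⟨c, fun s k => heightOf f s (e s k), by exact_mod_cast hc0, ⟨hheight, fun s a b hab => ?_,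
    fun s k => ?_⟩, ?_, ?_⟩
  · exact ((hheight s).record_lt_iff ((hrec s _).2 (hes s _).1) ((hrec s _).2 (hes s _).1)).2
      (he s hab)
  · simp only [hec, (hheight s).add_period]
  · change heightOf f true (z 0) = _
    rw [hz0]
  · refine hf.sameCycle_iff_stripKey (heightOf_add_one f) hheight he hes (fun t ht => (hzL t).1 ht)
      fun k => ?_
    change f.SameCycle (pt true (z k)) (pt false (w (- -k)))
    rw [neg_neg]
    exact hzw k

end Extraction


/-! ### What the permutation determines about its drawings -/

section Uniqueness

variable {n m : ℕ} [NeZero n] [NeZero m] {f f' : Equiv.Perm CoverPoint}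
  {π : Equiv.Perm (Point n m)}

theorem IsDrawing.cyc_proj_eq (h : IsDrawing f π) {x y : CoverPoint} (hxy : f.SameCycle x y) :
    cyc π (proj n m x) = cyc π (proj n m y) := by
  rw [cyc_eq_iff, h.sameCycle_proj]
  exact ⟨0, by simpa [deckVec_zero] using hxy⟩

theorem IsDrawing.exists_conn (h : IsDrawing f π) (hπ : (connectedCycles π).Nonempty) (s : Bool) :
    ∃ t, Conn f s t := by
  obtain ⟨γ, hγ⟩ := hπ
  have hγ' := (mem_connectedCycles (s := s)).1 hγ
  obtain ⟨p, rfl⟩ := mem_cycles.1 hγ'.1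
  obtain ⟨x, rfl⟩ := proj_surjective n m p
  obtain ⟨t, ht⟩ := (h.sizeOn_cyc_pos_iff s x).1 hγ'.2.1
  exact ⟨t, by rwa [h.conn_iff, ← h.cyc_proj_eq ht]⟩

/-- Two drawings of the same permutation agree on the cycles that are not connected, as such a
cycle lies between two consecutive points of connected cycles, which are less than one turn
apart. -/
theorem IsDrawing.apply_eq_of_not_conn (h : IsDrawing f π) (h' : IsDrawing f' π)
    (hπ : (connectedCycles π).Nonempty) {x : CoverPoint}
    (hx : cyc π (proj n m x) ∉ connectedCycles π) : f x = f' x := by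
  obtain ⟨s, t, rfl⟩ := exists_pt x
  have hp : (0 : ℤ) < per n m s := by exact_mod_cast per_pos n m s
  have hline : ∀ {f : Equiv.Perm CoverPoint}, IsDrawing f π →
      ∃ a, f (pt s t) = pt s a ∧ a ∈ block f s t := by
    intro f h
    have hsc : f.SameCycle (pt s t) (f (pt s t)) := Equiv.Perm.sameCycle_apply_right.2 (.refl _ _)
    obtain ⟨s', a, ha⟩ := exists_pt (f (pt s t))
    rw [ha] at hsc
    rcases Bool.eq_or_eq_not s' s with rfl | rfl
    · exact ⟨a, ha, hsc⟩
    · exact absurd ((h.conn_iff _ _).1 ⟨a, hsc⟩) hx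
  have hlt : ∀ {f f' : Equiv.Perm CoverPoint}, IsDrawing f π → IsDrawing f' π → ∀ {a b},
      f (pt s t) = pt s a → a ∈ block f s t → f' (pt s t) = pt s b → b ∈ block f' s t →
      ¬ a < b := by
    intro f f' h h' a b ha hab hb hbb hlt
    have hdvd : (per n m s : ℤ) ∣ b - a := by
      have := (h.proj_apply (pt s t)).trans (h'.proj_apply (pt s t)).symm
      rw [ha, hb, proj_pt_eq_iff] at this
      exact this.2
    have hle := Int.le_of_dvd (by omega) hdvd
    have htc : ∀ {f : Equiv.Perm CoverPoint}, IsDrawing f π → ¬ Conn f s t := fun h => by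
      rwa [h.conn_iff]
    -- a connected point between `a` and `b`
    obtain ⟨q, hq⟩ := h.exists_conn hπ s
    obtain ⟨q', hq', haq, hqb⟩ : ∃ q', (∀ {f : Equiv.Perm CoverPoint}, IsDrawing f π →
        Conn f s q') ∧ a ≤ q' ∧ q' < b := by
      refine ⟨a + (q - a) % per n m s, fun h'' => ?_, ?_, ?_⟩
      · rw [h.conn_iff] at hq
        rw [h''.conn_iff]
        convert hq using 2
        rw [proj_pt_eq_iff]
        refine ⟨rfl, ?_⟩
        rw [← sub_sub]
        exact Int.dvd_self_sub_emod
      · have := Int.emod_nonneg (q - a) hp.ne'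
        omega
      · have := Int.emod_lt_of_pos (q - a) hp
        omega
    have hac : ¬ Conn f s a := by rw [conn_congr hab]; exact htc h
    have haq' : a < q' := lt_of_le_of_ne haq (by rintro rfl; exact hac (hq' h))
    rcases lt_trichotomy q' t with hqt | rfl | hqt
    · have := h.noncrossing.mem_block_of_conn haq' hqt (mem_block_comm.1 hab) (hq' h)
      exact hac ((conn_congr this).1 (hq' h))
    · exact htc h (hq' h)
    · have := h'.noncrossing.mem_block_of_conn hqt hqb hbb (hq' h')
      exact htc h' ((conn_congr this).1 (hq' h'))
  obtain ⟨a, ha, hab⟩ := hline h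
  obtain ⟨b, hb, hbb⟩ := hline h'
  rw [ha, hb, le_antisymm (not_lt.1 (hlt h' h hb hbb ha hab)) (not_lt.1 (hlt h h' ha hab hb hbb))]

theorem IsDrawing.sameCycle_of_not_conn (h : IsDrawing f π) (h' : IsDrawing f' π)
    (hπ : (connectedCycles π).Nonempty) {x y : CoverPoint}
    (hx : cyc π (proj n m x) ∉ connectedCycles π) (hxy : f.SameCycle x y) : f'.SameCycle x y := by
  obtain ⟨i, rfl⟩ := hxy
  have hcyc : ∀ i : ℤ, cyc π (proj n m ((f ^ i) x)) ∉ connectedCycles π := fun i => by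
    rwa [← h.cyc_proj_eq ⟨i, rfl⟩]
  refine ⟨i, ?_⟩
  induction i using Int.induction_on with
  | zero => rfl
  | succ k ih =>
    rw [add_comm, zpow_one_add, zpow_one_add, Equiv.Perm.mul_apply, Equiv.Perm.mul_apply, ih,
      h.apply_eq_of_not_conn h' hπ (hcyc _)]
  | pred k ih =>
    have e : ∀ g : Equiv.Perm CoverPoint, (g ^ (-(k : ℤ))) x = g ((g ^ (-(k : ℤ) - 1)) x) := by
      intro g
      rw [← Equiv.Perm.mul_apply, ← zpow_one_add]
      ring_nf
    rw [e, e, h.apply_eq_of_not_conn h' hπ (hcyc _)] at ih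
    exact f'.injective ih

/-- The openers are determined by the permutation. -/
theorem IsDrawing.phiOf_eq (h : IsDrawing f π) (h' : IsDrawing f' π)
    (hπ : (connectedCycles π).Nonempty) (s : Bool) (t : ℤ) : phiOf f s t = phiOf f' s t := by
  have hc : Conn f s t ↔ Conn f' s t := by rw [h.conn_iff, h'.conn_iff]
  unfold phiOf
  by_cases ht : Conn f s t
  · rw [if_neg (fun h => h.1 ht), if_neg (fun h => h.1 (hc.1 ht))]
  · have hb : block f s t = block f' s t := by
      have ht' := ht
      rw [h.conn_iff] at ht'
      exact Set.ext fun y => ⟨h.sameCycle_of_not_conn h' hπ ht', h'.sameCycle_of_not_conn h hπ ht'⟩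
    rw [hc, IsFirst, IsFirst, hb]

theorem IsDrawing.isStart_congr (h : IsDrawing f π) (h' : IsDrawing f' π) (s : Bool) (t : ℤ) :
    IsStart f s t ↔ IsStart f' s t := by rw [h.isStart_iff, h'.isStart_iff]

theorem conj_sameCycle_iff (v : Bool → ℤ) (f : Equiv.Perm CoverPoint) (x y : CoverPoint) :
    ((shift v).toEquiv.permCongr f).SameCycle (shift v x) (shift v y) ↔ f.SameCycle x y := by
  rw [sameCycle_conj_iff]
  simp

/-- The openers of a rotation invariant permutation are rotation invariant. -/
theorem IsDrawing.phiOf_add_of_fixed (h : IsDrawing f π) (hπ : (connectedCycles π).Nonempty)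
    {v : Bool → ℤ} (hv : (rotBy n m v).permCongr π = π) (s : Bool) (t : ℤ) :
    phiOf f s (t + v s) = phiOf f s t := by
  have h' := h.conj v
  rw [hv] at h'
  rw [h.phiOf_eq h' hπ, phiOf_translate (conj_sameCycle_iff v f)]

/-- The starts of a rotation invariant permutation are rotation invariant. -/
theorem IsDrawing.isStart_add_of_fixed (h : IsDrawing f π)
    {v : Bool → ℤ} (hv : (rotBy n m v).permCongr π = π) (s : Bool) (t : ℤ) :
    IsStart f s (t + v s) ↔ IsStart f s t := by
  have h' := h.conj v
  rw [hv] at h'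
  rw [h.isStart_congr h', isStart_translate (conj_sameCycle_iff v f)]

end Uniqueness


/-! ### Encoding permutations by periodic functions -/

noncomputable section Data

/-- The combinatorial data encoding an annular noncrossing permutation with a distinguished
connected cycle: on each boundary line `s`, the opener function `φ s`, the sizes `a s` of the parts
of the connected cycles on that line (in their order along the line, the distinguished one having
number `0`), and the height `x s` of the first point of the distinguished part. -/
@[ext] structure Datum where
  φ : Bool → ℤ → ℕ
  a : Bool → ℤ → ℕ
  x : Bool → ℤ

/-- The height functions of a datum. -/
def Datum.height (D : Datum) (s : Bool) : ℤ → ℤ := psum fun t => 1 - D.φ s t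

/-- The heights of the first points of the connected cycles of a datum. -/
def Datum.starts (D : Datum) (s : Bool) (k : ℤ) : ℤ := D.x s + psum (fun k => D.a s k) k

theorem Datum.height_add_one (D : Datum) (s : Bool) (t : ℤ) :
    D.height s (t + 1) = D.height s t + (1 - D.φ s t) := psum_add_one _ _

theorem Datum.starts_add_one (D : Datum) (s : Bool) (k : ℤ) :
    D.starts s (k + 1) = D.starts s k + D.a s k := by
  rw [Datum.starts, psum_add_one, ← add_assoc, Datum.starts]

theorem Datum.starts_zero (D : Datum) (s : Bool) : D.starts s 0 = D.x s := by simp [Datum.starts]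

/-- The numerical constraints relating the numbers `p` of points, `N` of points of connected cycles
and `c` of connected cycles, and the multisets `A` of values of the opener functions and `Λ` of sizes of
the parts of connected cycles. -/
structure IsAdmissible (p N : Bool → ℕ) (c : ℕ) (A Λ : Bool → Multiset ℕ) : Prop where
  c_pos : 0 < c
  N_pos : ∀ s, 0 < N s
  card_A : ∀ s, (A s).card = p s
  sum_A : ∀ s, (A s).sum + N s = p s
  card_Λ : ∀ s, (Λ s).card = c
  sum_Λ : ∀ s, (Λ s).sum = N s
  pos_Λ : ∀ s, ∀ i ∈ Λ s, 0 < i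

/-- The data with prescribed values, normalized by choosing the heights `x` in one period. -/
structure Datum.IsOfType (p N : Bool → ℕ) (c : ℕ) (A Λ : Bool → Multiset ℕ) (D : Datum) : Prop where
  φ_add : ∀ s t, D.φ s (t + p s) = D.φ s t
  φ_type : ∀ s, ((Finset.range (p s)).val.map fun i : ℕ => D.φ s i) = A s
  a_add : ∀ s k, D.a s (k + c) = D.a s k
  a_type : ∀ s, ((Finset.range c).val.map fun i : ℕ => D.a s i) = Λ s
  x_nonneg : ∀ s, 0 ≤ D.x s
  x_lt : ∀ s, D.x s < N s

/-- The cycles of `f` are the blocks encoded by `D`. -/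
def Draws (f : Equiv.Perm CoverPoint) (D : Datum) : Prop :=
  ∀ x y, f.SameCycle x y ↔ stripKey D.height D.starts x = stripKey D.height D.starts y

/-- A periodic property can be checked on one period. -/
theorem forall_of_forall_range {c : ℕ} (hc : 0 < c) {P : ℤ → Prop}
    (hP : ∀ k, P (k + c) ↔ P k) (h : ∀ i < c, P (i : ℕ)) (k : ℤ) : P k := by
  have hc' : (0 : ℤ) < c := by exact_mod_cast hc
  have key : ∀ q k : ℤ, P (k + q * c) ↔ P k := by
    intro q
    induction q using Int.induction_on with
    | zero => simp
    | succ q ih => intro k; rw [add_mul, one_mul, ← add_assoc, hP, ih]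
    | pred q ih =>
      intro k
      rw [← hP, show k + (-(q : ℤ) - 1) * c + c = k + -q * c by ring, ih]
  have h1 : k = k % c + (k / c) * c := by rw [mul_comm, Int.emod_add_mul_ediv]
  have h2 : k % c = ((k % c).toNat : ℤ) := (Int.toNat_of_nonneg (Int.emod_nonneg _ hc'.ne')).symm
  rw [h1, key, h2]
  have := Int.emod_lt_of_pos k hc'
  exact h _ (by omega)

variable {p N : Bool → ℕ} {c : ℕ} {A Λ : Bool → Multiset ℕ} {D : Datum}

theorem sum_range_eq {p : ℕ} {g : ℤ → ℕ} {A : Multiset ℕ}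
    (h : ((Finset.range p).val.map fun i : ℕ => g i) = A) :
    ∑ i ∈ Finset.range p, g i = A.sum := by rw [← h]; rfl

theorem Datum.IsOfType.a_pos (hD : D.IsOfType p N c A Λ) (hA : IsAdmissible p N c A Λ) (s : Bool)
    (k : ℤ) : 0 < D.a s k := by
  refine forall_of_forall_range hA.c_pos (P := fun k => 0 < D.a s k) (fun k => ?_) (fun i hi => ?_) k
  · rw [hD.a_add]
  · refine hA.pos_Λ s _ ?_
    rw [← hD.a_type s]
    exact Multiset.mem_map_of_mem _ (Finset.mem_range.2 hi)

theorem Datum.IsOfType.isShape (hD : D.IsOfType p N c A Λ) (hA : IsAdmissible p N c A Λ) :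
    IsShape p N c D.height D.starts where
  height s :=
    { period_pos := by have := hA.sum_A s; have := hA.N_pos s; omega
      drift_pos := hA.N_pos s
      step := fun t => by rw [D.height_add_one]; omega
      add_period := fun t => by
        rw [AnnularNC.add_period (D.height_add_one s) (fun t => by rw [hD.φ_add]) 0, zero_add,
          apply_natCast_eq_sum (D.height_add_one s), Finset.sum_sub_distrib, ← Nat.cast_sum,
          sum_range_eq (hD.φ_type s)]
        have := hA.sum_A s
        simp only [Finset.sum_const, Finset.card_range, nsmul_eq_mul, mul_one]
        omega }
  mono s := strictMono_int_of_lt_succ fun k => by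
    rw [D.starts_add_one]
    have := hD.a_pos hA s k
    omega
  add_period s k := by
    rw [AnnularNC.add_period (D.starts_add_one s) (fun k => by rw [hD.a_add]) 0, zero_add,
      apply_natCast_eq_sum (D.starts_add_one s), ← Nat.cast_sum, sum_range_eq (hD.a_type s),
      hA.sum_Λ]
    ring

/-- The connected annular noncrossing permutations with sizes `A s` of the cycles contained in the
circle `s` and sizes `Λ s` of the connected cycles on this circle. The multiset `A s` consists of
all values of the opener function, one for each point of the circle, so its zeros are ignored. -/
def IsOfCycleType {n m : ℕ} [NeZero n] [NeZero m] (A Λ : Bool → Multiset ℕ)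
    (π : Equiv.Perm (Point n m)) : Prop :=
  IsAnnularNoncrossing π ∧ (connectedCycles π).Nonempty ∧
    (∀ s, cycleTypeOn s π = (A s).filter (· ≠ 0)) ∧ ∀ s, connTypeOn s π = Λ s

theorem isAnnularNoncrossing_iff {n m : ℕ} {π : Equiv.Perm (Point n m)} :
    IsAnnularNoncrossing π ↔ ∃ f, IsDrawing f π :=
  ⟨fun ⟨f, h1, h2, h3⟩ => ⟨f, h1, h2, h3⟩, fun ⟨f, h⟩ => ⟨f, h.1, h.2, h.3⟩⟩

variable {n m : ℕ} [NeZero n] [NeZero m] {f f' : Equiv.Perm CoverPoint}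
  {π π' : Equiv.Perm (Point n m)} {D' : Datum}

omit [NeZero n] [NeZero m] in
theorem IsDrawing.perm_unique (h : IsDrawing f π) (h' : IsDrawing f π') : π = π' := by
  ext p
  obtain ⟨x, rfl⟩ := proj_surjective n m p
  rw [← h.proj_apply, ← h'.proj_apply]

omit [NeZero n] [NeZero m] in
/-- Every datum encodes a permutation. -/
theorem Datum.IsOfType.exists_drawing (hD : D.IsOfType (per n m) N c A Λ)
    (hA : IsAdmissible (per n m) N c A Λ) :
    ∃ (π : Equiv.Perm (Point n m)) (f : Equiv.Perm CoverPoint), IsDrawing f π ∧ Draws f D := by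
  obtain ⟨f, hf, hk⟩ := (hD.isShape hA).exists_model
  have hcomm : ∀ x, f (deck n m x) = deck n m (f x) := by
    intro x
    have := (hD.isShape hA).model_comm hf hk x
    have h1 : deckVec n m 1 = fun s => sg s * per n m s := by ext s; simp [deckVec]
    rw [deck_eq_shift, deck_eq_shift, h1, this]
  obtain ⟨π, hπ⟩ := exists_isDrawing hcomm hf
  exact ⟨π, f, hπ, hk⟩

omit [NeZero n] [NeZero m] in
/-- A datum encodes only one permutation. -/
theorem IsDrawing.perm_unique_of_draws (h : IsDrawing f π) (h' : IsDrawing f' π')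
    (hD : Draws f D) (hD' : Draws f' D) : π = π' := by
  have : f = f' := h.noncrossing.eq_of_sameCycle_iff h'.noncrossing fun x y => by rw [hD, hD']
  subst this
  exact h.perm_unique h'

theorem Datum.IsOfType.phiOf_eq (hD : D.IsOfType p N c A Λ) (hA : IsAdmissible p N c A Λ)
    (hf : IsNoncrossing f) (hfD : Draws f D) (s : Bool) (t : ℤ) : phiOf f s t = D.φ s t := by
  have := (hD.isShape hA).phiOf_model hf hfD s t
  rw [D.height_add_one] at this
  omega

/-- The permutation encoded by a datum has the cycle type prescribed by the datum. -/
theorem Datum.IsOfType.isOfCycleType (hD : D.IsOfType (per n m) N c A Λ)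
    (hA : IsAdmissible (per n m) N c A Λ) (h : IsDrawing f π) (hfD : Draws f D) :
    IsOfCycleType A Λ π := by
  have hS := hD.isShape hA
  refine ⟨isAnnularNoncrossing_iff.2 ⟨f, h⟩, ?_, fun s => ?_, fun s => ?_⟩
  · have := (hS.isStart_model_iff hfD (s := true)).2 ⟨0, rfl⟩
    exact ⟨_, (h.conn_iff _ _).1 this.1⟩
  · rw [h.cycleTypeOn_eq, ← hD.φ_type s]
    congr 1
    exact Multiset.map_congr rfl fun i _ => hD.phiOf_eq hA h.noncrossing hfD s i
  · rw [h.connTypeOn_eq s hA.c_pos (fun k => recordPos (hS.height s) (D.starts s k))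
      ((recordPos_strictMono _).comp (hS.mono s)) (fun k => ?_) (fun t => hS.isStart_model_iff hfD),
      ← hD.a_type s]
    · refine Multiset.map_congr rfl fun i _ => ?_
      have := hS.ncard_block_start hfD s i
      rw [D.starts_add_one] at this
      omega
    · rw [hS.add_period, recordPos_add]

theorem IsShape.mem_range_iff {H u : Bool → ℤ → ℤ} (hS : IsShape p N c H u)
    (hk : ∀ x y, f.SameCycle x y ↔ stripKey H u x = stripKey H u y) (s : Bool) (v : ℤ) :
    v ∈ Set.range (u s) ↔ IsStart f s (recordPos (hS.height s) v) := by
  rw [hS.isStart_model_iff hk]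
  constructor
  · rintro ⟨k, rfl⟩
    exact ⟨k, rfl⟩
  · rintro ⟨k, hk⟩
    exact ⟨k, ((recordPos_strictMono _).injective hk).symm⟩

omit [NeZero n] [NeZero m] in
/-- The first point of the distinguished cycle on the interior line is determined modulo one turn by
the encoded permutation. -/
theorem IsShape.dvd_sub {H u u' : Bool → ℤ → ℤ} (hS : IsShape (per n m) N c H u)
    (hS' : IsShape (per n m) N c H u')
    (h : IsDrawing f π) (hk : ∀ x y, f.SameCycle x y ↔ stripKey H u x = stripKey H u y)
    (h' : IsDrawing f' π) (hk' : ∀ x y, f'.SameCycle x y ↔ stripKey H u' x = stripKey H u' y)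
    (hu : u true = u' true) : (N false : ℤ) ∣ u' false 0 - u false 0 := by
  have h1 := hS.model_apply h.noncrossing hk 0
  have h2 := hS'.model_apply h'.noncrossing hk' 0
  have h3 : proj n m (pt false (recordPos (hS.height false) (u false 0))) =
      proj n m (pt false (recordPos (hS.height false) (u' false 0))) := by
    rw [neg_zero] at h1 h2
    rw [← h1, ← h2, h.proj_apply, h'.proj_apply, hu]
  obtain ⟨q, hq⟩ := (proj_pt_eq_iff.1 h3).2
  have h4 := add_mul_period (F := recordPos (hS.height false)) (p := N false)
    (N := per n m false) (recordPos_add _) q (u false 0)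
  rw [show recordPos (hS.height false) (u false 0) + q * per n m false =
    recordPos (hS.height false) (u' false 0) by rw [mul_comm]; omega] at h4
  have h5 := (recordPos_strictMono (hS.height false)).injective h4
  exact ⟨q, by rw [mul_comm]; omega⟩

/-- A datum is determined by the encoded permutation and the height of the distinguished cycle. -/
theorem Datum.IsOfType.ext_of_draws (hD : D.IsOfType (per n m) N c A Λ)
    (hD' : D'.IsOfType (per n m) N c A Λ) (hA : IsAdmissible (per n m) N c A Λ)
    (h : IsDrawing f π) (hfD : Draws f D) (h' : IsDrawing f' π) (hfD' : Draws f' D')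
    (hx : D.x true = D'.x true) : D = D' := by
  have hπ := (hD.isOfCycleType hA h hfD).2.1
  have hφ : D.φ = D'.φ := by
    ext s t
    rw [← hD.phiOf_eq hA h.noncrossing hfD, ← hD'.phiOf_eq hA h'.noncrossing hfD',
      h.phiOf_eq h' hπ]
  have hH : D.height = D'.height := by
    unfold Datum.height
    rw [hφ]
  have hS := hD.isShape hA
  have hS' := hD'.isShape hA
  unfold Draws at hfD'
  rw [← hH] at hS' hfD'
  have hrange : ∀ s, Set.range (D.starts s) = Set.range (D'.starts s) := by
    intro s
    ext v
    rw [hS.mem_range_iff hfD, hS'.mem_range_iff hfD']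
    exact h.isStart_congr h' s _
  have htrue : D.starts true = D'.starts true :=
    eq_of_range_eq (hS.mono _) (hS'.mono _) (hrange true)
      (by rw [D.starts_zero, D'.starts_zero, hx])
  have hx' : D.x false = D'.x false := by
    have h1 := hS.dvd_sub hS' h hfD h' hfD' htrue
    rw [D.starts_zero, D'.starts_zero] at h1
    have h2 := hD.x_nonneg false
    have h3 := hD'.x_nonneg false
    have h4 := hD.x_lt false
    have h5 := hD'.x_lt false
    have := Int.eq_zero_of_abs_lt_dvd h1 (by rw [abs_lt]; constructor <;> omega)
    omega
  have hfalse : D.starts false = D'.starts false :=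
    eq_of_range_eq (hS.mono _) (hS'.mono _) (hrange false)
      (by rw [D.starts_zero, D'.starts_zero, hx'])
  have hstarts : ∀ s, D.starts s = D'.starts s := by rintro (_ | _); exacts [hfalse, htrue]
  refine Datum.ext hφ ?_ ?_
  · ext s k
    have h1 := D.starts_add_one s k
    have h2 := D'.starts_add_one s k
    rw [hstarts] at h1
    omega
  · ext s
    cases s
    exacts [hx', hx]

theorem eq_of_filter_ne_zero {s t : Multiset ℕ} (hc : s.card = t.card)
    (h : s.filter (· ≠ 0) = t.filter (· ≠ 0)) : s = t := by
  have key : ∀ s : Multiset ℕ, s = s.filter (· ≠ 0) + Multiset.replicate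
      (s.card - (s.filter (· ≠ 0)).card) 0 := by
    intro s
    conv_lhs => rw [← Multiset.filter_add_not (· ≠ 0) s]
    congr 1
    have h1 : s.filter (fun a => ¬ a ≠ 0) = Multiset.replicate (s.filter (fun a => ¬ a ≠ 0)).card 0 :=
      Multiset.eq_replicate_card.2 fun b hb => by simpa using (Multiset.mem_filter.1 hb).2
    rw [h1]
    congr 1
    have := congrArg Multiset.card (Multiset.filter_add_not (· ≠ 0) s)
    rw [Multiset.card_add] at this
    omega
  rw [key s, key t, h, hc]

theorem sum_filter_ne_zero (s : Multiset ℕ) : (s.filter (· ≠ 0)).sum = s.sum := by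
  conv_rhs => rw [← Multiset.filter_add_not (· ≠ 0) s, Multiset.sum_add]
  rw [Multiset.sum_eq_zero (s := s.filter (fun a => ¬ a ≠ 0)), add_zero]
  intro b hb
  simpa using (Multiset.mem_filter.1 hb).2

theorem IsOfCycleType.sum_phiOf (hπ : IsOfCycleType A Λ π) (hA : IsAdmissible (per n m) N c A Λ)
    (h : IsDrawing f π) (s : Bool) :
    ∑ i ∈ Finset.range (per n m s), phiOf f s (i : ℤ) + N s = per n m s := by
  have := hA.sum_A s
  rwa [← sum_filter_ne_zero (A s), ← hπ.2.2.1 s, h.cycleTypeOn_eq, sum_filter_ne_zero] at this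

theorem IsOfCycleType.isHeight (hπ : IsOfCycleType A Λ π) (hA : IsAdmissible (per n m) N c A Λ)
    (h : IsDrawing f π) (s : Bool) : IsHeight (per n m s) (N s) (heightOf f s) :=
  h.isHeight (hA.N_pos s) (hπ.sum_phiOf hA h s)

omit [NeZero n] [NeZero m] in
theorem rotBy_eq_one {v : Bool → ℤ} (hv : ∀ s, (per n m s : ℤ) ∣ v s) : rotBy n m v = 1 := by
  have h1 : ((v true : ℤ) : ZMod n) = 0 := (ZMod.intCast_zmod_eq_zero_iff_dvd _ _).2 (hv true)
  have h2 : ((v false : ℤ) : ZMod m) = 0 := (ZMod.intCast_zmod_eq_zero_iff_dvd _ _).2 (hv false)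
  ext (x | x) <;> simp [rotBy, h1, h2]

/-- Every permutation of the class is encoded by a datum, the distinguished cycle of which can be
chosen freely. -/
theorem IsOfCycleType.exists_datum (hπ : IsOfCycleType A Λ π)
    (hA : IsAdmissible (per n m) N c A Λ) (h : IsDrawing f π) {z : ℤ} (hz : IsStart f true z)
    (hz0 : 0 ≤ heightOf f true z) (hzN : heightOf f true z < N true) :
    ∃ D : Datum, D.IsOfType (per n m) N c A Λ ∧ D.x true = heightOf f true z ∧
      ∃ f', IsDrawing f' π ∧ Draws f' D := by
  obtain ⟨c', u, hc', hS, hu0, hk⟩ := h.exists_shape hA.N_pos (hπ.sum_phiOf hA h) hz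
  -- the number of cycles is the expected one
  have hconn : ∀ {f c' u}, 0 < c' → IsDrawing f π → IsShape (per n m) N c' (heightOf f) u →
      (∀ x y, f.SameCycle x y ↔ stripKey (heightOf f) u x = stripKey (heightOf f) u y) →
      ∀ s, Λ s = (Finset.range c').val.map fun k : ℕ => (u s (k + 1) - u s k).toNat := by
    intro f c' u hc' h hS hk s
    rw [← hπ.2.2.2 s, h.connTypeOn_eq s hc' (fun k => recordPos (hS.height s) (u s k))
      ((recordPos_strictMono _).comp (hS.mono s)) (fun k => ?_) (fun t => hS.isStart_model_iff hk)]
    · refine Multiset.map_congr rfl fun i _ => ?_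
      have := hS.ncard_block_start hk s i
      omega
    · rw [hS.add_period, recordPos_add]
  have hcc : ∀ {c' : ℕ} {g : ℕ → ℕ} {s}, Λ s = (Finset.range c').val.map g → c' = c := by
    intro c' g s h
    rw [← hA.card_Λ s, h]
    simp
  obtain rfl := hcc (hconn hc' h hS hk true)
  -- the interior line is translated such that the distinguished cycle becomes normalized
  set q : ℤ := -(u false 0 / N false) with hq
  let v : Bool → ℤ := fun s => if s then 0 else q * per n m false
  have hv : ∀ s, (per n m s : ℤ) ∣ v s := by
    rintro (_ | _)
    · exact Dvd.intro_left _ rfl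
    · exact dvd_zero _
  have h' := h.conj v
  rw [rotBy_eq_one hv] at h'
  change IsDrawing ((shift v).toEquiv.permCongr f) π at h'
  set f' := (shift v).toEquiv.permCongr f with hf'
  have hH : heightOf f' = heightOf f := by
    ext s t
    unfold heightOf
    congr 2
    ext t
    rw [h'.phiOf_eq h hπ.2.1]
  obtain ⟨c'', u', hc'', hS', hu0', hk'⟩ := h'.exists_shape hA.N_pos (hπ.sum_phiOf hA h')
    ((h.isStart_congr h' true z).1 hz)
  obtain rfl := hcc (hconn hc'' h' hS' hk' true)
  have hΛ := hconn hc'' h' hS' hk'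
  rw [hH] at hS' hu0' hk'
  have htrue : u true = u' true := by
    refine eq_of_range_eq (hS.mono _) (hS'.mono _) ?_ (hu0.trans hu0'.symm)
    ext w
    rw [hS.mem_range_iff hk, hS'.mem_range_iff hk']
    exact h.isStart_congr h' _ _
  have hfalse : u' false 0 = u false 0 + q * N false := by
    have h1 := hS.model_apply h.noncrossing hk 0
    have h2 := hS'.model_apply h'.noncrossing hk' 0
    rw [neg_zero] at h1 h2
    have h3 : ∀ t, pt true t = shift v (pt true t) := fun t => by simp [v]
    rw [h3, hf', conj_shift_apply, ← htrue, h1, shift_pt, pt_inj] at h2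
    have h4 := add_mul_period (F := recordPos (hS.height false)) (p := N false)
      (N := per n m false) (recordPos_add _) q (u false 0)
    exact (recordPos_strictMono (hS.height false)).injective (h2.2.symm.trans h4.symm)
  have hN : (0 : ℤ) < N false := by exact_mod_cast hA.N_pos false
  have hmod : u' false 0 = u false 0 % N false := by
    rw [hfalse, hq, Int.emod_def]
    ring
  let D : Datum := ⟨fun s t => phiOf f' s t, fun s k => (u' s (k + 1) - u' s k).toNat,
    fun s => u' s 0⟩
  have hDu : D.starts = u' := by
    ext s k
    refine eq_of_add_one_sub (fun k => ?_) (D.starts_zero s) k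
    rw [D.starts_add_one]
    have := hS'.mono s (lt_add_one k)
    change _ + ((u' s (k + 1) - u' s k).toNat : ℤ) - _ = _
    omega
  have hDH : D.height = heightOf f := hH ▸ rfl
  refine ⟨D, ⟨fun s t => h'.phiOf_add (dvd_refl _) t, fun s => ?_, fun s k => ?_, fun s =>
    (hΛ s).symm, ?_, ?_⟩, hu0', f', h', ?_⟩
  · refine eq_of_filter_ne_zero ?_ ?_
    · rw [hA.card_A]
      simp
    · rw [← hπ.2.2.1 s, h'.cycleTypeOn_eq]
  · change (u' s (k + c'' + 1) - u' s (k + c'')).toNat = (u' s (k + 1) - u' s k).toNat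
    rw [add_right_comm, hS'.add_period, hS'.add_period]
    congr 1
    ring
  · rintro (_ | _)
    · change 0 ≤ u' false 0
      rw [hmod]
      exact Int.emod_nonneg _ hN.ne'
    · exact hz0.trans_eq hu0'.symm
  · rintro (_ | _)
    · change u' false 0 < _
      rw [hmod]
      exact Int.emod_lt_of_pos _ hN
    · exact hu0'.trans_lt hzN
  · unfold Draws
    rw [hDu, hDH]
    exact hk'

end Data


/-! ### Rotation invariant permutations -/

section Rotation

/-- The datum is invariant under the rotation of order `d`, which moves the points of the boundary
line `s` by `p' s` and advances the connected cycles by the `d`-th part of a period. -/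
def Datum.IsPeriodic (D : Datum) (p' : Bool → ℕ) (d c : ℕ) : Prop :=
  (∀ s t, D.φ s (t + p' s) = D.φ s t) ∧ ∃ c', c = d * c' ∧ ∀ s k, D.a s (k + c') = D.a s k

variable {n m : ℕ} [NeZero n] [NeZero m] {N : Bool → ℕ} {c d : ℕ} {A Λ : Bool → Multiset ℕ}
  {D : Datum} {f : Equiv.Perm CoverPoint} {π : Equiv.Perm (Point n m)} {p' : Bool → ℕ}

/-- The rotation by `p' true` points on the exterior circle and by `p' false` points on the interior
circle, in the clockwise direction. -/
def rotVec (p' : Bool → ℕ) (s : Bool) : ℤ := sg s * p' s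

/-- A function with periodic differences that increases by `N > 0` in `d` periods increases by the
`d`-th part of `N` in each of them. -/
theorem exists_period_increment {F g : ℤ → ℤ} (h : ∀ t, F (t + 1) = F t + g t) {p d N : ℕ}
    (hg : ∀ t, g (t + p) = g t) (hN : 0 < N) (hF : ∀ t, F (t + d * p) = F t + N) :
    ∃ K : ℕ, 0 < K ∧ d * K = N ∧ ∀ t, F (t + p) = F t + K := by
  have h1 := add_period h hg 0
  have h2 := add_mul_period h1 d 0
  rw [hF, add_right_inj] at h2
  have h3 : 0 < F (0 + p) - F 0 := by
    by_contra hle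
    have : (d : ℤ) * (F (0 + p) - F 0) ≤ 0 :=
      mul_nonpos_of_nonneg_of_nonpos (by positivity) (not_lt.1 hle)
    omega
  obtain ⟨K, hK⟩ := Int.eq_ofNat_of_zero_le h3.le
  rw [hK] at h1 h2 h3
  exact ⟨K, by exact_mod_cast h3, by exact_mod_cast h2.symm, h1⟩

omit [NeZero n] [NeZero m] in
theorem Datum.IsOfType.exists_height_increment (hD : D.IsOfType (per n m) N c A Λ)
    (hA : IsAdmissible (per n m) N c A Λ) (hp' : ∀ s, per n m s = d * p' s)
    (hφ : ∀ s t, D.φ s (t + p' s) = D.φ s t) (s : Bool) :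
    ∃ K : ℕ, 0 < K ∧ d * K = N s ∧ ∀ t, D.height s (t + p' s) = D.height s t + K := by
  refine exists_period_increment (D.height_add_one s) (fun t => by rw [hφ]) (hA.N_pos s) fun t => ?_
  have := ((hD.isShape hA).height s).add_period t
  rw [hp'] at this
  exact_mod_cast this

theorem pos_of_per_eq (hp' : ∀ s, per n m s = d * p' s) (s : Bool) : 0 < d ∧ 0 < p' s := by
  have := per_pos n m s
  rw [hp'] at this
  exact ⟨Nat.pos_of_mul_pos_right this, Nat.pos_of_mul_pos_left this⟩

/-- The permutation encoded by a rotation invariant datum is rotation invariant. -/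
theorem Datum.IsPeriodic.fixed (hP : D.IsPeriodic p' d c) (hD : D.IsOfType (per n m) N c A Λ)
    (hA : IsAdmissible (per n m) N c A Λ) (hp' : ∀ s, per n m s = d * p' s) (h : IsDrawing f π)
    (hfD : Draws f D) : (rotBy n m (rotVec p')).permCongr π = π := by
  obtain ⟨hφ, c', rfl, ha⟩ := hP
  have hS := hD.isShape hA
  choose K hK0 hKN hK using hD.exists_height_increment hA hp' hφ
  have hS' : IsShape p' K c' D.height D.starts := by
    refine ⟨fun s => ⟨(pos_of_per_eq hp' s).2, hK0 s, (hS.height s).step, hK s⟩, hS.mono,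
      fun s k => ?_⟩
    obtain ⟨K', -, hKN', hK'⟩ := exists_period_increment (D.starts_add_one s) (d := d)
      (fun k => by rw [ha]) (hA.N_pos s) (fun k => by exact_mod_cast hS.add_period s k)
    rw [hK', Nat.eq_of_mul_eq_mul_left (pos_of_per_eq hp' s).1 (hKN'.trans (hKN s).symm)]
  have hcomm := hS'.model_comm h.noncrossing hfD
  have h' := h.conj (rotVec p')
  have : (shift (rotVec p')).toEquiv.permCongr f = f := by
    ext x
    obtain ⟨x, rfl⟩ := (shift (rotVec p')).surjective x
    rw [conj_shift_apply]
    exact (hcomm x).symm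
  rw [this] at h'
  exact h'.perm_unique h

/-- A datum that encodes a rotation invariant permutation is rotation invariant. -/
theorem Datum.IsOfType.isPeriodic_of_fixed (hD : D.IsOfType (per n m) N c A Λ)
    (hA : IsAdmissible (per n m) N c A Λ) (hp' : ∀ s, per n m s = d * p' s) (h : IsDrawing f π)
    (hfD : Draws f D) (hfix : (rotBy n m (rotVec p')).permCongr π = π) :
    D.IsPeriodic p' d c := by
  have hS := hD.isShape hA
  have hπ := (hD.isOfCycleType hA h hfD).2.1
  have hd := (pos_of_per_eq hp' true).1
  have hφ : ∀ s t, D.φ s (t + p' s) = D.φ s t := by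
    intro s t
    have h1 := fun t => h.phiOf_add_of_fixed hπ hfix s t
    simp only [hD.phiOf_eq hA h.noncrossing hfD] at h1
    cases s
    · have := h1 (t + p' false)
      simpa [rotVec, sg] using this.symm
    · simpa [rotVec, sg] using h1 t
  refine ⟨hφ, ?_⟩
  choose K hK0 hKN hK using hD.exists_height_increment hA hp' hφ
  have hH' : ∀ s, IsHeight (p' s) (K s) (D.height s) := fun s =>
    ⟨(pos_of_per_eq hp' s).2, hK0 s, (hS.height s).step, hK s⟩
  have hstart : ∀ s t, IsStart f s (t + p' s) ↔ IsStart f s t := by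
    intro s t
    have h1 := fun t => h.isStart_add_of_fixed hfix s t
    cases s
    · have := h1 (t + p' false)
      simpa [rotVec, sg] using this.symm
    · simpa [rotVec, sg] using h1 t
  -- the heights at which connected cycles start are invariant under translation by `K s`
  have hrange : ∀ s (v : ℤ), v + K s ∈ Set.range (D.starts s) ↔ v ∈ Set.range (D.starts s) := by
    intro s v
    rw [hS.mem_range_iff hfD, hS.mem_range_iff hfD]
    have : recordPos (hS.height s) (v + K s) = recordPos (hS.height s) v + p' s := recordPos_add (hH' s) v
    rw [this]
    exact hstart s _
  have hc' : ∀ s, ∃ c' : ℕ, c = d * c' ∧ ∀ k, D.a s (k + c') = D.a s k := by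
    intro s
    -- the rotation advances the connected cycles by `j`
    obtain ⟨j, hj⟩ := (hrange s (D.starts s 0)).2 ⟨0, rfl⟩
    have hj' : ∀ k, D.starts s (k + j) = D.starts s k + K s := by
      refine fun k => congrFun (eq_of_range_eq (u := fun k => D.starts s (k + j))
        (v := fun k => D.starts s k + K s) (fun a b hab => hS.mono s (by simpa using hab))
        (fun a b hab => by simpa using hS.mono s hab) ?_ (by simpa using hj)) k
      ext v
      constructor
      · rintro ⟨k, rfl⟩
        obtain ⟨i, hi⟩ := (hrange s (D.starts s (k + j) - K s)).1 (by simp)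
        exact ⟨i, by simp [hi]⟩
      · rintro ⟨k, rfl⟩
        obtain ⟨i, hi⟩ := (hrange s (D.starts s k)).2 ⟨k, rfl⟩
        exact ⟨i - j, by simp [hi]⟩
    have hj0 : 0 < j := by
      have := hj' 0
      rw [zero_add] at this
      rw [← (hS.mono s).lt_iff_lt, this]
      have := hK0 s
      omega
    obtain ⟨c', rfl⟩ := Int.eq_ofNat_of_zero_le hj0.le
    refine ⟨c', ?_, fun k => ?_⟩
    · have h1 := add_mul_period hj' d 0
      have h2 := hS.add_period s 0
      have h3 : (d : ℤ) * K s = N s := by exact_mod_cast hKN s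
      rw [h3, ← h2] at h1
      have := (hS.mono s).injective h1
      simp only [zero_add] at this
      exact_mod_cast this.symm
    · have h1 := D.starts_add_one s (k + c')
      have h2 := D.starts_add_one s k
      rw [add_right_comm, hj', hj', h2] at h1
      omega
  obtain ⟨c₁, hc₁, h₁⟩ := hc' true
  obtain ⟨c₂, hc₂, h₂⟩ := hc' false
  obtain rfl := Nat.eq_of_mul_eq_mul_left hd (hc₁.symm.trans hc₂)
  exact ⟨c₁, hc₁, by rintro (_ | _); exacts [h₂, h₁]⟩

/-- There are `c` connected cycles in each turn. -/
theorem ncard_range_inter_Ico {u : ℤ → ℤ} (hu : StrictMono u) {c N : ℕ}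
    (hper : ∀ k, u (k + c) = u k + N) :
    {v | v ∈ Set.range u ∧ 0 ≤ v ∧ v < N}.ncard = c := by
  obtain ⟨k₀, h1, h2⟩ := exists_index hu (-1)
  have : {v | v ∈ Set.range u ∧ 0 ≤ v ∧ v < N} =
      u '' (Finset.Ico (k₀ + 1) (k₀ + 1 + c) : Finset ℤ) := by
    ext v
    simp only [Set.mem_ofPred_eq, Finset.coe_Ico, Set.mem_image, Set.mem_Ico]
    constructor
    · rintro ⟨⟨k, rfl⟩, h3, h4⟩
      refine ⟨k, ⟨?_, ?_⟩, rfl⟩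
      · have := hu.lt_iff_lt.1 (show u k₀ < u k by omega)
        omega
      · have h5 := hper (k - c)
        rw [sub_add_cancel] at h5
        have := hu.lt_iff_lt.1 (show u (k - c) < u (k₀ + 1) by omega)
        omega
    · rintro ⟨k, ⟨h3, h4⟩, rfl⟩
      refine ⟨⟨k, rfl⟩, ?_, ?_⟩
      · have := hu.monotone h3
        omega
      · have h5 := hper (k - c)
        rw [sub_add_cancel] at h5
        have := hu.monotone (show k - c ≤ k₀ by omega)
        omega
  rw [this, Set.ncard_image_of_injective _ hu.injective, Set.ncard_coe_finset, Int.card_Ico]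
  omega

theorem IsDrawing.exists_start (h : IsDrawing f π) (hπ : (connectedCycles π).Nonempty) (s : Bool) :
    ∃ t, IsStart f s t := by
  obtain ⟨t, ht⟩ := h.exists_conn hπ s
  obtain ⟨o, ho, hof⟩ := h.noncrossing.exists_isFirst s t
  exact ⟨o, (conn_congr ho).2 ht, hof⟩

/-- Counting the rotation invariant pairs of a permutation and a distinguished connected cycle in
two ways. -/
theorem mul_ncard_fixed (hA : IsAdmissible (per n m) N c A Λ) (hp' : ∀ s, per n m s = d * p' s) :
    c * {π : Equiv.Perm (Point n m) | IsOfCycleType A Λ π ∧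
      (rotBy n m (rotVec p')).permCongr π = π}.ncard =
    {D : Datum | D.IsOfType (per n m) N c A Λ ∧ D.IsPeriodic p' d c}.ncard := by
  classical
  set X := {π : Equiv.Perm (Point n m) | IsOfCycleType A Λ π ∧
      (rotBy n m (rotVec p')).permCongr π = π} with hX
  set E := {D : Datum | D.IsOfType (per n m) N c A Λ ∧ D.IsPeriodic p' d c} with hE
  -- the permutation encoded by a datum
  let F : Datum → Equiv.Perm (Point n m) := fun D =>
    if h : ∃ (π : Equiv.Perm (Point n m)) (f : Equiv.Perm CoverPoint), IsDrawing f π ∧ Draws f D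
    then h.choose else 1
  have hF : ∀ {D : Datum}, D.IsOfType (per n m) N c A Λ → ∃ f, IsDrawing f (F D) ∧ Draws f D := by
    intro D hD
    have h := hD.exists_drawing hA
    simp only [F, dif_pos h]
    exact h.choose_spec
  have hmaps : ∀ D ∈ E, F D ∈ X := by
    rintro D ⟨hD, hP⟩
    obtain ⟨f, hf, hfD⟩ := hF hD
    exact ⟨hD.isOfCycleType hA hf hfD, hP.fixed hD hA hp' hf hfD⟩
  have hinj : ∀ D ∈ E, ∀ D' ∈ E, F D = F D' → D.x true = D'.x true → D = D' := by
    rintro D ⟨hD, -⟩ D' ⟨hD', -⟩ hFD hx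
    obtain ⟨f, hf, hfD⟩ := hF hD
    obtain ⟨f', hf', hfD'⟩ := hF hD'
    rw [← hFD] at hf'
    exact hD.ext_of_draws hD' hA hf hfD hf' hfD' hx
  have hXfin : X.Finite := Set.toFinite _
  have hEfin : E.Finite := by
    refine Set.Finite.of_injOn (f := fun D => (F D, D.x true))
      (t := X ×ˢ Set.Ico (0 : ℤ) (N true)) (fun D hD => ?_) (fun D hD D' hD' h => ?_)
      (hXfin.prod (Set.finite_Ico _ _))
    · exact ⟨hmaps D hD, hD.1.x_nonneg _, hD.1.x_lt _⟩
    · rw [Prod.mk.injEq] at h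
      exact hinj D hD D' hD' h.1 h.2
  have hfiber : ∀ π ∈ X, {D | D ∈ E ∧ F D = π}.ncard = c := by
    rintro π ⟨hπ, hfix⟩
    obtain ⟨f₀, hf₀⟩ := isAnnularNoncrossing_iff.1 hπ.1
    -- a datum with the right properties from each start at a height in `[0, N)`
    have hdatum : ∀ {f : Equiv.Perm CoverPoint} {z}, IsDrawing f π → IsStart f true z →
        0 ≤ heightOf f true z → heightOf f true z < N true →
        ∃ D ∈ E, F D = π ∧ D.x true = heightOf f true z := by
      intro f z hf hz h1 h2
      obtain ⟨D, hD, hx, f', hf', hfD'⟩ := hπ.exists_datum hA hf hz h1 h2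
      obtain ⟨f'', hf'', hfD''⟩ := hF hD
      exact ⟨D, ⟨hD, hD.isPeriodic_of_fixed hA hp' hf' hfD' hfix⟩,
        hf''.perm_unique_of_draws hf' hfD'' hfD', hx⟩
    obtain ⟨D₀, hD₀, hFD₀⟩ : ∃ D ∈ E, F D = π := by
      obtain ⟨z, hz⟩ := hf₀.exists_start hπ.2.1 true
      have hN : (0 : ℤ) < N true := by exact_mod_cast hA.N_pos true
      have hh := hπ.isHeight hA hf₀ true
      set q := heightOf f₀ true z / N true with hq
      have hmod : heightOf f₀ true (z + -q * per n m true) = heightOf f₀ true z % N true := by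
        rw [hh.add_mul, Int.emod_def]
        ring
      obtain ⟨D, hD, hFD, -⟩ := hdatum hf₀ ((hf₀.isStart_add (Dvd.intro_left (-q) rfl) z).2 hz)
        (by rw [hmod]; exact Int.emod_nonneg _ hN.ne') (by rw [hmod]; exact Int.emod_lt_of_pos _ hN)
      exact ⟨D, hD, hFD⟩
    obtain ⟨f, hf, hfD₀⟩ := hF hD₀.1
    rw [hFD₀] at hf
    have hS := hD₀.1.isShape hA
    have hheight : ∀ D ∈ E, F D = π → D.height = heightOf f := by
      intro D hD hFD
      obtain ⟨f', hf', hfD'⟩ := hF hD.1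
      rw [hFD] at hf'
      ext s t
      unfold Datum.height heightOf
      congr 2
      ext t
      rw [hf.phiOf_eq hf' hπ.2.1, hD.1.phiOf_eq hA hf'.noncrossing hfD']
    -- the data encoding `π` are identified with the starts at heights in `[0, N)`
    rw [← ncard_range_inter_Ico (hS.mono true) (hS.add_period true)]
    refine Set.ncard_congr (fun D _ => D.x true) (fun D hD => ?_)
      (fun D D' hD hD' h => hinj D hD.1 D' hD'.1 (hD.2.trans hD'.2.symm) h) (fun v hv => ?_)
    · obtain ⟨f', hf', hfD'⟩ := hF hD.1.1
      rw [hD.2] at hf'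
      refine ⟨?_, hD.1.1.x_nonneg _, hD.1.1.x_lt _⟩
      have h1 := ((hD.1.1.isShape hA).mem_range_iff hfD' true (D.x true)).1
        ⟨0, D.starts_zero true⟩
      rw [hS.mem_range_iff hfD₀, hf.isStart_congr hf']
      have : ∀ {H H' : Bool → ℤ → ℤ} (h : IsHeight (per n m true) (N true) (H true))
          (h' : IsHeight (per n m true) (N true) (H' true)), H = H' → ∀ v,
          recordPos h v = recordPos h' v := by
        rintro H _ h h' rfl v
        rfl
      rwa [this _ _ ((hheight D hD.1 hD.2).trans (hheight D₀ hD₀ hFD₀).symm)] at h1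
    · obtain ⟨hv1, hv2, hv3⟩ := hv
      have hlev : heightOf f true (recordPos (hS.height true) v) = v := by
        rw [← hheight D₀ hD₀ hFD₀, height_recordPos (hS.height true)]
      obtain ⟨D, hD, hFD, hx⟩ := hdatum hf ((hS.mem_range_iff hfD₀ true v).1 hv1)
        (by rwa [hlev]) (by rwa [hlev])
      exact ⟨D, ⟨hD, hFD⟩, hx.trans hlev⟩
  have hsum := Finset.card_eq_sum_card_fiberwise (f := F) (s := hEfin.toFinset) (t := hXfin.toFinset)
    (fun D hD => Finset.mem_coe.2 (hXfin.mem_toFinset.2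
      (hmaps D (hEfin.mem_toFinset.1 (Finset.mem_coe.1 hD)))))
  have hfib : ∀ π ∈ hXfin.toFinset, (hEfin.toFinset.filter fun D => F D = π).card = c := by
    intro π hπ
    rw [← hfiber π (hXfin.mem_toFinset.1 hπ), ← Set.ncard_coe_finset]
    congr 1
    ext D
    simp
  rw [Finset.sum_congr rfl hfib, Finset.sum_const, smul_eq_mul] at hsum
  rw [Set.ncard_eq_toFinset_card E hEfin, Set.ncard_eq_toFinset_card X hXfin, hsum, mul_comm]

end Rotation


/-! ### Rotation invariant arrangements of a multiset -/

section Lists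

/-- The lists with a given multiset of entries. -/
def arrangements (s : Multiset ℕ) : Finset (List ℕ) := (Multiset.lists s).toFinset

theorem mem_arrangements {s : Multiset ℕ} {l : List ℕ} : l ∈ arrangements s ↔ s = (l : Multiset ℕ) := by
  rw [arrangements, Multiset.mem_toFinset, Multiset.mem_lists_iff]
  rfl

/-- The number of arrangements of a multiset is a multinomial coefficient. -/
theorem card_arrangements_mul (s : Multiset ℕ) :
    (arrangements s).card * ∏ a ∈ s.toFinset, (s.count a).factorial = s.card.factorial := by
  induction hn : s.card generalizing s with
  | zero =>
    rw [Multiset.card_eq_zero.1 hn]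
    have : arrangements (0 : Multiset ℕ) = {[]} := by
      ext l
      rw [mem_arrangements, Finset.mem_singleton]
      exact eq_comm.trans (Multiset.coe_eq_zero l)
    simp [this]
  | succ n ih =>
    have hlists : arrangements s =
        s.toFinset.biUnion fun a => (arrangements (s.erase a)).image (List.cons a) := by
      ext l
      simp only [mem_arrangements, Finset.mem_biUnion, Finset.mem_image, Multiset.mem_toFinset]
      constructor
      · rintro rfl
        cases l with
        | nil => simp at hn
        | cons a l => exact ⟨a, by simp, l, by simp, rfl⟩
      · rintro ⟨a, ha, l, hl, rfl⟩
        rw [← Multiset.cons_erase ha, hl]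
        rfl
    have hcard : (arrangements s).card = ∑ a ∈ s.toFinset, (arrangements (s.erase a)).card := by
      rw [hlists, Finset.card_biUnion]
      · exact Finset.sum_congr rfl fun a _ => Finset.card_image_of_injective _ (List.cons_injective)
      · intro a _ b _ hab
        rw [Function.onFun, Finset.disjoint_left]
        simp only [Finset.mem_image]
        rintro _ ⟨l, -, rfl⟩ ⟨l', -, h⟩
        exact hab (List.cons.inj h).1.symm
    have hterm : ∀ a ∈ s.toFinset, (arrangements (s.erase a)).card *
        ∏ b ∈ s.toFinset, (s.count b).factorial = n.factorial * s.count a := by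
      intro a ha
      have ha' := Multiset.mem_toFinset.1 ha
      have h1 : (s.erase a).card = n := by
        rw [Multiset.card_erase_of_mem ha', hn]
        rfl
      rw [← ih (s.erase a) h1, mul_assoc]
      congr 1
      have h2 : ∏ b ∈ (s.erase a).toFinset, ((s.erase a).count b).factorial =
          ∏ b ∈ s.toFinset, ((s.erase a).count b).factorial := by
        refine Finset.prod_subset (fun b hb => ?_) fun b _ hb => ?_
        · exact Multiset.mem_toFinset.2 (Multiset.mem_of_mem_erase (Multiset.mem_toFinset.1 hb))
        · rw [Multiset.count_eq_zero_of_notMem (by simpa using hb)]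
          rfl
      rw [h2, ← Finset.mul_prod_erase _ _ ha, ← Finset.mul_prod_erase _ _ ha,
        Multiset.count_erase_self]
      have h3 : ∏ b ∈ s.toFinset.erase a, (s.count b).factorial =
          ∏ b ∈ s.toFinset.erase a, ((s.erase a).count b).factorial :=
        Finset.prod_congr rfl fun b hb => by rw [Multiset.count_erase_of_ne (Finset.ne_of_mem_erase hb)]
      rw [h3]
      have h4 : 0 < s.count a := Multiset.count_pos.2 ha'
      rw [← Nat.mul_factorial_pred h4.ne']
      ring
    rw [hcard, Finset.sum_mul, Finset.sum_congr rfl hterm, ← Finset.mul_sum,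
      Multiset.toFinset_sum_count_eq, hn, Nat.factorial_succ, mul_comm]

/-- Over `d` periods, a periodic function takes the values of one period `d` times. -/
theorem map_range_mul {g : ℤ → ℕ} {q : ℕ} (hg : ∀ t, g (t + q) = g t) (d : ℕ) :
    (Multiset.range (d * q)).map (fun i : ℕ => g i) =
      d • (Multiset.range q).map (fun i : ℕ => g i) := by
  induction d with
  | zero => simp
  | succ d ih =>
    rw [add_mul, one_mul, Multiset.range_add, Multiset.map_add, ih, Multiset.map_map, succ_nsmul]
    congr 1
    refine Multiset.map_congr rfl fun i _ => ?_
    have := add_mul_period (F := fun t => (g t : ℤ)) (p := q) (N := 0) (fun t => by simp [hg]) d i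
    simp only [mul_zero, add_zero, Nat.cast_inj] at this
    rw [Function.comp_apply, ← this]
    congr 1
    push_cast
    ring

/-- The functions on a cycle of length `d * q` with given values that are invariant under rotation
by `q` steps. -/
def periodicFns (d q : ℕ) (s : Multiset ℕ) : Set (ℤ → ℕ) :=
  {g | (∀ t, g (t + q) = g t) ∧ (Multiset.range (d * q)).map (fun i : ℕ => g i) = s}

theorem nsmul_multiset_injective {d : ℕ} (hd : 0 < d) {s t : Multiset ℕ} (h : d • s = d • t) :
    s = t := by
  ext a
  have := congrArg (Multiset.count a) h
  rw [Multiset.count_nsmul, Multiset.count_nsmul] at this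
  exact Nat.eq_of_mul_eq_mul_left hd this

/-- A periodic function amounts to a list of its values in one period. -/
theorem ncard_periodicFns {d q : ℕ} (hd : 0 < d) (hq : 0 < q) {t : Multiset ℕ}
    (ht : t.card = q) : (periodicFns d q (d • t)).ncard = (arrangements t).card := by
  rw [← Set.ncard_coe_finset]
  refine Set.ncard_congr (fun g _ => (List.range q).map fun i : ℕ => g i) (fun g hg => ?_)
    (fun g g' hg hg' h => ?_) (fun l hl => ?_)
  · rw [Finset.mem_coe, mem_arrangements]
    have := hg.2
    rw [map_range_mul hg.1] at this
    exact (nsmul_multiset_injective hd this).symm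
  · ext k
    refine forall_of_forall_range hq (P := fun k => g k = g' k) (fun k => by rw [hg.1, hg'.1])
      (fun i hi => ?_) k
    exact List.map_inj_left.1 h i (List.mem_range.2 hi)
  · rw [Finset.mem_coe, mem_arrangements] at hl
    have hlen : l.length = q := by rw [← ht, hl]; rfl
    let g : ℤ → ℕ := fun k => l.getD (k % q).toNat 0
    have hgl : ((List.range q).map fun i : ℕ => g i) = l := by
      refine List.ext_getElem (by simp [hlen]) fun i h1 h2 => ?_
      have h3 : ((i : ℤ) % q).toNat = i := by
        rw [← Int.natCast_mod, Int.toNat_natCast, Nat.mod_eq_of_lt (hlen ▸ h2)]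
      simp [g, h3, h2]
    have hper : ∀ t, g (t + q) = g t := fun t => by simp [g]
    refine ⟨g, ⟨hper, ?_⟩, hgl⟩
    rw [map_range_mul hper, hl]
    congr 1
    exact congrArg _ hgl

theorem exists_nsmul_eq {d : ℕ} {s : Multiset ℕ} (h : ∀ a, d ∣ s.count a) : ∃ t, s = d • t := by
  refine ⟨∑ a ∈ s.toFinset, Multiset.replicate (s.count a / d) a, ?_⟩
  ext a
  rw [Multiset.count_nsmul, Multiset.count_sum']
  simp only [Multiset.count_replicate]
  rw [Finset.sum_ite_eq' s.toFinset a (fun b => s.count b / d)]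
  split_ifs with ha
  · rw [Nat.mul_div_cancel' (h a)]
  · rw [Multiset.count_eq_zero_of_notMem (by simpa using ha), mul_zero]

end Lists

/-! ### Values of `q`-multinomial coefficients at roots of unity -/

noncomputable section QAnalogues

open Polynomial

/-- `(1 - q) (1 - q ^ 2) ⋯ (1 - q ^ k)`. -/
def qPoch (k : ℕ) : ℂ[X] := ∏ i ∈ Finset.range k, (1 - X ^ (i + 1))

theorem one_sub_X_pow_ne_zero {k : ℕ} (hk : 0 < k) : (1 - X ^ k : ℂ[X]) ≠ 0 := by
  rw [← neg_ne_zero, neg_sub]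
  exact X_pow_sub_C_ne_zero hk 1

theorem qPoch_ne_zero (k : ℕ) : qPoch k ≠ 0 :=
  Finset.prod_ne_zero_iff.2 fun i _ => one_sub_X_pow_ne_zero (Nat.succ_pos i)

theorem qPoch_succ (k : ℕ) : qPoch (k + 1) = qPoch k * (1 - X ^ (k + 1)) :=
  Finset.prod_range_succ _ _

/-- The `q`-binomial coefficients are polynomials, by the `q`-Pascal recursion. -/
theorem qPoch_mul_dvd (a b : ℕ) : qPoch a * qPoch b ∣ qPoch (a + b) := by
  induction h : a + b generalizing a b with
  | zero =>
    obtain ⟨rfl, rfl⟩ : a = 0 ∧ b = 0 := by omega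
    simp [qPoch]
  | succ k ih =>
    rcases a with _ | a
    · rw [zero_add] at h
      simp [qPoch, h]
    rcases b with _ | b
    · rw [add_zero] at h
      simp [qPoch, h]
    have h1 : qPoch (k + 1) = qPoch k * (1 - X ^ (a + 1)) +
        qPoch k * (1 - X ^ (b + 1)) * X ^ (a + 1) := by
      rw [qPoch_succ, ← h]
      ring
    rw [h1]
    refine dvd_add ?_ (Dvd.dvd.mul_right ?_ _)
    · obtain ⟨w, hw⟩ := ih a (b + 1) (by omega)
      exact ⟨w, by rw [hw, qPoch_succ a]; ring⟩
    · obtain ⟨w, hw⟩ := ih (a + 1) b (by omega)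
      exact ⟨w, by rw [hw, qPoch_succ b]; ring⟩

theorem prod_qPoch_dvd (S : Finset ℕ) (k : ℕ → ℕ) :
    ∏ a ∈ S, qPoch (k a) ∣ qPoch (∑ a ∈ S, k a) := by
  induction S using Finset.induction_on with
  | empty => simp
  | insert a S ha ih =>
    rw [Finset.prod_insert ha, Finset.sum_insert ha]
    exact (mul_dvd_mul_left _ ih).trans (qPoch_mul_dvd _ _)

theorem prod_qPoch_count_dvd (s : Multiset ℕ) :
    ∏ a ∈ s.toFinset, qPoch (s.count a) ∣ qPoch s.card := by
  rw [← Multiset.toFinset_sum_count_eq]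
  exact prod_qPoch_dvd _ _

/-- The `q`-multinomial coefficient of a multiset, as a polynomial. -/
def qMult (s : Multiset ℕ) : ℂ[X] := (prod_qPoch_count_dvd s).choose

theorem qMult_spec (s : Multiset ℕ) :
    qPoch s.card = (∏ a ∈ s.toFinset, qPoch (s.count a)) * qMult s :=
  (prod_qPoch_count_dvd s).choose_spec

variable {ω : ℂ} {d : ℕ}

theorem one_sub_pow_eq_zero_iff (hω : IsPrimitiveRoot ω d) (k : ℕ) : 1 - ω ^ k = 0 ↔ d ∣ k := by
  rw [sub_eq_zero, eq_comm, hω.pow_eq_one_iff_dvd]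

/-- Near a primitive `d`-th root of unity, `1 - X ^ (d * j)` behaves like `j * (1 - X ^ d)`. -/
theorem one_sub_X_pow_mul (d j : ℕ) :
    (1 - X ^ (d * j) : ℂ[X]) = (1 - X ^ d) * ∑ l ∈ Finset.range j, (X ^ d) ^ l := by
  rw [mul_neg_geom_sum, pow_mul]

theorem eval_geom (hω : IsPrimitiveRoot ω d) (j : ℕ) :
    (∑ l ∈ Finset.range j, (X ^ d) ^ l : ℂ[X]).eval ω = j := by
  simp [eval_finsetSum, hω.pow_eq_one]

/-- The leading behaviour of `qPoch` at a primitive `d`-th root of unity: the order of vanishing of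
`qPoch k` is `k / d`, and the cofactor of `(1 - X ^ d) ^ k` in `qPoch (d * k)` takes the value
`k! * v ^ k`. -/
theorem exists_qPoch_eq (hd : 0 < d) (hω : IsPrimitiveRoot ω d) :
    ∃ (G : ℕ → ℂ[X]) (v : ℂ), v ≠ 0 ∧ (∀ k, qPoch k = (1 - X ^ d) ^ (k / d) * G k) ∧
      (∀ k, (G k).eval ω ≠ 0) ∧ ∀ k, (G (d * k)).eval ω = k.factorial * v ^ k := by
  classical
  let g : ℕ → ℂ[X] := fun i =>
    if d ∣ i then ∑ l ∈ Finset.range (i / d), (X ^ d) ^ l else 1 - X ^ i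
  let v : ℂ := ∏ i ∈ Finset.range (d - 1), (1 - ω ^ (i + 1))
  have hv : v ≠ 0 := by
    refine Finset.prod_ne_zero_iff.2 fun i hi => ?_
    rw [Ne, one_sub_pow_eq_zero_iff hω]
    intro h
    have := Nat.le_of_dvd (Nat.succ_pos i) h
    have := Finset.mem_range.1 hi
    omega
  have hg : ∀ i, 0 < i → (g i).eval ω ≠ 0 := by
    intro i hi
    simp only [g]
    split_ifs with h
    · rw [eval_geom hω, Nat.cast_ne_zero]
      exact (Nat.div_pos (Nat.le_of_dvd hi h) hd).ne'
    · simpa [one_sub_pow_eq_zero_iff hω] using h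
  refine ⟨fun k => ∏ i ∈ Finset.range k, g (i + 1), v, hv, fun k => ?_, fun k => ?_, fun k => ?_⟩ <;>
    beta_reduce
  · induction k with
    | zero => simp [qPoch]
    | succ k ih =>
      rw [qPoch_succ, ih, Finset.prod_range_succ, Nat.succ_div]
      simp only [g]
      split_ifs with h
      · conv_lhs => rw [← Nat.mul_div_cancel' h, one_sub_X_pow_mul]
        rw [pow_succ]
        ring
      · rw [add_zero]
        ring
  · rw [eval_prod]
    exact Finset.prod_ne_zero_iff.2 fun i _ => hg _ (Nat.succ_pos i)
  · induction k with
    | zero => simp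
    | succ k ih =>
      obtain ⟨e, rfl⟩ : ∃ e, d = e + 1 := ⟨d - 1, by omega⟩
      rw [mul_add, mul_one, Finset.prod_range_add, eval_mul, ih, Finset.prod_range_succ, eval_mul]
      have h1 : (∏ i ∈ Finset.range e, g ((e + 1) * k + i + 1)).eval ω = v := by
        rw [eval_prod]
        refine Finset.prod_congr rfl fun i hi => ?_
        have h2 : ¬ (e + 1) ∣ (e + 1) * k + i + 1 := by
          rw [add_assoc, Nat.dvd_add_right (Dvd.intro _ rfl)]
          intro h
          have := Nat.le_of_dvd (Nat.succ_pos i) h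
          have := Finset.mem_range.1 hi
          omega
        simp only [g, if_neg h2]
        rw [eval_sub, eval_one, eval_pow, eval_X, add_assoc, pow_add, pow_mul, hω.pow_eq_one,
          one_pow, one_mul]
      have h3 : (g ((e + 1) * k + e + 1)).eval ω = (k + 1 : ℕ) := by
        have h4 : (e + 1) * k + e + 1 = (e + 1) * (k + 1) := by ring
        simp only [g]
        rw [h4, if_pos (Dvd.intro _ rfl), Nat.mul_div_cancel_left _ hd, eval_geom hω]
      rw [h1, h3, Nat.factorial_succ, pow_succ]
      push_cast
      ring

/-- The definition of the `q`-multinomial coefficient with the vanishing factors separated. -/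
theorem qMult_eq {G : ℕ → ℂ[X]} (hG : ∀ k, qPoch k = (1 - X ^ d) ^ (k / d) * G k)
    (s : Multiset ℕ) : (1 - X ^ d) ^ (s.card / d) * G s.card =
      (1 - X ^ d) ^ (∑ a ∈ s.toFinset, s.count a / d) *
        ((∏ a ∈ s.toFinset, G (s.count a)) * qMult s) := by
  rw [← hG, qMult_spec, ← mul_assoc]
  congr 1
  rw [Finset.prod_congr rfl fun a _ => hG (s.count a), Finset.prod_mul_distrib,
    Finset.prod_pow_eq_pow_sum]

/-- The value of a `q`-multinomial coefficient at a primitive `d`-th root of unity is the multinomial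
coefficient with all entries divided by `d`. -/
theorem eval_qMult_nsmul (hd : 0 < d) (hω : IsPrimitiveRoot ω d) (t : Multiset ℕ) :
    (qMult (d • t)).eval ω = (arrangements t).card := by
  obtain ⟨G, v, hv, hG, -, hGv⟩ := exists_qPoch_eq hd hω
  have h := qMult_eq hG (d • t)
  have hfin : (d • t).toFinset = t.toFinset := Multiset.toFinset_nsmul t d hd.ne'
  simp only [hfin, Multiset.count_nsmul, Multiset.card_nsmul, Nat.mul_div_cancel_left _ hd,
    Multiset.toFinset_sum_count_eq] at h
  have h1 := congrArg (Polynomial.eval ω)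
    (mul_left_cancel₀ (pow_ne_zero _ (one_sub_X_pow_ne_zero hd)) h)
  simp only [eval_mul, eval_prod, hGv, Finset.prod_mul_distrib, Finset.prod_pow_eq_pow_sum,
    Multiset.toFinset_sum_count_eq] at h1
  have h2 : (∏ a ∈ t.toFinset, ((t.count a).factorial : ℂ)) ≠ 0 :=
    Finset.prod_ne_zero_iff.2 fun a _ => Nat.cast_ne_zero.2 (Nat.factorial_ne_zero _)
  have h3 : ((t.card.factorial : ℕ) : ℂ) = ((arrangements t).card : ℂ) *
      ∏ a ∈ t.toFinset, ((t.count a).factorial : ℂ) := by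
    rw [← card_arrangements_mul t]
    push_cast
    ring
  have h4 : v ^ t.card ≠ 0 := pow_ne_zero _ hv
  rw [h3] at h1
  have h5 : (∏ a ∈ t.toFinset, ((t.count a).factorial : ℂ)) * v ^ t.card ≠ 0 := mul_ne_zero h2 h4
  apply mul_left_cancel₀ h5
  rw [← h1]
  ring

/-- If some multiplicity is not divisible by `d`, the numerator of the `q`-multinomial coefficient has
more factors vanishing at a primitive `d`-th root of unity than the denominator. -/
theorem eval_qMult_eq_zero (hd : 0 < d) (hω : IsPrimitiveRoot ω d) {s : Multiset ℕ}
    (hs : d ∣ s.card) (h : ¬ ∀ a, d ∣ s.count a) : (qMult s).eval ω = 0 := by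
  obtain ⟨G, -, -, hG, hG0, -⟩ := exists_qPoch_eq hd hω
  have hlt : ∑ a ∈ s.toFinset, s.count a / d < s.card / d := by
    push Not at h
    obtain ⟨a, ha⟩ := h
    have has : a ∈ s.toFinset := by
      by_contra hc
      rw [Multiset.count_eq_zero_of_notMem (by simpa using hc)] at ha
      exact ha (dvd_zero d)
    rw [← Nat.mul_lt_mul_left hd, Nat.mul_div_cancel' hs, Finset.mul_sum,
      ← Multiset.toFinset_sum_count_eq]
    refine Finset.sum_lt_sum (fun b _ => Nat.mul_div_le _ _) ⟨a, has, ?_⟩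
    refine lt_of_le_of_ne (Nat.mul_div_le _ _) fun he => ha ⟨_, he.symm⟩
  obtain ⟨e, he⟩ := Nat.exists_eq_add_of_lt hlt
  have h1 := qMult_eq hG s
  rw [he, add_assoc, pow_add, mul_assoc] at h1
  have h2 := congrArg (Polynomial.eval ω)
    (mul_left_cancel₀ (pow_ne_zero _ (one_sub_X_pow_ne_zero hd)) h1)
  simp only [eval_mul, eval_pow, eval_sub, eval_one, eval_X, hω.pow_eq_one, sub_self, eval_prod] at h2
  rw [zero_pow (Nat.succ_ne_zero e), zero_mul, eq_comm, mul_eq_zero] at h2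
  exact h2.resolve_left (Finset.prod_ne_zero_iff.2 fun a _ => hG0 _)

/-- The value of a `q`-multinomial coefficient at a primitive `d`-th root of unity counts the
rotation invariant functions with the given values. -/
theorem eval_qMult (hd : 0 < d) (hω : IsPrimitiveRoot ω d) {q : ℕ} (hq : 0 < q) {s : Multiset ℕ}
    (hs : s.card = d * q) : (qMult s).eval ω = (periodicFns d q s).ncard := by
  by_cases h : ∀ a, d ∣ s.count a
  · obtain ⟨t, rfl⟩ := exists_nsmul_eq h
    rw [Multiset.card_nsmul] at hs
    rw [eval_qMult_nsmul hd hω, ncard_periodicFns hd hq (Nat.eq_of_mul_eq_mul_left hd hs)]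
  · rw [eval_qMult_eq_zero hd hω ⟨q, hs⟩ h]
    have : periodicFns d q s = ∅ := by
      refine Set.eq_empty_of_forall_notMem fun g hg => h fun a => ?_
      rw [← hg.2, map_range_mul hg.1, Multiset.count_nsmul]
      exact Dvd.intro _ rfl
    rw [this]
    simp

end QAnalogues


/-! ### The number of rotation invariant data -/

section CountingData

variable {p p' N : Bool → ℕ} {A Λ : Bool → Multiset ℕ} {c d : ℕ}

theorem apply_add_mul_of_periodic {g : ℤ → ℕ} {q : ℕ} (hg : ∀ t, g (t + q) = g t) (d : ℕ) (t : ℤ) :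
    g (t + (d * q : ℕ)) = g t := by
  have := add_mul_period (F := fun t => (g t : ℤ)) (p := q) (N := 0) (fun t => by simp [hg]) d t
  push_cast
  simpa using this

/-- If the order of the rotation does not divide the number of connected cycles, no data are
invariant. -/
theorem ncard_data_eq_zero (h : ¬ d ∣ c) :
    {D : Datum | D.IsOfType p N c A Λ ∧ D.IsPeriodic p' d c}.ncard = 0 := by
  have : {D : Datum | D.IsOfType p N c A Λ ∧ D.IsPeriodic p' d c} = ∅ := by
    refine Set.eq_empty_of_forall_notMem fun D hD => h ?_
    obtain ⟨c', hc', -⟩ := hD.2.2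
    exact ⟨c', hc'⟩
  rw [this, Set.ncard_empty]

/-- The components of an invariant datum can be chosen independently. -/
theorem ncard_data (hd : 0 < d) (hp : ∀ s, p s = d * p' s) (c' : ℕ) :
    {D : Datum | D.IsOfType p N (d * c') A Λ ∧ D.IsPeriodic p' d (d * c')}.ncard =
      ((periodicFns d (p' true) (A true)).ncard * (periodicFns d (p' false) (A false)).ncard) *
      ((periodicFns d c' (Λ true)).ncard * (periodicFns d c' (Λ false)).ncard) *
      (N true * N false) := by
  have hN : ∀ k : ℕ, (Set.Ico (0 : ℤ) k).ncard = k := fun k => by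
    rw [← Finset.coe_Ico, Set.ncard_coe_finset, Int.card_Ico]
    simp
  rw [← hN (N true), ← hN (N false), ← Set.ncard_prod, ← Set.ncard_prod, ← Set.ncard_prod,
    ← Set.ncard_prod, ← Set.ncard_prod]
  refine Set.ncard_congr
    (fun D _ => (((D.φ true, D.φ false), D.a true, D.a false), D.x true, D.x false))
    (fun D hD => ?_) (fun D D' hD hD' h => ?_) ?_
  · obtain ⟨hD, hφ, c'', hc, ha⟩ := hD
    obtain rfl := Nat.eq_of_mul_eq_mul_left hd hc
    have h1 : ∀ s, D.φ s ∈ periodicFns d (p' s) (A s) := fun s =>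
      ⟨hφ s, by rw [← hp]; exact hD.φ_type s⟩
    have h2 : ∀ s, D.a s ∈ periodicFns d c' (Λ s) := fun s => ⟨ha s, hD.a_type s⟩
    have h3 : ∀ s, D.x s ∈ Set.Ico (0 : ℤ) (N s) := fun s => ⟨hD.x_nonneg s, hD.x_lt s⟩
    exact ⟨⟨⟨h1 _, h1 _⟩, h2 _, h2 _⟩, h3 _, h3 _⟩
  · simp only [Prod.mk.injEq] at h
    obtain ⟨⟨⟨h1, h2⟩, h3, h4⟩, h5, h6⟩ := h
    ext (_ | _) : 2
    exacts [h2, h1, h4, h3, h6, h5]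
  · rintro ⟨⟨⟨φ₁, φ₀⟩, a₁, a₀⟩, x₁, x₀⟩ ⟨⟨⟨h1, h2⟩, h3, h4⟩, h5, h6⟩
    refine ⟨⟨fun s => bif s then φ₁ else φ₀, fun s => bif s then a₁ else a₀,
      fun s => bif s then x₁ else x₀⟩, ⟨⟨?_, ?_, ?_, ?_, ?_, ?_⟩, ?_, c', rfl, ?_⟩, rfl⟩ <;>
      rintro (_ | _)
    · rw [hp]; exact apply_add_mul_of_periodic h2.1 d
    · rw [hp]; exact apply_add_mul_of_periodic h1.1 d
    · rw [hp]; exact h2.2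
    · rw [hp]; exact h1.2
    · exact apply_add_mul_of_periodic h4.1 d
    · exact apply_add_mul_of_periodic h3.1 d
    · exact h4.2
    · exact h3.2
    · exact h6.1
    · exact h5.1
    · exact h6.2
    · exact h5.2
    · exact h2.1
    · exact h1.1
    · exact h4.1
    · exact h3.1

end CountingData


/-! ### The sieving polynomial -/

noncomputable section SievingPolynomial

open Polynomial

variable {p p' N : Bool → ℕ} {A Λ : Bool → Multiset ℕ} {c d : ℕ} {ω : ℂ}

/-- If a `q`-multinomial coefficient does not vanish at a primitive `d`-th root of unity, all
multiplicities are divisible by `d`, and hence so is the sum. -/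
theorem eval_qMult_eq_zero_or_dvd_sum (hd : 0 < d) (hω : IsPrimitiveRoot ω d) {s : Multiset ℕ}
    (hs : d ∣ s.card) : (qMult s).eval ω = 0 ∨ d ∣ s.sum := by
  by_cases h : ∀ a, d ∣ s.count a
  · obtain ⟨t, rfl⟩ := exists_nsmul_eq h
    rw [Multiset.sum_nsmul]
    exact Or.inr ⟨_, rfl⟩
  · exact Or.inl (eval_qMult_eq_zero hd hω hs h)

/-- As `1 - X ^ c` has simple roots, divisibility by it can be tested at the roots. -/
theorem one_sub_X_pow_dvd (hc : 0 < c) {Q : ℂ[X]} (h : ∀ ω : ℂ, ω ^ c = 1 → Q.eval ω = 0) :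
    1 - X ^ c ∣ Q := by
  rw [← neg_sub, neg_dvd, X_pow_sub_one_eq_prod hc (Complex.isPrimitiveRoot_exp c hc.ne')]
  refine Finset.prod_dvd_of_coprime
    (fun a _ b _ hab => pairwise_coprime_X_sub_C Function.injective_id hab) fun ω hω => ?_
  refine dvd_iff_isRoot.2 ?_
  exact h ω ((mem_nthRootsFinset hc _).1 hω)

/-- The quotient of `q`-integers becomes a polynomial after multiplication by the `q`-multinomial
coefficient of the exterior sizes of the connected cycles. -/
theorem IsAdmissible.exists_quotient (hA : IsAdmissible p N c A Λ) :
    ∃ B : ℂ[X], (1 - X ^ c) * B = (1 - X ^ (N true * N false)) * qMult (Λ true) := by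
  obtain ⟨B, hB⟩ : 1 - X ^ c ∣ (1 - X ^ (N true * N false)) * qMult (Λ true) := by
    refine one_sub_X_pow_dvd hA.c_pos fun ω hω => ?_
    have hd : 0 < orderOf ω := orderOf_pos_iff.2 (isOfFinOrder_iff_pow_eq_one.2 ⟨c, hA.c_pos, hω⟩)
    have hω' := IsPrimitiveRoot.orderOf ω
    rw [eval_mul, mul_eq_zero]
    refine (eval_qMult_eq_zero_or_dvd_sum hd hω' (s := Λ true)
      (hA.card_Λ true ▸ orderOf_dvd_of_pow_eq_one hω)).symm.imp (fun h => ?_) id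
    rw [hA.sum_Λ] at h
    simpa [one_sub_pow_eq_zero_iff hω'] using h.mul_right _
  exact ⟨B, hB.symm⟩

/-- The value of the sieving polynomial at a root of unity counts the invariant data. -/
theorem IsAdmissible.mul_eval_eq (hA : IsAdmissible p N c A Λ) {B : ℂ[X]}
    (hB : (1 - X ^ c) * B = (1 - X ^ (N true * N false)) * qMult (Λ true)) (hd : 0 < d)
    (hω : IsPrimitiveRoot ω d) (hp : ∀ s, p s = d * p' s) :
    c * (B * qMult (A true) * qMult (A false) * qMult (Λ false)).eval ω =
      ({D : Datum | D.IsOfType p N c A Λ ∧ D.IsPeriodic p' d c}.ncard : ℂ) := by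
  have hdA : d ∣ (A true).card := hA.card_A true ▸ hp true ▸ Dvd.intro _ rfl
  have hsum : d ∣ (A true).sum → d ∣ N true := fun h =>
    (Nat.dvd_add_right h).1 (hA.sum_A true ▸ hp true ▸ Dvd.intro _ rfl)
  have hB' := congrArg (Polynomial.eval ω) hB
  simp only [eval_mul, eval_sub, eval_one, eval_pow, eval_X] at hB' ⊢
  by_cases hdc : d ∣ c
  · obtain ⟨c', rfl⟩ := hdc
    have hc' : 0 < c' := Nat.pos_of_mul_pos_left hA.c_pos
    have hp' : ∀ s, 0 < p' s := fun s => by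
      have h1 := hA.sum_A s
      have h2 := hA.N_pos s
      exact Nat.pos_of_mul_pos_left (a := d) (by rw [← hp]; omega)
    have hcard : ∀ s, (A s).card = d * p' s := fun s => (hA.card_A s).trans (hp s)
    rw [ncard_data hd hp]
    push_cast
    rw [← eval_qMult hd hω (hp' true) (hcard true), ← eval_qMult hd hω (hp' false) (hcard false),
      ← eval_qMult hd hω hc' (hA.card_Λ true), ← eval_qMult hd hω hc' (hA.card_Λ false)]
    rcases eval_qMult_eq_zero_or_dvd_sum hd hω hdA with h | h
    · rw [h]
      ring
    · obtain ⟨e, he⟩ := hsum h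
      -- cancelling `1 - X ^ d` before evaluation turns `[N]_q / [c]_q` into `N / c`
      rw [he, mul_assoc d, one_sub_X_pow_mul, one_sub_X_pow_mul, mul_assoc, mul_assoc] at hB
      have h1 := congrArg (Polynomial.eval ω) (mul_left_cancel₀ (one_sub_X_pow_ne_zero hd) hB)
      rw [eval_mul, eval_mul, eval_geom hω, eval_geom hω] at h1
      rw [he]
      push_cast at h1 ⊢
      linear_combination (d * (qMult (A true)).eval ω * (qMult (A false)).eval ω *
        (qMult (Λ false)).eval ω) * h1
  · -- there are no invariant data, and the polynomial vanishes
    rw [ncard_data_eq_zero hdc]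
    rcases eval_qMult_eq_zero_or_dvd_sum hd hω hdA with h | h
    · simp [h]
    · rw [(one_sub_pow_eq_zero_iff hω _).2 ((hsum h).mul_right _), zero_mul, mul_eq_zero,
        one_sub_pow_eq_zero_iff hω] at hB'
      simp [hB'.resolve_left hdc]

theorem one_sub_X_ratFunc_ne_zero : (1 - RatFunc.X : RatFunc ℂ) ≠ 0 := by
  have h := one_sub_X_pow_ne_zero (k := 1) one_pos
  rw [pow_one] at h
  have := (map_ne_zero_iff (algebraMap ℂ[X] (RatFunc ℂ)) (RatFunc.algebraMap_injective ℂ)).2 h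
  simpa using this

theorem qFactorial_eq (k : ℕ) :
    qFactorial k = algebraMap ℂ[X] (RatFunc ℂ) (qPoch k) / (1 - RatFunc.X) ^ k := by
  induction k with
  | zero => simp [qFactorial, qPoch]
  | succ k ih =>
    rw [qFactorial, Finset.prod_Icc_succ_top (Nat.le_add_left 1 k), ← qFactorial, ih, qPoch_succ, qInt,
      div_mul_div_comm, ← pow_succ]
    simp

theorem qFactorial_ne_zero (k : ℕ) : qFactorial k ≠ 0 := by
  rw [qFactorial_eq]
  exact div_ne_zero ((map_ne_zero_iff _ (RatFunc.algebraMap_injective ℂ)).2 (qPoch_ne_zero k))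
    (pow_ne_zero _ one_sub_X_ratFunc_ne_zero)

theorem algebraMap_qMult (s : Multiset ℕ) : algebraMap ℂ[X] (RatFunc ℂ) (qMult s) =
    qFactorial s.card / ∏ a ∈ s.toFinset, qFactorial (s.count a) := by
  rw [eq_div_iff (Finset.prod_ne_zero_iff.2 fun a _ => qFactorial_ne_zero _), qFactorial_eq,
    qMult_spec, Finset.prod_congr rfl fun a _ => qFactorial_eq (s.count a), Finset.prod_div_distrib,
    Finset.prod_pow_eq_pow_sum, Multiset.toFinset_sum_count_eq, map_mul, map_prod]
  ring

theorem algebraMap_qMult_parts {K k : ℕ} (ν : K.Partition) (hν : ν.parts.card = k) :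
    algebraMap ℂ[X] (RatFunc ℂ) (qMult ν.parts) = qMultinom k ν := by
  rw [algebraMap_qMult, hν, qMultinom]

theorem card_parts_le {K : ℕ} (ν : K.Partition) : ν.parts.card ≤ K := by
  have := Multiset.card_nsmul_le_sum (s := ν.parts) (a := 1) fun x hx => ν.parts_pos hx
  rwa [ν.parts_sum, nsmul_one] at this

/-- Adding zeros to the parts of a partition amounts to choosing the places of the zeros. -/
theorem algebraMap_qMult_add_replicate {K k l : ℕ} (ν : K.Partition) (hν : ν.parts.card = k)
    (hkl : k ≤ l) : algebraMap ℂ[X] (RatFunc ℂ) (qMult (ν.parts + Multiset.replicate (l - k) 0)) =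
      qBinom l k * qMultinom k ν := by
  have h0 : 0 ∉ ν.parts := fun h => (ν.parts_pos h).ne rfl
  have hprod : ∏ a ∈ (ν.parts + Multiset.replicate (l - k) 0).toFinset,
      qFactorial ((ν.parts + Multiset.replicate (l - k) 0).count a) =
      qFactorial (l - k) * ∏ a ∈ ν.parts.toFinset, qFactorial (ν.parts.count a) := by
    have h1 : (ν.parts + Multiset.replicate (l - k) 0).toFinset ⊆ insert 0 ν.parts.toFinset := by
      intro a ha
      rw [Multiset.mem_toFinset, Multiset.mem_add] at ha
      rw [Finset.mem_insert, Multiset.mem_toFinset]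
      exact ha.symm.imp_left Multiset.eq_of_mem_replicate
    rw [Finset.prod_subset h1, Finset.prod_insert (by simpa using h0)]
    · congr 1
      · simp [Multiset.count_eq_zero_of_notMem h0]
      · refine Finset.prod_congr rfl fun a ha => ?_
        have : a ≠ 0 := by
          rintro rfl
          exact h0 (by simpa using ha)
        rw [Multiset.count_add, Multiset.count_replicate, if_neg this.symm, add_zero]
    · intro a _ ha
      rw [Multiset.count_eq_zero_of_notMem fun h => ha (Multiset.mem_toFinset.2 h)]
      simp [qFactorial]
  rw [algebraMap_qMult, hprod, qBinom, if_pos hkl, qMultinom, Multiset.card_add,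
    Multiset.card_replicate, hν, Nat.add_sub_cancel' hkl]
  have := qFactorial_ne_zero k
  field_simp

theorem algebraMap_quotient {K : ℕ} (hc : 0 < c) {B M : ℂ[X]} (hB : (1 - X ^ c) * B = (1 - X ^ K) * M) :
    algebraMap ℂ[X] (RatFunc ℂ) B = qInt K / qInt c * algebraMap ℂ[X] (RatFunc ℂ) M := by
  have h1 := (map_ne_zero_iff (algebraMap ℂ[X] (RatFunc ℂ)) (RatFunc.algebraMap_injective ℂ)).2
    (one_sub_X_pow_ne_zero hc)
  have h2 := congrArg (algebraMap ℂ[X] (RatFunc ℂ)) hB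
  simp only [map_mul, map_sub, map_one, map_pow, RatFunc.algebraMap_X] at h1 h2
  rw [qInt, qInt, div_div_div_cancel_right₀ one_sub_X_ratFunc_ne_zero, div_mul_eq_mul_div,
    eq_div_iff h1, ← h2, mul_comm]

end SievingPolynomial


/-! ### The group of rotations -/

section RotationGroup

variable {n m : ℕ}

theorem rotBy_add (v w : Bool → ℤ) : rotBy n m (v + w) = rotBy n m w * rotBy n m v := by
  ext (x | x) <;> simp [rotBy]

theorem rotBy_nsmul (k : ℕ) (v : Bool → ℤ) : rotBy n m (k • v) = rotBy n m v ^ k := by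
  induction k with
  | zero => exact rotBy_eq_one fun s => by simp
  | succ k ih => rw [succ_nsmul, rotBy_add, ih, pow_succ']

theorem rotation_eq (n m : ℕ) :
    rotation n m = rotBy n m (rotVec fun s => per n m s / n.gcd m) := by
  ext (x | x) <;> simp [rotation, rotBy, rotVec, per, sg, sub_eq_add_neg, -Nat.cast_div, -Int.natCast_ediv]

theorem gcd_dvd_per (n m : ℕ) (s : Bool) : n.gcd m ∣ per n m s := by
  cases s
  exacts [Nat.gcd_dvd_right n m, Nat.gcd_dvd_left n m]

theorem rotation_pow {d e : ℕ} (hd : 0 < d) (h : d * e = n.gcd m) :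
    rotation n m ^ e = rotBy n m (rotVec fun s => per n m s / d) := by
  rw [rotation_eq, ← rotBy_nsmul]
  congr 1
  ext s
  obtain ⟨u, hu⟩ := gcd_dvd_per n m s
  rcases Nat.eq_zero_or_pos e with rfl | he
  · rw [mul_zero] at h
    rw [← h, zero_mul] at hu
    simp [rotVec, hu]
  · have h1 : per n m s / n.gcd m = u := by
      rw [hu, Nat.mul_div_cancel_left _ (h ▸ Nat.mul_pos hd he)]
    have h2 : per n m s / d = e * u := by
      rw [hu, ← h, mul_assoc, Nat.mul_div_cancel_left _ hd]
    simp only [Pi.smul_apply, rotVec, h1, h2]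
    push_cast
    rw [nsmul_eq_mul]
    ring

variable [NeZero n] [NeZero m]

theorem orderOf_rotation (n m : ℕ) [NeZero n] [NeZero m] : orderOf (rotation n m) = n.gcd m := by
  have hn : 0 < n := Nat.pos_of_ne_zero (NeZero.ne n)
  have hg : 0 < n.gcd m := Nat.gcd_pos_of_pos_left _ hn
  refine Nat.dvd_antisymm (orderOf_dvd_of_pow_eq_one ?_) ?_
  · rw [rotation_pow one_pos (one_mul _)]
    refine rotBy_eq_one fun s => ?_
    rw [rotVec, Nat.div_one]
    exact Dvd.intro_left _ rfl
  · set k := orderOf (rotation n m) with hk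
    have h1 : rotation n m ^ k = 1 := pow_orderOf_eq_one _
    rw [rotation_eq, ← rotBy_nsmul] at h1
    have h2 := Sum.inl_injective (Equiv.ext_iff.1 h1 (Sum.inl 0))
    obtain ⟨u, hu⟩ := Nat.gcd_dvd_left n m
    have h3 : n / n.gcd m = u := Nat.div_eq_of_eq_mul_right hg hu
    have h4 : ((k * u : ℕ) : ZMod n) = 0 := by
      simpa [rotVec, per, sg, h3, -Nat.cast_div, -Int.natCast_ediv] using h2
    rw [ZMod.natCast_eq_zero_iff] at h4
    refine Nat.dvd_of_mul_dvd_mul_right (k := u) (Nat.pos_of_mul_pos_left (hu ▸ hn)) ?_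
    rwa [← hu]

variable {A Λ : Bool → Multiset ℕ} {π : Equiv.Perm (Point n m)}

theorem cyc_permCongr (σ π : Equiv.Perm (Point n m)) (x : Point n m) :
    cyc (σ.permCongr π) (σ x) = (cyc π x).map σ.toEmbedding := by
  ext y
  obtain ⟨y, rfl⟩ := σ.surjective y
  have h : σ.permCongr π = σ * π * σ⁻¹ := rfl
  rw [mem_cyc, h, Equiv.Perm.sameCycle_conj, Finset.mem_map_equiv, mem_cyc]
  simp

theorem cycles_permCongr (σ π : Equiv.Perm (Point n m)) :
    cycles (σ.permCongr π) = (cycles π).map (Finset.mapEmbedding σ.toEmbedding).toEmbedding := by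
  ext γ
  rw [mem_cycles, Finset.mem_map]
  constructor
  · rintro ⟨x, rfl⟩
    obtain ⟨x, rfl⟩ := σ.surjective x
    exact ⟨_, mem_cycles.2 ⟨x, rfl⟩, (cyc_permCongr σ π x).symm⟩
  · rintro ⟨γ, hγ, rfl⟩
    obtain ⟨x, rfl⟩ := mem_cycles.1 hγ
    exact ⟨σ x, (cyc_permCongr σ π x).symm⟩

omit [NeZero n] [NeZero m] in
theorem sizeOn_map_rotBy (v : Bool → ℤ) (s : Bool) (γ : Finset (Point n m)) :
    sizeOn s (γ.map (rotBy n m v).toEmbedding) = sizeOn s γ := by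
  cases s <;> simp only [sizeOn, extSize, intSize, cond_true, cond_false, Finset.filter_map,
    Finset.card_map] <;> congr 2 <;> ext (x | x) <;> rfl

theorem cycleTypeOn_permCongr (v : Bool → ℤ) (s : Bool) (π : Equiv.Perm (Point n m)) :
    cycleTypeOn s ((rotBy n m v).permCongr π) = cycleTypeOn s π := by
  rw [cycleTypeOn, cycles_permCongr, Finset.filter_map, Finset.map_val, Multiset.map_map, cycleTypeOn]
  have h : ∀ s (γ : Finset (Point n m)), sizeOn s ((Finset.mapEmbedding
      (rotBy n m v).toEmbedding).toEmbedding γ) = sizeOn s γ := sizeOn_map_rotBy v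
  simp only [Function.comp_def, h]

theorem connectedCycles_permCongr (v : Bool → ℤ) (π : Equiv.Perm (Point n m)) :
    connectedCycles ((rotBy n m v).permCongr π) =
      (connectedCycles π).map (Finset.mapEmbedding (rotBy n m v).toEmbedding).toEmbedding := by
  have h : ∀ s (γ : Finset (Point n m)), sizeOn s ((Finset.mapEmbedding
      (rotBy n m v).toEmbedding).toEmbedding γ) = sizeOn s γ := sizeOn_map_rotBy v
  rw [connectedCycles, cycles_permCongr, Finset.filter_map, connectedCycles]
  congr 1
  refine Finset.filter_congr fun γ _ => ?_
  exact and_congr (iff_of_eq (congrArg (0 < ·) (h true γ))) (iff_of_eq (congrArg (0 < ·) (h false γ)))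

theorem IsOfCycleType.permCongr (h : IsOfCycleType A Λ π) (v : Bool → ℤ) :
    IsOfCycleType A Λ ((rotBy n m v).permCongr π) := by
  obtain ⟨h1, h2, h3, h4⟩ := h
  obtain ⟨f, hf⟩ := isAnnularNoncrossing_iff.1 h1
  refine ⟨isAnnularNoncrossing_iff.2 ⟨_, hf.conj v⟩, ?_, fun s => ?_, fun s => ?_⟩
  · rw [connectedCycles_permCongr]
    exact h2.map
  · rw [cycleTypeOn_permCongr, h3]
  · rw [← h4, connTypeOn, connectedCycles_permCongr, Finset.map_val, Multiset.map_map]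
    exact Multiset.map_congr rfl fun γ _ => sizeOn_map_rotBy v s γ

/-- The action of a rotation on permutations is conjugation, which relabels the cycles. -/
theorem smul_eq_permCongr (ρ : rotationGroup n m) (π : Equiv.Perm (Point n m)) :
    ρ • π = (ConjAct.ofConjAct (ρ : ConjAct (Equiv.Perm (Point n m)))).permCongr π := rfl

theorem isOfFinOrder_rotation (n m : ℕ) [NeZero n] [NeZero m] :
    IsOfFinOrder (ConjAct.toConjAct (rotation n m)) := by
  rw [← orderOf_pos_iff, MulEquiv.orderOf_eq ConjAct.toConjAct (rotation n m), orderOf_rotation]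
  exact Nat.gcd_pos_of_pos_left _ (Nat.pos_of_ne_zero (NeZero.ne n))

theorem exists_rotBy_of_rotationGroup (ρ : rotationGroup n m) :
    ∃ v, ∀ π : Equiv.Perm (Point n m), ρ • π = (rotBy n m v).permCongr π := by
  obtain ⟨k, hk⟩ := (isOfFinOrder_rotation n m).mem_powers_iff_mem_zpowers.2 ρ.2
  refine ⟨k • rotVec fun s => per n m s / n.gcd m, fun π => ?_⟩
  rw [rotBy_nsmul, ← rotation_eq, smul_eq_permCongr, ← hk]
  rfl

/-- A rotation generates the same group as the rotation of the same order through the smallest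
angle. -/
theorem exists_smul_eq_iff (ρ : rotationGroup n m) : ∃ d : ℕ, 0 < d ∧ orderOf ρ = d ∧
    d ∣ n.gcd m ∧ ∀ π : Equiv.Perm (Point n m), ρ • π = π ↔
      (rotBy n m (rotVec fun s => per n m s / d)).permCongr π = π := by
  have hg : 0 < n.gcd m := Nat.gcd_pos_of_pos_left _ (Nat.pos_of_ne_zero (NeZero.ne n))
  set σ : ConjAct (Equiv.Perm (Point n m)) := ConjAct.toConjAct (rotation n m) with hσ
  have hord : orderOf σ = n.gcd m := by
    rw [← orderOf_rotation n m]
    exact MulEquiv.orderOf_eq ConjAct.toConjAct _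
  have hfin : IsOfFinOrder σ := isOfFinOrder_rotation n m
  obtain ⟨k, hk⟩ : (ρ : ConjAct (Equiv.Perm (Point n m))) ∈ Submonoid.powers σ :=
    hfin.mem_powers_iff_mem_zpowers.2 ρ.2
  simp only at hk
  set e := (n.gcd m).gcd k with he
  have hed : e ∣ n.gcd m := Nat.gcd_dvd_left _ _
  have hρ : orderOf ρ = n.gcd m / e := by
    rw [← Subgroup.orderOf_coe, ← hk, hfin.orderOf_pow, hord]
  refine ⟨n.gcd m / e, Nat.div_pos (Nat.le_of_dvd hg hed) (Nat.pos_of_dvd_of_pos hed hg), hρ,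
    Nat.div_dvd_of_dvd hed, fun π => ?_⟩
  have h1 : σ ^ e • π = (rotBy n m (rotVec fun s => per n m s / (n.gcd m / e))).permCongr π := by
    rw [← rotation_pow (e := e) (Nat.div_pos (Nat.le_of_dvd hg hed) (Nat.pos_of_dvd_of_pos hed hg))
      (Nat.div_mul_cancel hed)]
    rfl
  have h2 : ρ • π = σ ^ k • π := by rw [hk]; rfl
  rw [← h1, h2, ← MulAction.mem_stabilizer_iff, ← MulAction.mem_stabilizer_iff]
  constructor
  · intro h
    -- Bézout: `e` is congruent to a multiple of `k` modulo the order of `σ`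
    have h3 : σ ^ (e : ℤ) = (σ ^ k) ^ (n.gcd m).gcdB k := by
      rw [he, Nat.gcd_eq_gcd_ab, zpow_add, zpow_mul, zpow_mul, zpow_natCast, ← hord, pow_orderOf_eq_one,
        one_zpow, one_mul, zpow_natCast]
    rw [← zpow_natCast, h3]
    exact Subgroup.zpow_mem _ h _
  · intro h
    obtain ⟨j, hj⟩ := Nat.gcd_dvd_right (n.gcd m) k
    rw [hj, pow_mul]
    exact Subgroup.pow_mem _ h _

end RotationGroup

end AnnularNC

theorem mainTheorem2 (n m : ℕ) [NeZero n] [NeZero m] (c r s R S : ℕ) (hc : 0 < c)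
    (hR : R ≤ n) (hS : S ≤ m)
    (α : Nat.Partition R) (hα : α.parts.card = r)
    (β : Nat.Partition S) (hβ : β.parts.card = s)
    (lam : Nat.Partition (n - R)) (hlam : lam.parts.card = c)
    (mu : Nat.Partition (m - S)) (hmu : mu.parts.card = c) :
    ∃ P : Polynomial ℂ,
      algebraMap (Polynomial ℂ) (RatFunc ℂ) P =
        AnnularNC.qInt ((n - R) * (m - S)) / AnnularNC.qInt c *
          AnnularNC.qBinom n r * AnnularNC.qBinom m s *
          AnnularNC.qMultinom r α * AnnularNC.qMultinom s β *
          AnnularNC.qMultinom c lam * AnnularNC.qMultinom c mu ∧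
      AnnularNC.ExhibitsCSP (AnnularNC.ANCOfType n m α β lam mu) P
        (AnnularNC.rotationGroup n m) := by
  classical
  have hrR : r ≤ n := hα ▸ (AnnularNC.card_parts_le α).trans hR
  have hsS : s ≤ m := hβ ▸ (AnnularNC.card_parts_le β).trans hS
  -- the points that do not open a cycle contribute the zeros
  let A : Bool → Multiset ℕ := fun b => bif b then α.parts + Multiset.replicate (n - r) 0
    else β.parts + Multiset.replicate (m - s) 0
  let Λ : Bool → Multiset ℕ := fun b => bif b then lam.parts else mu.parts
  let N : Bool → ℕ := fun b => bif b then n - R else m - S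
  have hA : AnnularNC.IsAdmissible (AnnularNC.per n m) N c A Λ := by
    refine ⟨hc, ?_, ?_, ?_, ?_, ?_, ?_⟩ <;> rintro (_ | _)
    · exact hc.trans_le (hmu ▸ AnnularNC.card_parts_le mu)
    · exact hc.trans_le (hlam ▸ AnnularNC.card_parts_le lam)
    · simp [A, AnnularNC.per, hβ, hsS]
    · simp [A, AnnularNC.per, hα, hrR]
    · simp [A, N, AnnularNC.per, β.parts_sum, hS]
    · simp [A, N, AnnularNC.per, α.parts_sum, hR]
    · exact hmu
    · exact hlam
    · exact mu.parts_sum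
    · exact lam.parts_sum
    · exact fun i hi => mu.parts_pos hi
    · exact fun i hi => lam.parts_pos hi
  have hX : AnnularNC.ANCOfType n m α β lam mu = {π | AnnularNC.IsOfCycleType A Λ π} := by
    have hfilter : ∀ {K : ℕ} (ν : K.Partition) (l : ℕ),
        (ν.parts + Multiset.replicate l 0).filter (· ≠ 0) = ν.parts := by
      intro K ν l
      rw [Multiset.filter_add, Multiset.filter_eq_self.2 fun i hi => (ν.parts_pos hi).ne',
        Multiset.filter_eq_nil.2 fun i hi => not_not.2 (Multiset.eq_of_mem_replicate hi), add_zero]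
    ext π
    constructor
    · rintro ⟨⟨h1, h2⟩, h3, h4, h5, h6⟩
      refine ⟨h1, h2, ?_, ?_⟩ <;> rintro (_ | _)
      exacts [h4.trans (hfilter β _).symm, h3.trans (hfilter α _).symm, h6, h5]
    · rintro ⟨h1, h2, h3, h4⟩
      exact ⟨⟨h1, h2⟩, (h3 true).trans (hfilter α _), (h3 false).trans (hfilter β _), h4 true, h4 false⟩
  obtain ⟨B, hB⟩ := hA.exists_quotient
  refine ⟨B * AnnularNC.qMult (A true) * AnnularNC.qMult (A false) * AnnularNC.qMult (Λ false), ?_,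
    inferInstance, inferInstance, Set.toFinite _, ?_, fun w hw ρ => ?_⟩
  · rw [map_mul, map_mul, map_mul, AnnularNC.algebraMap_quotient hc hB]
    have h1 := AnnularNC.algebraMap_qMult_add_replicate α hα hrR
    have h2 := AnnularNC.algebraMap_qMult_add_replicate β hβ hsS
    have h3 := AnnularNC.algebraMap_qMult_parts lam hlam
    have h4 := AnnularNC.algebraMap_qMult_parts mu hmu
    simp only [A, Λ, N, cond_true, cond_false, h1, h2, h3, h4]
    ring
  · rw [hX]
    intro ρ π hπ
    obtain ⟨v, hv⟩ := AnnularNC.exists_rotBy_of_rotationGroup ρ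
    rw [hv]
    exact hπ.permCongr v
  · obtain ⟨d, hd, hρ, hdg, hfix⟩ := AnnularNC.exists_smul_eq_iff ρ
    have hω : IsPrimitiveRoot (w ρ : ℂ) d := by
      rw [← hρ, ← orderOf_injective w hw, ← orderOf_units]
      exact IsPrimitiveRoot.orderOf _
    have hp : ∀ b, AnnularNC.per n m b = d * (AnnularNC.per n m b / d) := fun b =>
      (Nat.mul_div_cancel' (hdg.trans (AnnularNC.gcd_dvd_per n m b))).symm
    have hcount := hA.mul_eval_eq hB hd hω hp
    rw [← AnnularNC.mul_ncard_fixed hA hp, Nat.cast_mul] at hcount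
    rw [mul_left_cancel₀ (Nat.cast_ne_zero.2 hc.ne') hcount, hX]
    simp only [Set.mem_ofPred_eq, hfix]
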